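/- Let $R$ be a (unital, not necessarily commutative) topological ring and let $n\in\mathbb N$. Consider $R$ with its full set-theoretic structure (all subsets of all $R^m$ are $0$-definable; language $\mathcal L$), and let $\bar R\succ R$ be a $\kappa$-saturated and strongly $\kappa$-homogeneous elementary extension, where $\kappa>|R|+|\mathcal L|$ is a strong limit cardinal. A set of parameters is small if it has fewer than $\kappa$ elements; a set is $A$-type-definable if it is an intersection of $A$-definable sets; a subgroup has bounded index if its index is less than $\kappa$. For a definable set $X$ let $\bar X$ be its interpretation in $\bar R$. Let $\mathrm{UT}_n(S)$ be the group of upper unitriangular $n\times n$ matrices over a ring $S$; $\mathrm{UT}_n(R)$ has the topology induced from the product topology on matrices. For $G=\mathrm{UT}_n(R)$ or $G=(R,+)$, let $\bar G^{00}_{topo}$ be the smallest bounded index subgroup of $\bar G$ that is an intersection of sets of the form $\bar U$ with $U$ open in $G$ (such a smallest subgroup exists). Define subgroups of $B:=(\bar R,+)$ by $I_1:=(\bar R,+)^{00}_{topo}$ and, for $i\ge 1$, $I_{i+1}:=$ the smallest $0$-type-definable subgroup of $(\bar R,+)$ containing $\bar R\cdot I_i$. Quotients carry the logic topology, whose closed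 sets are exactly the sets whose preimage is type-definable over a small set of parameters. Then: 1. $\mathrm{UT}_n(\bar R)^{00}_{topo}$ is a normal subgroup of $\mathrm{UT}_n(\bar R)$, and the natural map $\mathrm{UT}_n(R)\to \mathrm{UT}_n(\bar R)/\mathrm{UT}_n(\bar R)^{00}_{topo}$ is the Bohr compactification of the topological group $\mathrm{UT}_n(R)$, that is, the universal continuous homomorphism with dense image into a compact Hausdorff topological group. 2. For $i,j\ge 1$ and $k>\max(i,j)$ the product $(a+I_i)(b+I_j):=ab+I_k$ of cosets is well defined, and with these products matrix multiplication makes the set $H$ of upper unitriangular matrices whose $(i,j)$ entry for $i<j$ is in $B/I_{j-i}$, $$H=\begin{pmatrix}1&B/I_1&B/I_2&\cdots&B/I_{n-1}\\0&1&B/I_1&\cdots&B/I_{n-2}\\ \vdots&\vdots&\vdots&\ddots&\vdots\\0&0&0&\cdots&B/I_1\\0&0&0&\cdots&1\end{pmatrix},$$ a group. With the product of the logic topologies on $H$, the map that sends the class of a matrix $(a_{ij})$ to the matrix with $(i,j)$ entry $a_{ij}+I_{j-i}$ for $i<j$ is an isomorphism of topological groups $\mathrm{UT}_n(\bar R)/\mathrm{UT}_n(\bar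 R)^{00}_{topo}\cong H$. 3. The natural map $(R,+)\to B/I_1$ is the Bohr compactification of the topological group $(R,+)$. -/

import Mathlib

open FirstOrder FirstOrder.Language

universe u v w

/-! ### Compactifications of topological groups -/

/-- `φ : G → K` is a compactification of `G`: `K` is a compact Hausdorff topological group and `φ`
is a continuous homomorphism with dense image. -/
@[to_additive IsAddCompactification /-- `φ : G → K` is a compactification of the additive group `G`:
`K` is a compact Hausdorff topological group and `φ` is a continuous homomorphism with dense
image. -/]
def IsGroupCompactification {G : Type*} [Group G] [TopologicalSpace G] {K : Type*} [Group K]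
    [TopologicalSpace K] (φ : G →* K) : Prop :=
  IsTopologicalGroup K ∧ CompactSpace K ∧ T2Space K ∧ Continuous φ ∧ DenseRange φ

/-- `φ : G → K` is the Bohr compactification of `G`: a compactification through which every
compactification `φ'` factors by a unique continuous homomorphism. -/
@[to_additive IsAddBohrCompactification /-- `φ : G → K` is the Bohr compactification of the additive
group `G`: a compactification through which every compactification `φ'` factors by a unique
continuous homomorphism. -/]
def IsBohrCompactification {G : Type u} [Group G] [TopologicalSpace G] {K : Type v} [Group K]
    [TopologicalSpace K] (φ : G →* K) : Prop :=
  IsGroupCompactification φ ∧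
    ∀ (K' : Type w) [Group K'] [TopologicalSpace K'] (φ' : G →* K'),
      IsGroupCompactification φ' → ∃! f : K →ₜ* K', ∀ g, f (φ g) = φ' g

/-! ### The group of upper unitriangular matrices -/

section Unitriangular

variable (n : ℕ) (S : Type*) [Ring S]

/-- The upper unitriangular `n × n` matrices over a (not necessarily commutative) ring. -/
def UT : Submonoid (Matrix (Fin n) (Fin n) S) where
  carrier := {A | (∀ i, A i i = 1) ∧ ∀ i j, j < i → A i j = 0}
  one_mem' := ⟨fun i => Matrix.one_apply_eq i, fun _ _ h => Matrix.one_apply_ne h.ne'⟩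
  mul_mem' := by
    rintro A B ⟨hA, hA'⟩ ⟨hB, hB'⟩
    refine ⟨fun i => ?_, fun i j hij => ?_⟩
    · rw [Matrix.mul_apply, Finset.sum_eq_single i]
      · rw [hA, hB, one_mul]
      · intro k _ hk
        rcases lt_or_gt_of_ne hk with h | h
        · rw [hA' i k h, zero_mul]
        · rw [hB' k i h, mul_zero]
      · simp
    · rw [Matrix.mul_apply]
      refine Finset.sum_eq_zero fun k _ => ?_
      rcases lt_or_ge k i with h | h
      · rw [hA' i k h, zero_mul]
      · rw [hB' k j (hij.trans_le h), mul_zero]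

variable {n S}

theorem UT.one_sub_pow_apply (A : UT n S) (k : ℕ) (i j : Fin n) (h : (j : ℕ) < i + k) :
    ((1 - (A : Matrix (Fin n) (Fin n) S)) ^ k) i j = 0 := by
  induction k generalizing i j with
  | zero => rw [pow_zero]; exact Matrix.one_apply_ne (by rintro rfl; omega)
  | succ k ih =>
    rw [pow_succ, Matrix.mul_apply]
    refine Finset.sum_eq_zero fun l _ => ?_
    by_cases hl : (l : ℕ) < i + k
    · rw [ih i l hl, zero_mul]
    · have hjl : j ≤ l := by rw [Fin.le_def]; omega
      have : (1 - (A : Matrix (Fin n) (Fin n) S)) l j = 0 := by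
        rcases hjl.eq_or_lt with h' | h'
        · subst h'
          rw [Matrix.sub_apply, Matrix.one_apply_eq, A.2.1 j, sub_self]
        · rw [Matrix.sub_apply, Matrix.one_apply_ne h'.ne', A.2.2 _ _ h', sub_self]
      rw [this, mul_zero]

theorem UT.one_sub_pow_eq_zero (A : UT n S) : (1 - (A : Matrix (Fin n) (Fin n) S)) ^ n = 0 := by
  ext i j
  exact UT.one_sub_pow_apply A n i j (by omega)

/-- The inverse of a unitriangular matrix `A` is `∑ (1 - A) ^ k`. -/
def UT.inverse (A : UT n S) : UT n S :=
  ⟨∑ k ∈ Finset.range n, (1 - (A : Matrix (Fin n) (Fin n) S)) ^ k, by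
    refine ⟨fun i => ?_, fun i j hij => ?_⟩
    · rw [Matrix.sum_apply, Finset.sum_eq_single 0]
      · rw [pow_zero, Matrix.one_apply_eq]
      · intro k _ hk
        exact UT.one_sub_pow_apply A k i i (by omega)
      · intro h
        exact absurd (Finset.mem_range.2 i.pos) h
    · rw [Matrix.sum_apply]
      exact Finset.sum_eq_zero fun k _ =>
        UT.one_sub_pow_apply A k i j (by have := Fin.lt_def.1 hij; omega)⟩

instance UT.instGroup : Group (UT n S) :=
  { (inferInstance : Monoid (UT n S)) with
    inv := UT.inverse
    inv_mul_cancel := fun A => by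
      have h := geom_sum_mul_neg (1 - (A : Matrix (Fin n) (Fin n) S)) n
      rw [UT.one_sub_pow_eq_zero A, sub_sub_cancel, sub_zero] at h
      exact Subtype.ext h }

/-- The group homomorphism obtained by applying a ring homomorphism to all entries. -/
def UT.map {T : Type*} [Ring T] (f : S →+* T) : UT n S →* UT n T where
  toFun A := ⟨f.mapMatrix A.1, fun i => by simp [A.2.1 i], fun i j h => by simp [A.2.2 i j h]⟩
  map_one' := Subtype.ext (map_one f.mapMatrix)
  map_mul' A B := Subtype.ext (map_mul f.mapMatrix A.1 B.1)

/-- The entries of a unitriangular matrix, as a tuple. -/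
def UT.coords (A : UT n S) : Fin n × Fin n → S := fun p => A.1 p.1 p.2

end Unitriangular

/-! ### The full set-theoretic structure and its monster model -/

/-- The language of the full set-theoretic structure on `R`: a symbol for every subset of every
`R ^ n` and for every operation `R ^ n → R`. -/
def fullLanguage (R : Type u) : FirstOrder.Language.{u, u} where
  Functions n := (Fin n → R) → R
  Relations n := Set (Fin n → R)

/-- `R` with its full set-theoretic structure: each symbol names itself. -/
instance fullStructure (R : Type u) : (fullLanguage R).Structure R where
  funMap f x := f x
  RelMap {n} (s : Set (Fin n → R)) x := x ∈ s

/-- A monster model: a `κ`-saturated and strongly `κ`-homogeneous elementary extension of `R` with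
its full set-theoretic structure, for a strong limit cardinal `κ` greater than the cardinalities of
`R` and of the language. -/
structure MonsterModel (R : Type u) where
  /-- the degree of saturation -/
  κ : Cardinal.{v}
  isStrongLimit : κ.IsStrongLimit
  lt_κ : Cardinal.lift.{v} (Cardinal.mk R + (fullLanguage R).card) < Cardinal.lift.{u} κ
  /-- the underlying set of the extension -/
  carrier : Type v
  [str : (fullLanguage R).Structure carrier]
  /-- the elementary embedding -/
  emb : R ↪ₑ[fullLanguage R] carrier
  /-- every family of sets definable over a fixed small set that has the finite intersection
  property has a common point -/
  saturated : ∀ A : Set carrier, Cardinal.mk A < κ → ∀ 𝒟 : Set (Set carrier),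
    (∀ D ∈ 𝒟, A.Definable₁ (fullLanguage R) D) →
    (∀ ℱ ⊆ 𝒟, ℱ.Finite → (⋂₀ ℱ).Nonempty) → (⋂₀ 𝒟).Nonempty
  /-- every elementary map defined on a small set extends to an automorphism -/
  homogeneous : ∀ A : Set carrier, Cardinal.mk A < κ → ∀ f : A → carrier,
    (∀ φ : (fullLanguage R).Formula A, φ.Realize (fun a : A => (a : carrier)) ↔ φ.Realize f) →
    ∃ σ : carrier ≃[fullLanguage R] carrier, ∀ a : A, σ a = f a

namespace MonsterModel

section Ring

variable {R : Type u} (𝓜 : MonsterModel.{u, v} R)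

instance instStructure : (fullLanguage R).Structure 𝓜.carrier := 𝓜.str

/-- An identity between terms that holds in `R` holds in the elementary extension. -/
theorem transfer {k : ℕ} (s t : (fullLanguage R).Term (Fin k))
    (h : ∀ x : Fin k → R, s.realize x = t.realize x) (x : Fin k → 𝓜.carrier) :
    s.realize x = t.realize x := by
  let φ : (fullLanguage R).BoundedFormula Empty k :=
    (s.relabel Sum.inr).bdEqual (t.relabel Sum.inr)
  have hR : R ⊨ φ.alls := by
    simp only [Language.Sentence.Realize, FirstOrder.Language.BoundedFormula.realize_alls, φ,
      FirstOrder.Language.BoundedFormula.realize_bdEqual, FirstOrder.Language.Term.realize_relabel, Sum.elim_comp_inr]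
    exact h
  have hN : 𝓜.carrier ⊨ φ.alls := (𝓜.emb.map_sentence _).1 hR
  simp only [Language.Sentence.Realize, FirstOrder.Language.BoundedFormula.realize_alls, φ,
      FirstOrder.Language.BoundedFormula.realize_bdEqual, FirstOrder.Language.Term.realize_relabel,
      Sum.elim_comp_inr] at hN
  exact hN x

/-- The interpretation in the extension of an operation on `R`. -/
def op {k : ℕ} (f : (Fin k → R) → R) (x : Fin k → 𝓜.carrier) : 𝓜.carrier :=
  FirstOrder.Language.Structure.funMap (L := fullLanguage R) f x

theorem emb_op {k : ℕ} (f : (Fin k → R) → R) (x : Fin k → R) :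
    𝓜.emb (f x) = 𝓜.op f (fun i => 𝓜.emb (x i)) :=
  𝓜.emb.map_fun (n := k) f x

variable [Ring R]

instance (priority := low) : Add 𝓜.carrier := ⟨fun a b => 𝓜.op (fun x : Fin 2 → R => x 0 + x 1) ![a, b]⟩
instance (priority := low) : Mul 𝓜.carrier := ⟨fun a b => 𝓜.op (fun x : Fin 2 → R => x 0 * x 1) ![a, b]⟩
instance (priority := low) : Neg 𝓜.carrier := ⟨fun a => 𝓜.op (fun x : Fin 1 → R => - x 0) ![a]⟩
instance (priority := low) : Zero 𝓜.carrier := ⟨𝓜.op (fun _ : Fin 0 → R => 0) ![]⟩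
instance (priority := low) : One 𝓜.carrier := ⟨𝓜.op (fun _ : Fin 0 → R => 1) ![]⟩

/-- Polynomial expressions over the ring symbols, used to transfer identities. -/
inductive RingExpr (k : ℕ) : Type
  | var (i : Fin k)
  | add (s t : RingExpr k)
  | mul (s t : RingExpr k)
  | neg (s : RingExpr k)
  | zero
  | one

/-- The value of an expression. -/
def RingExpr.eval {S : Type*} [Add S] [Mul S] [Neg S] [Zero S] [One S] {k : ℕ} (x : Fin k → S) :
    RingExpr k → S
  | var i => x i
  | add s t => s.eval x + t.eval x
  | mul s t => s.eval x * t.eval x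
  | neg s => - s.eval x
  | zero => 0
  | one => 1

/-- The term of the full language that corresponds to an expression. -/
def RingExpr.toTerm (R : Type u) [Ring R] {k : ℕ} :
    RingExpr k → (fullLanguage R).Term (Fin k)
  | var i => Term.var i
  | add s t => Term.func (L := fullLanguage R) (l := 2) (fun x : Fin 2 → R => x 0 + x 1)
      ![s.toTerm R, t.toTerm R]
  | mul s t => Term.func (L := fullLanguage R) (l := 2) (fun x : Fin 2 → R => x 0 * x 1)
      ![s.toTerm R, t.toTerm R]
  | neg s => Term.func (L := fullLanguage R) (l := 1) (fun x : Fin 1 → R => - x 0) ![s.toTerm R]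
  | zero => Term.func (L := fullLanguage R) (l := 0) (fun _ : Fin 0 → R => 0) ![]
  | one => Term.func (L := fullLanguage R) (l := 0) (fun _ : Fin 0 → R => 1) ![]

theorem RingExpr.realize_base {k : ℕ} (x : Fin k → R) (s : RingExpr k) :
    (s.toTerm R).realize x = s.eval x := by
  induction s with
  | var i => rfl
  | add s t hs ht => rw [eval, ← hs, ← ht]; rfl
  | mul s t hs ht => rw [eval, ← hs, ← ht]; rfl
  | neg s hs => rw [eval, ← hs]; rfl
  | zero => rfl
  | one => rfl

theorem RingExpr.realize_ext {k : ℕ} (x : Fin k → 𝓜.carrier) (s : RingExpr k) :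
    (s.toTerm R).realize x = s.eval x := by
  induction s with
  | var i => rfl
  | add s t hs ht =>
    rw [eval, ← hs, ← ht]
    exact congrArg (𝓜.op _) (by ext i; fin_cases i <;> rfl)
  | mul s t hs ht =>
    rw [eval, ← hs, ← ht]
    exact congrArg (𝓜.op _) (by ext i; fin_cases i <;> rfl)
  | neg s hs =>
    rw [eval, ← hs]
    exact congrArg (𝓜.op _) (by ext i; fin_cases i; rfl)
  | zero => exact congrArg (𝓜.op _) (Subsingleton.elim _ _)
  | one => exact congrArg (𝓜.op _) (Subsingleton.elim _ _)

theorem transfer_expr {k : ℕ} (s t : RingExpr k) (h : ∀ x : Fin k → R, s.eval x = t.eval x)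
    (x : Fin k → 𝓜.carrier) : s.eval x = t.eval x := by
  rw [← RingExpr.realize_ext, ← RingExpr.realize_ext]
  refine 𝓜.transfer _ _ (fun y => ?_) x
  rw [RingExpr.realize_base, RingExpr.realize_base, h]

open RingExpr in
/-- The ring structure of the elementary extension: its operations are the interpretations of the
operations of `R`. -/
instance instRing : Ring 𝓜.carrier :=
  Ring.ofMinimalAxioms
    (fun a b c => 𝓜.transfer_expr (.add (.add (var 0) (var 1)) (var 2))
      (.add (var 0) (.add (var 1) (var 2))) (fun _ => add_assoc _ _ _) ![a, b, c])
    (fun a => 𝓜.transfer_expr (.add .zero (var 0)) (var 0) (fun _ => zero_add _) ![a])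
    (fun a => 𝓜.transfer_expr (.add (.neg (var 0)) (var 0)) .zero
      (fun _ => neg_add_cancel _) ![a])
    (fun a b c => 𝓜.transfer_expr (.mul (.mul (var 0) (var 1)) (var 2))
      (.mul (var 0) (.mul (var 1) (var 2))) (fun _ => mul_assoc _ _ _) ![a, b, c])
    (fun a => 𝓜.transfer_expr (.mul .one (var 0)) (var 0) (fun _ => one_mul _) ![a])
    (fun a => 𝓜.transfer_expr (.mul (var 0) .one) (var 0) (fun _ => mul_one _) ![a])
    (fun a b c => 𝓜.transfer_expr (.mul (var 0) (.add (var 1) (var 2)))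
      (.add (.mul (var 0) (var 1)) (.mul (var 0) (var 2))) (fun _ => mul_add _ _ _) ![a, b, c])
    (fun a b c => 𝓜.transfer_expr (.mul (.add (var 0) (var 1)) (var 2))
      (.add (.mul (var 0) (var 2)) (.mul (var 1) (var 2))) (fun _ => add_mul _ _ _) ![a, b, c])

/-- The elementary embedding, as a ring homomorphism. -/
def embHom : R →+* 𝓜.carrier where
  toFun := 𝓜.emb
  map_one' := (𝓜.emb_op (fun _ : Fin 0 → R => 1) ![]).trans
    (congrArg (𝓜.op _) (Subsingleton.elim _ _))
  map_zero' := (𝓜.emb_op (fun _ : Fin 0 → R => 0) ![]).trans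
    (congrArg (𝓜.op _) (Subsingleton.elim _ _))
  map_add' a b := (𝓜.emb_op (fun x : Fin 2 → R => x 0 + x 1) ![a, b]).trans
    (congrArg (𝓜.op _) (by ext i; fin_cases i <;> rfl))
  map_mul' a b := (𝓜.emb_op (fun x : Fin 2 → R => x 0 * x 1) ![a, b]).trans
    (congrArg (𝓜.op _) (by ext i; fin_cases i <;> rfl))

end Ring

/-! ### Interpretations, type-definable sets, logic topology -/

section Definability

variable {R : Type u} (𝓜 : MonsterModel.{u, v} R)

/-- The interpretation `X̄` in the extension of a set `X` of tuples from `R`: the set defined in the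
extension by a formula that defines `X` in `R`. -/
def interp {α : Type} (X : Set (α → R)) : Set (α → 𝓜.carrier) :=
  {x | ∃ φ : (fullLanguage R).Formula α, (∀ y : α → R, φ.Realize y ↔ y ∈ X) ∧ φ.Realize x}

/-- `Y` is `A`-type-definable: an intersection of `A`-definable sets. -/
def IsTypeDefinable (A : Set 𝓜.carrier) {α : Type} (Y : Set (α → 𝓜.carrier)) : Prop :=
  ∃ 𝒟 : Set (Set (α → 𝓜.carrier)), (∀ D ∈ 𝒟, A.Definable (fullLanguage R) D) ∧ Y = ⋂₀ 𝒟

/-- `Y` is type-definable over some small set of parameters. -/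
def IsSmallTypeDefinable {α : Type} (Y : Set (α → 𝓜.carrier)) : Prop :=
  ∃ A : Set 𝓜.carrier, Cardinal.mk A < 𝓜.κ ∧ 𝓜.IsTypeDefinable A Y

/-- Let `G` be a topological group whose elements are tuples from `R` via `c`, and let `G'` be its
interpretation in the extension, whose elements are tuples via `c'`. The subgroups of `G'` of bounded
index that are intersections of sets of the form `Ū`, with `U` open in `G`. -/
@[to_additive IsAddTopoSubgroup /-- Let `G` be an additive topological group whose elements are
tuples from `R` via `c`, and let `G'` be its interpretation in the extension, whose elements are
tuples via `c'`. The subgroups of `G'` of bounded index that are intersections of sets of the form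
`Ū`, with `U` open in `G`. -/]
def IsTopoSubgroup {α : Type} {G : Type u} [TopologicalSpace G] {G' : Type v} [Group G']
    (c : G → α → R) (c' : G' → α → 𝓜.carrier) (H : Subgroup G') : Prop :=
  Cardinal.mk (G' ⧸ H) < 𝓜.κ ∧
    ∃ 𝒰 : Set (Set G), (∀ U ∈ 𝒰, IsOpen U) ∧ (H : Set G') = ⋂ U ∈ 𝒰, c' ⁻¹' 𝓜.interp (c '' U)

/-- The topological connected component `Ḡ⁰⁰_topo`: the smallest bounded index subgroup of `Ḡ` that
is an intersection of sets of the form `Ū`, with `U` open in `G`. -/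
@[to_additive addTopoComponent /-- The topological connected component `Ḡ⁰⁰_topo`: the smallest
bounded index subgroup of `Ḡ` that is an intersection of sets of the form `Ū`, with `U` open in
`G`. -/]
def topoComponent {α : Type} {G : Type u} [TopologicalSpace G] {G' : Type v} [Group G']
    (c : G → α → R) (c' : G' → α → 𝓜.carrier) : Subgroup G' :=
  sInf {H | 𝓜.IsTopoSubgroup c c' H}

/-- The sets closed in the logic topology on `G' ⧸ H`: those whose preimage in `G'` is type-definable
over a small set of parameters. -/
@[to_additive IsAddLogicClosed /-- The sets closed in the logic topology on `G' ⧸ H`: those whose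
preimage in `G'` is type-definable over a small set of parameters. -/]
def IsLogicClosed {α : Type} {G' : Type v} [Group G'] (c' : G' → α → 𝓜.carrier) (H : Subgroup G')
    (C : Set (G' ⧸ H)) : Prop :=
  𝓜.IsSmallTypeDefinable (c' '' ((fun g : G' => (g : G' ⧸ H)) ⁻¹' C))

/-- The logic topology on `G' ⧸ H`, as the topology generated by the complements of the sets in
`IsLogicClosed`. (For the quotients considered below, the closed sets are exactly these sets.) -/
@[to_additive addLogicTopology /-- The logic topology on `G' ⧸ H`, as the topology generated by the
complements of the sets in `IsAddLogicClosed`. (For the quotients considered below, the closed sets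
are exactly these sets.) -/]
abbrev logicTopology {α : Type} {G' : Type v} [Group G'] (c' : G' → α → 𝓜.carrier)
    (H : Subgroup G') : TopologicalSpace (G' ⧸ H) :=
  TopologicalSpace.generateFrom {V | 𝓜.IsLogicClosed c' H Vᶜ}

end Definability

/-! ### The components of `UT n R̄` and of `(R̄, +)` -/

section Components

variable {R : Type u} [Ring R] (𝓜 : MonsterModel.{u, v} R)

/-- The smallest `0`-type-definable subgroup of `(R̄, +)` that contains `R̄ · J`. -/
def genTypeDefinable (J : AddSubgroup 𝓜.carrier) : AddSubgroup 𝓜.carrier :=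
  sInf {H | 𝓜.IsTypeDefinable ∅ ((fun (x : 𝓜.carrier) (_ : Fin 1) => x) '' (H : Set 𝓜.carrier)) ∧
    ∀ r : 𝓜.carrier, ∀ x ∈ J, r * x ∈ H}

variable [TopologicalSpace R]

/-- The sequence `I₁ = (R̄, +)⁰⁰_topo`, `Iᵢ₊₁` the smallest `0`-type-definable subgroup of `(R̄, +)`
that contains `R̄ · Iᵢ`. The value at `0` is not used. -/
def I : ℕ → AddSubgroup 𝓜.carrier
  | 0 => ⊥
  | 1 => 𝓜.addTopoComponent (fun (x : R) (_ : Fin 1) => x)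
      (fun (x : 𝓜.carrier) (_ : Fin 1) => x)
  | i + 2 => 𝓜.genTypeDefinable (I (i + 1))

/-- The logic topology on `(R̄, +) / Iᵢ`. -/
instance (i : ℕ) : TopologicalSpace (𝓜.carrier ⧸ 𝓜.I i) :=
  𝓜.addLogicTopology (fun (x : 𝓜.carrier) (_ : Fin 1) => x) (𝓜.I i)

/-- The component `UT n (R̄)⁰⁰_topo`; the topology on `UT n R` is induced from the product topology
on matrices. -/
def utComponent (n : ℕ) : Subgroup (UT n 𝓜.carrier) :=
  𝓜.topoComponent (G := UT n R) UT.coords UT.coords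

/-- The logic topology on `UT n (R̄) / UT n (R̄)⁰⁰_topo`. -/
instance (n : ℕ) : TopologicalSpace (UT n 𝓜.carrier ⧸ 𝓜.utComponent n) :=
  𝓜.logicTopology UT.coords (𝓜.utComponent n)

/-- The unitriangular matrices whose `(i, j)` entry, for `i < j`, is in `(R̄, +) / I_{j - i}`. Such a
matrix is given by its entries above the diagonal; the topology is the product topology. -/
abbrev CosetMatrix (n : ℕ) : Type v :=
  (p : {p : Fin n × Fin n // p.1 < p.2}) → 𝓜.carrier ⧸ 𝓜.I ((p.1.2 : ℕ) - (p.1.1 : ℕ))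

/-- The matrix of the cosets of the entries of a unitriangular matrix over `R̄`. -/
def toCosetMatrix {n : ℕ} (A : UT n 𝓜.carrier) : 𝓜.CosetMatrix n :=
  fun p => (A.1 p.1.1 p.1.2 : 𝓜.carrier ⧸ 𝓜.I ((p.1.2 : ℕ) - (p.1.1 : ℕ)))

/-- The product `(a + Iᵢ)(b + Iⱼ) = ab + Iₖ`, computed with representatives. -/
noncomputable def cosetMul {i j : ℕ} (k : ℕ) (x : 𝓜.carrier ⧸ 𝓜.I i) (y : 𝓜.carrier ⧸ 𝓜.I j) :
    𝓜.carrier ⧸ 𝓜.I k :=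
  ((Quotient.out x * Quotient.out y : 𝓜.carrier) : 𝓜.carrier ⧸ 𝓜.I k)

/-- Matrix multiplication of unitriangular matrices of cosets: for `i < j`, the `(i, j)` entry is
`x i j + y i j + ∑_{i < k < j} x i k * y k j`, the products being taken in `(R̄, +) / I_{j - i}`. -/
noncomputable def cosetMatrixMul {n : ℕ} (x y : 𝓜.CosetMatrix n) : 𝓜.CosetMatrix n :=
  fun p => x p + y p + ∑ k : {k : Fin n // p.1.1 < k ∧ k < p.1.2},
    𝓜.cosetMul ((p.1.2 : ℕ) - (p.1.1 : ℕ)) (x ⟨(p.1.1, k.1), k.2.1⟩) (y ⟨(k.1, p.1.2), k.2.2⟩)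

end Components

end MonsterModel

/-! The proof identifies `0`-type-definable sets in the monster model with monads of filters on the
ground structure. As every subset of every `R ^ m` is named, the type of a tuple over `R` is an
ultrafilter, `Code.tp`. The `0`-type-definable sets are the sets `Code.monad f` of elements
whose type refines a filter `f`, and saturation makes `f` unique (`Code.monad_subset_ext`). In
this language a subgroup that is type-definable without parameters has bounded index exactly
when elements of equal type are in the same coset (`Code.IsTypeInvariant`): if the index is
bounded, finitely many translates by elements of the ground group of any set whose
interpretation contains the subgroup cover the ground group
(`Code.IsGroupCode.exists_finite_cover`). Type invariance passes to intersections, hence there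
is a smallest topological subgroup, in the sense of `MonsterModel.IsTopoSubgroup`. It is normal
because it is invariant under conjugation by the ground group, which approximates the whole
group by the covering property. The quotient is compact, being an image of the space of
ultrafilters, and Hausdorff; every homomorphism to a compact group extends to the interpretation
by limits along types, and the kernel of the extension of a continuous homomorphism is a
topological subgroup, which gives the universal property
(`Code.IsGroupLogicQuotient.isBohrCompactification`).

For the description of the component of `UT n R̄`, the groups `I i` have to absorb
multiplication from the right although they are defined by multiplication from the left. The
essential case is `I 1 * R̄ ⊆ I 2` (`MonsterModel.mul_mem_I_two`). Compact abelian groups have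
enough finite dimensional representations, by the Peter-Weyl argument with a compact operator
that commutes with translations. Therefore an element outside `I 2` is detected by a length
function on `R̄ / I 2` without small subgroups, and for such a length the condition "the length
vanishes on `r * R`" is an open condition on `r` that defines a subgroup of bounded index. The
inclusion for larger indices follows by induction.

Consequently the matrices whose `(i, j)` entries are in `I (j - i)` form a topological subgroup
of `UT n R̄`, which therefore contains the component. Conversely the component contains the
elementary matrices with entries in `I (j - i)`, by induction on `j - i`: the commutator of
elementary matrices with entries `r` and `x` has the entry `r * x`, and `I (i + 1)` is generated
by `R̄ * I i` as a type-definable group. These elementary matrices generate that subgroup, by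
row operations (`MonsterModel.utComponent_eq_levelSubgroup`). -/

/-! ### Interpretations of sets and functions in the elementary extension -/

namespace MonsterModel

section Interp

variable {R : Type u} (𝓜 : MonsterModel.{u, v} R) {α β γ : Type}

/-- Formulas that are equivalent in `R` are equivalent in the extension. -/
theorem realize_iff_of_forall [Finite α] (φ ψ : (fullLanguage R).Formula α)
    (h : ∀ y : α → R, φ.Realize y ↔ ψ.Realize y) (x : α → 𝓜.carrier) :
    φ.Realize x ↔ ψ.Realize x := by
  let χ : (fullLanguage R).Formula (Empty ⊕ α) := (φ.iff ψ).relabel Sum.inr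
  have hR : R ⊨ (χ.iAlls α : (fullLanguage R).Sentence) := by
    rw [Language.Sentence.Realize, Formula.realize_iAlls]
    intro y
    simp only [χ, Formula.realize_relabel, Formula.realize_iff]
    exact h y
  have hM : 𝓜.carrier ⊨ (χ.iAlls α : (fullLanguage R).Sentence) := (𝓜.emb.map_sentence _).1 hR
  rw [Language.Sentence.Realize, Formula.realize_iAlls] at hM
  have := hM x
  simp only [χ, Formula.realize_relabel, Formula.realize_iff] at this
  exact this

theorem mem_interp_iff [Finite α] {X : Set (α → R)} (φ : (fullLanguage R).Formula α)
    (h : ∀ y : α → R, φ.Realize y ↔ y ∈ X) (x : α → 𝓜.carrier) :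
    x ∈ 𝓜.interp X ↔ φ.Realize x :=
  ⟨fun ⟨ψ, hψ, hx⟩ => (𝓜.realize_iff_of_forall ψ φ (fun y => (hψ y).trans (h y).symm) x).1 hx,
    fun hx => ⟨φ, h, hx⟩⟩

theorem exists_formula [Finite α] (X : Set (α → R)) :
    ∃ φ : (fullLanguage R).Formula α, ∀ y : α → R, φ.Realize y ↔ y ∈ X := by
  let e := Finite.equivFin α
  refine ⟨Relations.formula (L := fullLanguage R) (n := Nat.card α)
    ({y | y ∘ e ∈ X} : Set (Fin (Nat.card α) → R)) (fun i => Term.var (e.symm i)), fun y => ?_⟩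
  refine Formula.realize_rel.trans ?_
  change (fun i => y (e.symm i)) ∘ e ∈ X ↔ y ∈ X
  have : (fun i => y (e.symm i)) ∘ e = y := by ext a; simp
  rw [this]

theorem interp_compl [Finite α] (X : Set (α → R)) : 𝓜.interp Xᶜ = (𝓜.interp X)ᶜ := by
  obtain ⟨φ, hφ⟩ := exists_formula X
  ext x
  rw [Set.mem_compl_iff, 𝓜.mem_interp_iff φ hφ, 𝓜.mem_interp_iff φ.not (fun y => by simp [hφ]),
    Formula.realize_not]

theorem interp_inter [Finite α] (X Y : Set (α → R)) :
    𝓜.interp (X ∩ Y) = 𝓜.interp X ∩ 𝓜.interp Y := by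
  obtain ⟨φ, hφ⟩ := exists_formula X
  obtain ⟨ψ, hψ⟩ := exists_formula Y
  ext x
  rw [Set.mem_inter_iff, 𝓜.mem_interp_iff φ hφ, 𝓜.mem_interp_iff ψ hψ,
    𝓜.mem_interp_iff (φ ⊓ ψ) (fun y => by simp [hφ, hψ]), Formula.realize_inf]

theorem interp_univ [Finite α] : 𝓜.interp (Set.univ : Set (α → R)) = Set.univ :=
  Set.eq_univ_of_forall fun _ => ⟨⊤, fun _ => by simp, by simp⟩

theorem interp_iInter [Finite α] {κ : Type*} [Finite κ] (X : κ → Set (α → R)) :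
    𝓜.interp (⋂ k, X k) = ⋂ k, 𝓜.interp (X k) := by
  classical
  have := Fintype.ofFinite κ
  have h : ∀ s : Finset κ, 𝓜.interp (⋂ k ∈ s, X k) = ⋂ k ∈ s, 𝓜.interp (X k) := by
    intro s
    induction s using Finset.induction_on with
    | empty => simp [interp_univ]
    | insert a s _ ih => rw [Finset.set_biInter_insert, interp_inter, ih, Finset.set_biInter_insert]
  simpa using h Finset.univ

theorem emb_mem_interp [Finite α] {X : Set (α → R)} {y : α → R} :
    (fun a => 𝓜.emb (y a)) ∈ 𝓜.interp X ↔ y ∈ X := by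
  obtain ⟨φ, hφ⟩ := exists_formula X
  rw [𝓜.mem_interp_iff φ hφ, ← hφ y]
  exact 𝓜.emb.map_formula φ y

/-- The term that names an operation on `R` whose arguments are indexed by a finite type. -/
noncomputable def opTerm [Finite α] (f : (α → R) → R) : (fullLanguage R).Term α :=
  Term.func (L := fullLanguage R) (l := Nat.card α)
    (fun y : Fin (Nat.card α) → R => f (y ∘ Finite.equivFin α))
    (fun i => Term.var ((Finite.equivFin α).symm i))

theorem realize_opTerm_base [Finite α] (f : (α → R) → R) (y : α → R) :
    (opTerm f).realize y = f y := by
  change f ((fun i => y ((Finite.equivFin α).symm i)) ∘ Finite.equivFin α) = f y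
  congr 1
  ext a
  simp

/-- The extension to `R̄` of a function from tuples to tuples. -/
noncomputable def hat [Finite α] (F : (α → R) → β → R) (x : α → 𝓜.carrier) (b : β) : 𝓜.carrier :=
  (opTerm fun y => F y b).realize x

/-- An identity between terms in finitely many variables transfers to the extension. -/
theorem realize_eq_of_forall [Finite α] (s t : (fullLanguage R).Term α)
    (h : ∀ y : α → R, s.realize y = t.realize y) (x : α → 𝓜.carrier) :
    s.realize x = t.realize x := by
  have := (𝓜.realize_iff_of_forall (s.equal t) ⊤ (fun y => by
    rw [Formula.realize_equal]; simp [h]) x).2 (by simp)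
  rwa [Formula.realize_equal] at this

theorem hat_mem_interp [Finite α] [Finite β] (F : (α → R) → β → R) (X : Set (β → R))
    (x : α → 𝓜.carrier) : 𝓜.hat F x ∈ 𝓜.interp X ↔ x ∈ 𝓜.interp (F ⁻¹' X) := by
  obtain ⟨φ, hφ⟩ := exists_formula X
  rw [𝓜.mem_interp_iff φ hφ, 𝓜.mem_interp_iff (φ.subst fun b => opTerm fun y => F y b)]
  · exact (BoundedFormula.realize_subst).symm
  · intro y
    refine BoundedFormula.realize_subst.trans ?_
    simp only [realize_opTerm_base]
    exact hφ _

theorem hat_comp [Finite α] [Finite β] (F : (α → R) → β → R) (G : (β → R) → γ → R)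
    (x : α → 𝓜.carrier) : 𝓜.hat G (𝓜.hat F x) = 𝓜.hat (fun y => G (F y)) x := by
  ext c
  have := 𝓜.realize_eq_of_forall ((opTerm fun y => G y c).subst fun b => opTerm fun y => F y b)
    (opTerm fun y => G (F y) c) (fun y => by simp [realize_opTerm_base]) x
  rw [Term.realize_subst] at this
  exact this

theorem hat_reindex [Finite α] (ρ : β → α) (x : α → 𝓜.carrier) :
    𝓜.hat (fun y b => y (ρ b)) x = fun b => x (ρ b) := by
  ext b
  exact 𝓜.realize_eq_of_forall (opTerm fun y => y (ρ b)) (Term.var (ρ b))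
    (fun y => by simp [realize_opTerm_base]) x

theorem hat_elim [Finite α] {F : (α → R) → β → R} {G : (α → R) → γ → R} (x : α → 𝓜.carrier) :
    𝓜.hat (fun y => Sum.elim (F y) (G y)) x = Sum.elim (𝓜.hat F x) (𝓜.hat G x) := by
  ext (b | c) <;> rfl

theorem reindex_mem_interp [Finite α] [Finite β] (ρ : β → α) (X : Set (β → R))
    (x : α → 𝓜.carrier) :
    (fun b => x (ρ b)) ∈ 𝓜.interp X ↔ x ∈ 𝓜.interp {y | (fun b => y (ρ b)) ∈ X} := by
  rw [← 𝓜.hat_reindex, 𝓜.hat_mem_interp]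
  rfl

theorem mem_interp_eq [Finite α] (f g : (α → R) → R) (x : α → 𝓜.carrier) :
    x ∈ 𝓜.interp {y | f y = g y} ↔ (opTerm f).realize x = (opTerm g).realize x := by
  rw [𝓜.mem_interp_iff ((opTerm f).equal (opTerm g)) fun y => ?_, Formula.realize_equal]
  rw [Formula.realize_equal, realize_opTerm_base, realize_opTerm_base]
  rfl

theorem definable_interp [Finite α] (A : Set 𝓜.carrier) (X : Set (α → R)) :
    A.Definable (fullLanguage R) (𝓜.interp X) := by
  obtain ⟨φ, hφ⟩ := exists_formula X
  refine Set.Definable.mono (Set.empty_definable_iff.2 ⟨φ, ?_⟩) (Set.empty_subset A)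
  ext x
  exact 𝓜.mem_interp_iff φ hφ x

theorem exists_interp_of_definable [Finite α] {D : Set (α → 𝓜.carrier)}
    (hD : (∅ : Set 𝓜.carrier).Definable (fullLanguage R) D) :
    ∃ X : Set (α → R), D = 𝓜.interp X := by
  obtain ⟨φ, rfl⟩ := Set.empty_definable_iff.1 hD
  exact ⟨{y | φ.Realize y}, Set.ext fun x => (𝓜.mem_interp_iff φ (fun _ => Iff.rfl) x).symm⟩

/-- The preimage of a definable set under a `0`-definable map. -/
theorem definable_preimage_hat [Finite α] (A : Set 𝓜.carrier) (F : (α → R) → β → R)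
    {D : Set (β → 𝓜.carrier)} (hD : A.Definable (fullLanguage R) D) :
    A.Definable (fullLanguage R) (𝓜.hat F ⁻¹' D) := by
  obtain ⟨φ, rfl⟩ := hD
  refine ⟨φ.subst fun b =>
    ((fullLanguage R).lhomWithConstants A).onTerm (opTerm fun y => F y b), ?_⟩
  ext x
  refine Iff.trans ?_ BoundedFormula.realize_subst.symm
  simp only [LHom.realize_onTerm]
  rfl

/-- The fibres of a `0`-definable set are definable. -/
theorem definable_fiber [Finite α] [Finite β] {A : Set 𝓜.carrier} (X : Set (α ⊕ β → R))
    {a : α → 𝓜.carrier} (ha : ∀ i, a i ∈ A) :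
    A.Definable (fullLanguage R) {x : β → 𝓜.carrier | Sum.elim a x ∈ 𝓜.interp X} := by
  obtain ⟨φ, hφ⟩ := 𝓜.definable_interp A X
  refine ⟨φ.subst (Sum.elim (fun i => ((fullLanguage R).con (⟨a i, ha i⟩ : A)).term) Term.var), ?_⟩
  rw [hφ]
  ext x
  refine Iff.trans ?_ BoundedFormula.realize_subst.symm
  change φ.Realize _ ↔ φ.Realize _
  have : Sum.elim a x = fun i : α ⊕ β => (Sum.elim
      (fun i => ((fullLanguage R).con (⟨a i, ha i⟩ : A)).term) Term.var i).realize x := by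
    ext (i | i) <;> simp
  rw [← this]

theorem finite_carrier [Finite R] : Finite 𝓜.carrier := by
  have h : ¬ R ⊨ Sentence.cardGe (fullLanguage R) (Nat.card R + 1) := by
    have := Fintype.ofFinite R
    rw [Sentence.realize_cardGe, Cardinal.mk_fintype, Nat.card_eq_fintype_card, Nat.cast_le]
    exact Nat.not_succ_le_self _
  have h' : ¬ 𝓜.carrier ⊨ Sentence.cardGe (fullLanguage R) (Nat.card R + 1) :=
    fun hM => h ((𝓜.emb.map_sentence _).2 hM)
  rw [Sentence.realize_cardGe, not_le] at h'
  exact Cardinal.lt_aleph0_iff_finite.1 (h'.trans (Cardinal.natCast_lt_aleph0))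

/-- Saturation for tuples of variables. For infinite `R` a surjection `R → R ^ α` is named in the
language, which reduces the claim to one variable; for finite `R` the extension is finite. -/
theorem tuple_saturated [Finite α] (A : Set 𝓜.carrier) (hA : Cardinal.mk A < 𝓜.κ)
    (𝒟 : Set (Set (α → 𝓜.carrier))) (hD : ∀ D ∈ 𝒟, A.Definable (fullLanguage R) D)
    (hfin : ∀ ℱ ⊆ 𝒟, ℱ.Finite → (⋂₀ ℱ).Nonempty) : (⋂₀ 𝒟).Nonempty := by
  rcases finite_or_infinite R with hR | hR
  · have := 𝓜.finite_carrier
    exact hfin 𝒟 subset_rfl (Set.toFinite _)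
  have hle : Cardinal.mk (α → R) ≤ Cardinal.mk R := by
    have := Fintype.ofFinite α
    rw [Cardinal.mk_arrow, Cardinal.mk_fintype α]
    simpa using Cardinal.power_nat_le (n := Fintype.card α) (Cardinal.aleph0_le_mk R)
  obtain ⟨⟨f, hf⟩⟩ := (Cardinal.le_def _ _).1 hle
  let F : (Fin 1 → R) → α → R := fun y => Function.invFun f (y 0)
  let S : (α → R) → Fin 1 → R := fun y _ => f y
  have hFS : ∀ x, 𝓜.hat F (𝓜.hat S x) = x := fun x => by
    rw [𝓜.hat_comp]
    have : (fun y => F (S y)) = fun (y : α → R) a => y (id a) := by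
      ext y : 1
      exact Function.leftInverse_invFun hf y
    rw [this, 𝓜.hat_reindex]
    rfl
  let g : Set (α → 𝓜.carrier) → Set 𝓜.carrier := fun D => {x | 𝓜.hat F (fun _ => x) ∈ D}
  obtain ⟨x, hx⟩ := 𝓜.saturated A hA (g '' 𝒟) (by
      rintro _ ⟨D, hD', rfl⟩
      have hset : {x : Fin 1 → 𝓜.carrier | x 0 ∈ g D} = 𝓜.hat F ⁻¹' D := by
        ext x
        have hx : (fun _ => x 0) = x := funext fun i => congrArg x (Subsingleton.elim 0 i)
        change 𝓜.hat F (fun _ => x 0) ∈ D ↔ 𝓜.hat F x ∈ D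
        rw [hx]
      have := 𝓜.definable_preimage_hat A F (hD D hD')
      rwa [← hset] at this) (by
      intro ℱ hℱ hfinℱ
      obtain ⟨𝒟', h𝒟', hfin', rfl⟩ := Set.exists_subset_image_finite_and.1 ⟨ℱ, hℱ, hfinℱ, rfl⟩
      obtain ⟨y, hy⟩ := hfin 𝒟' h𝒟' hfin'
      refine ⟨𝓜.hat S y 0, ?_⟩
      rintro _ ⟨D, hD', rfl⟩
      change 𝓜.hat F (fun _ => 𝓜.hat S y 0) ∈ D
      rw [show (fun _ => 𝓜.hat S y 0) = 𝓜.hat S y from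
        funext fun i => by rw [Subsingleton.elim i 0], hFS]
      exact hy D hD')
  exact ⟨𝓜.hat F fun _ => x, fun D hD' => hx _ ⟨D, hD', rfl⟩⟩

/-- The power set of `R ^ α` is small. -/
theorem lift_mk_set_tuple_lt [Finite α] :
    Cardinal.lift.{v} (Cardinal.mk (Set (α → R))) < Cardinal.lift.{u} 𝓜.κ := by
  refine lt_of_le_of_lt (Cardinal.lift_le.2 ?_) 𝓜.lt_κ
  refine le_trans ?_ (self_le_add_left _ _)
  let e := Finite.equivFin α
  refine Cardinal.mk_le_of_injective
    (f := fun X : Set (α → R) => (Sum.inr ⟨Nat.card α, {y | y ∘ e ∈ X}⟩ :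
      (fullLanguage R).Symbols)) fun X Y h => ?_
  have h' : ({y | y ∘ e ∈ X} : Set (Fin (Nat.card α) → R)) = {y | y ∘ e ∈ Y} := by
    have h1 := Sum.inr_injective h
    exact eq_of_heq (Sigma.mk.inj h1).2
  ext y
  have := Set.ext_iff.1 h' (y ∘ e.symm)
  simpa [Function.comp_assoc] using this

end Interp
end MonsterModel

/-! ### Coded sets, types as ultrafilters, monads of filters -/

namespace MonsterModel

open Filter

variable {R : Type u} (𝓜 : MonsterModel.{u, v} R)

theorem mk_empty_lt : Cardinal.mk (∅ : Set 𝓜.carrier) < 𝓜.κ := by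
  rw [Cardinal.mk_eq_zero]
  exact bot_lt_iff_ne_bot.2 𝓜.isStrongLimit.ne_zero

/-- A set `S` whose elements are coded by tuples from `R`, together with its interpretation `S'` in
the extension: `c` and `c'` are the codings and `ι` is the inclusion of `S` in `S'`. -/
structure Code (S : Type u) (S' : Type v) where
  /-- the finite index type of the tuples -/
  ix : Type
  [finite : Finite ix]
  /-- the coding of `S` -/
  c : S → ix → R
  /-- the coding of the interpretation -/
  c' : S' → ix → 𝓜.carrier
  /-- the inclusion -/
  ι : S → S'
  c_injective : Function.Injective c
  c'_injective : Function.Injective c'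
  range_c' : Set.range c' = 𝓜.interp (Set.range c)
  c'_ι : ∀ s i, c' (ι s) i = 𝓜.emb (c s i)

namespace Code

attribute [instance] Code.finite

variable {𝓜} {S T : Type u} {S' T' : Type v} (E : 𝓜.Code S S') (F : 𝓜.Code T T')

/-- The interpretation of a subset of a coded set. -/
def ext (X : Set S) : Set S' := E.c' ⁻¹' 𝓜.interp (E.c '' X)

theorem c'_mem_interp (x : S') (Z : Set (E.ix → R)) :
    E.c' x ∈ 𝓜.interp Z ↔ x ∈ E.ext (E.c ⁻¹' Z) := by
  rw [ext, Set.image_preimage_eq_inter_range, interp_inter, ← E.range_c']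
  simp

theorem ext_compl (X : Set S) : E.ext Xᶜ = (E.ext X)ᶜ := by
  ext x
  have h := E.c'_mem_interp x (E.c '' X)ᶜ
  rw [Set.preimage_compl, Set.preimage_image_eq _ E.c_injective, interp_compl] at h
  exact h.symm

theorem ext_inter (X Y : Set S) : E.ext (X ∩ Y) = E.ext X ∩ E.ext Y := by
  rw [ext, Set.image_inter E.c_injective, interp_inter]
  rfl

theorem ext_univ : E.ext Set.univ = Set.univ := by
  refine Set.eq_univ_of_forall fun x => ?_
  have := (E.c'_mem_interp x Set.univ).1 (by rw [interp_univ]; trivial)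
  rwa [Set.preimage_univ] at this

theorem ext_empty : E.ext ∅ = ∅ := by
  rw [← Set.compl_univ, ext_compl, ext_univ, Set.compl_univ]

theorem ext_mono {X Y : Set S} (h : X ⊆ Y) : E.ext X ⊆ E.ext Y := by
  rw [← Set.inter_eq_left.2 h, ext_inter]
  exact Set.inter_subset_right

theorem ι_mem_ext {s : S} {X : Set S} : E.ι s ∈ E.ext X ↔ s ∈ X := by
  have : E.c' (E.ι s) = fun i => 𝓜.emb (E.c s i) := funext (E.c'_ι s)
  rw [ext, Set.mem_preimage, this, emb_mem_interp, E.c_injective.mem_set_image]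

/-- The type of an element of `S'` over `S`, as an ultrafilter on `S`. -/
def tp (x : S') : Ultrafilter S :=
  Ultrafilter.ofComplNotMemIff
    { sets := {X | x ∈ E.ext X}
      univ_sets := by rw [Set.mem_ofPred_eq, ext_univ]; trivial
      sets_of_superset := fun h h' => E.ext_mono h' h
      inter_sets := fun h h' => by rw [Set.mem_ofPred_eq, ext_inter]; exact ⟨h, h'⟩ } fun X => by
    change x ∉ E.ext Xᶜ ↔ x ∈ E.ext X
    rw [ext_compl, Set.mem_compl_iff, not_not]

variable {E} in
theorem mem_tp {x : S'} {X : Set S} : X ∈ E.tp x ↔ x ∈ E.ext X := Iff.rfl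

theorem tp_ι (s : S) : E.tp (E.ι s) = pure s := by
  ext X
  exact E.ι_mem_ext

/-- Saturation: every proper filter on `S` is contained in the type of some element. -/
theorem exists_tp_le (f : Filter S) [f.NeBot] : ∃ x, (E.tp x : Filter S) ≤ f := by
  obtain ⟨z, hz⟩ := 𝓜.tuple_saturated ∅
    𝓜.mk_empty_lt
    ((fun X => 𝓜.interp (E.c '' X)) '' f.sets)
    (by rintro _ ⟨X, -, rfl⟩; exact 𝓜.definable_interp _ _) (by
      intro ℱ hℱ hfin
      obtain ⟨𝒟, h𝒟, hfin', rfl⟩ := Set.exists_subset_image_finite_and.1 ⟨ℱ, hℱ, hfin, rfl⟩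
      obtain ⟨s, hs⟩ := f.nonempty_of_mem ((sInter_mem hfin').2 fun X hX => h𝒟 hX)
      refine ⟨E.c' (E.ι s), ?_⟩
      rintro _ ⟨X, hX, rfl⟩
      exact E.ι_mem_ext.2 (hs X hX))
  have hz' : z ∈ Set.range E.c' := by
    rw [E.range_c', ← Set.image_univ]
    exact hz _ ⟨Set.univ, univ_mem, rfl⟩
  obtain ⟨x, rfl⟩ := hz'
  exact ⟨x, fun X hX => hz _ ⟨X, hX, rfl⟩⟩

/-- The monad of a filter: the elements of the extension that belong to the interpretation of every
set in the filter. -/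
def monad (f : Filter S) : Set S' := {x | (E.tp x : Filter S) ≤ f}

variable {E} in
theorem mem_monad {f : Filter S} {x : S'} : x ∈ E.monad f ↔ ∀ X ∈ f, x ∈ E.ext X := Iff.rfl

variable {E} in
theorem monad_subset_ext {f : Filter S} {X : Set S} : E.monad f ⊆ E.ext X ↔ X ∈ f := by
  refine ⟨fun h => ?_, fun h x hx => hx h⟩
  by_contra hX
  have : (f ⊓ 𝓟 Xᶜ).NeBot := by
    rw [neBot_iff]
    intro hbot
    exact hX (by rwa [inf_principal_eq_bot, compl_compl] at hbot)
  obtain ⟨x, hx⟩ := E.exists_tp_le (f ⊓ 𝓟 Xᶜ)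
  have h1 : x ∈ E.ext X := h (hx.trans inf_le_left)
  have h2 : x ∈ E.ext Xᶜ := hx (mem_inf_of_right (mem_principal_self _))
  rw [ext_compl] at h2
  exact h2 h1

theorem monad_principal (X : Set S) : E.monad (𝓟 X) = E.ext X := by
  ext x
  exact le_principal_iff

theorem monad_inf (f g : Filter S) : E.monad (f ⊓ g) = E.monad f ∩ E.monad g := by
  ext x
  change (E.tp x : Filter S) ≤ f ⊓ g ↔ _
  exact le_inf_iff

theorem monad_sup (f g : Filter S) : E.monad (f ⊔ g) = E.monad f ∪ E.monad g := by
  ext x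
  constructor
  · intro h
    by_contra hx
    rw [Set.mem_union, not_or] at hx
    simp only [mem_monad, not_forall] at hx
    obtain ⟨⟨X, hX, hxX⟩, Y, hY, hxY⟩ := hx
    have h1 : X ∪ Y ∈ E.tp x := h (union_mem_sup hX hY)
    rcases Ultrafilter.union_mem_iff.1 h1 with h1 | h1
    exacts [hxX h1, hxY h1]
  · rintro (h | h)
    exacts [le_trans (show (E.tp x : Filter S) ≤ f from h) le_sup_left,
      le_trans (show (E.tp x : Filter S) ≤ g from h) le_sup_right]

theorem monad_iInf {κ : Sort*} (f : κ → Filter S) : E.monad (⨅ k, f k) = ⋂ k, E.monad (f k) := by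
  ext x
  rw [Set.mem_iInter]
  exact le_iInf_iff (a := (E.tp x : Filter S))

/-- The sets that are type-definable without parameters. -/
def IsTD (Y : Set S') : Prop := ∃ f : Filter S, E.monad f = Y

variable {E} in
theorem disjoint_of_monad_disjoint {f g : Filter S} (h : E.monad f ∩ E.monad g = ∅) :
    ∃ X ∈ f, Xᶜ ∈ g := by
  have : ∅ ∈ f ⊓ g := monad_subset_ext (E := E).1 (by rw [monad_inf, h]; exact Set.empty_subset _)
  obtain ⟨X, hX, Y, hY, hXY⟩ := mem_inf_iff.1 this
  exact ⟨X, hX, mem_of_superset hY fun y hy hy' => by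
    have : y ∈ X ∩ Y := ⟨hy', hy⟩
    rwa [← hXY] at this⟩

variable {E} in
theorem IsTD.iInter {κ : Sort*} {Y : κ → Set S'} (h : ∀ k, E.IsTD (Y k)) : E.IsTD (⋂ k, Y k) := by
  choose f hf using h
  exact ⟨⨅ k, f k, by rw [monad_iInf]; simp_rw [hf]⟩

variable {E} in
theorem IsTD.union {Y Z : Set S'} (hY : E.IsTD Y) (hZ : E.IsTD Z) : E.IsTD (Y ∪ Z) := by
  obtain ⟨f, rfl⟩ := hY
  obtain ⟨g, rfl⟩ := hZ
  exact ⟨f ⊔ g, E.monad_sup f g⟩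

theorem isTD_ext (X : Set S) : E.IsTD (E.ext X) := ⟨𝓟 X, E.monad_principal X⟩

/-- Extensions of functions are recognised on types. -/
theorem tp_map_of_hat {φ : S → T} {φ' : S' → T'} (Fn : (E.ix → R) → F.ix → R)
    (h : ∀ s, F.c (φ s) = Fn (E.c s)) (h' : ∀ x, F.c' (φ' x) = 𝓜.hat Fn (E.c' x)) (x : S') :
    F.tp (φ' x) = (E.tp x).map φ := by
  ext X
  rw [Ultrafilter.mem_map, mem_tp, mem_tp, ext, Set.mem_preimage, h', hat_mem_interp, c'_mem_interp]
  have : E.c ⁻¹' (Fn ⁻¹' (F.c '' X)) = φ ⁻¹' X := by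
    ext s
    rw [Set.mem_preimage, Set.mem_preimage, ← h, F.c_injective.mem_set_image]
    rfl
  rw [this]

theorem tp_map_of_reindex {φ : S → T} {φ' : S' → T'} (ρ : F.ix → E.ix)
    (h : ∀ s i, F.c (φ s) i = E.c s (ρ i)) (h' : ∀ x i, F.c' (φ' x) i = E.c' x (ρ i)) (x : S') :
    F.tp (φ' x) = (E.tp x).map φ :=
  tp_map_of_hat E F (fun y i => y (ρ i)) (fun s => funext (h s))
    (fun x => by rw [hat_reindex]; exact funext (h' x)) x

variable {F} in
theorem monad_comap {φ : S → T} {φ' : S' → T'} (h : ∀ x, F.tp (φ' x) = (E.tp x).map φ)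
    (g : Filter T) : E.monad (comap φ g) = φ' ⁻¹' F.monad g := by
  ext x
  change (E.tp x : Filter S) ≤ comap φ g ↔ (F.tp (φ' x) : Filter T) ≤ g
  rw [h, Ultrafilter.coe_map, map_le_iff_le_comap]

variable {E F} in
theorem IsTD.preimage {φ : S → T} {φ' : S' → T'} (h : ∀ x, F.tp (φ' x) = (E.tp x).map φ)
    {Y : Set T'} (hY : F.IsTD Y) : E.IsTD (φ' ⁻¹' Y) := by
  obtain ⟨g, rfl⟩ := hY
  exact ⟨_, E.monad_comap h g⟩

/-- The product of two coded sets. -/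
def prod : 𝓜.Code (S × T) (S' × T') where
  ix := E.ix ⊕ F.ix
  c p := Sum.elim (E.c p.1) (F.c p.2)
  c' p := Sum.elim (E.c' p.1) (F.c' p.2)
  ι := Prod.map E.ι F.ι
  c_injective p q h := Prod.ext (E.c_injective (funext fun i => congrFun h (Sum.inl i)))
    (F.c_injective (funext fun i => congrFun h (Sum.inr i)))
  c'_injective p q h := Prod.ext (E.c'_injective (funext fun i => congrFun h (Sum.inl i)))
    (F.c'_injective (funext fun i => congrFun h (Sum.inr i)))
  range_c' := by
    have : (Set.range fun p : S × T => Sum.elim (E.c p.1) (F.c p.2)) =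
        {z | (fun i => z (Sum.inl i)) ∈ Set.range E.c} ∩
          {z | (fun i => z (Sum.inr i)) ∈ Set.range F.c} := by
      ext z
      constructor
      · rintro ⟨p, rfl⟩
        exact ⟨⟨p.1, rfl⟩, ⟨p.2, rfl⟩⟩
      · rintro ⟨⟨s, hs⟩, ⟨t, ht⟩⟩
        exact ⟨(s, t), by ext (i | i); exacts [congrFun hs i, congrFun ht i]⟩
    rw [this, interp_inter]
    ext z
    rw [Set.mem_inter_iff, ← reindex_mem_interp 𝓜 Sum.inl, ← reindex_mem_interp 𝓜 Sum.inr,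
      ← E.range_c', ← F.range_c']
    constructor
    · rintro ⟨p, rfl⟩
      exact ⟨⟨p.1, rfl⟩, ⟨p.2, rfl⟩⟩
    · rintro ⟨⟨s, hs⟩, ⟨t, ht⟩⟩
      exact ⟨(s, t), by ext (i | i); exacts [congrFun hs i, congrFun ht i]⟩
  c'_ι p i := by rcases i with i | i; exacts [E.c'_ι _ _, F.c'_ι _ _]

theorem tp_fst (p : S' × T') : E.tp p.1 = ((E.prod F).tp p).map Prod.fst :=
  tp_map_of_reindex (E.prod F) E Sum.inl (fun _ _ => rfl) (fun _ _ => rfl) p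

theorem tp_snd (p : S' × T') : F.tp p.2 = ((E.prod F).tp p).map Prod.snd :=
  tp_map_of_reindex (E.prod F) F Sum.inr (fun _ _ => rfl) (fun _ _ => rfl) p

theorem monad_prod (f : Filter S) (g : Filter T) :
    (E.prod F).monad (f ×ˢ g) = E.monad f ×ˢ F.monad g := by
  change (E.prod F).monad (comap Prod.fst f ⊓ comap Prod.snd g) = _
  rw [monad_inf, monad_comap (E.prod F) (E.tp_fst F), monad_comap (E.prod F) (E.tp_snd F)]
  rfl

variable {E F} in
theorem mem_prod_of_forall {f : Filter S} {g : Filter T} {P : Set (S × T)}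
    (h : ∀ x ∈ E.monad f, ∀ y ∈ F.monad g, (x, y) ∈ (E.prod F).ext P) : P ∈ f ×ˢ g := by
  refine monad_subset_ext (E := E.prod F).1 ?_
  rw [monad_prod]
  rintro ⟨x, y⟩ ⟨hx, hy⟩
  exact h x hx y hy

variable {E F} in
theorem mem_ext_prod {x : S'} {y : T'} {X : Set S} {Y : Set T} :
    (x, y) ∈ (E.prod F).ext (X ×ˢ Y) ↔ x ∈ E.ext X ∧ y ∈ F.ext Y := by
  have := congrArg (fun s => (x, y) ∈ s) (monad_prod E F (𝓟 X) (𝓟 Y))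
  rw [prod_principal_principal, monad_principal, monad_principal, monad_principal] at this
  exact iff_of_eq this

/-- Tuples of elements of a coded set. -/
def pow (m : ℕ) : 𝓜.Code (Fin m → S) (Fin m → S') where
  ix := Fin m × E.ix
  c p i := E.c (p i.1) i.2
  c' p i := E.c' (p i.1) i.2
  ι p k := E.ι (p k)
  c_injective p q h := funext fun k => E.c_injective (funext fun i => congrFun h (k, i))
  c'_injective p q h := funext fun k => E.c'_injective (funext fun i => congrFun h (k, i))
  range_c' := by
    have h : ∀ z : Fin m × E.ix → 𝓜.carrier,
        z ∈ 𝓜.interp (⋂ k, {z : Fin m × E.ix → R | (fun i => z (k, i)) ∈ Set.range E.c}) ↔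
          ∀ k, (fun i => z (k, i)) ∈ Set.range E.c' := by
      intro z
      rw [interp_iInter, Set.mem_iInter]
      exact forall_congr' fun k => by
        rw [← reindex_mem_interp 𝓜 (fun i => (k, i)) (Set.range E.c), E.range_c']
    have h2 : (Set.range fun (p : Fin m → S) (i : Fin m × E.ix) => E.c (p i.1) i.2) =
        ⋂ k, {z : Fin m × E.ix → R | (fun i => z (k, i)) ∈ Set.range E.c} := by
      ext z
      rw [Set.mem_iInter]
      constructor
      · rintro ⟨p, rfl⟩ k
        exact ⟨p k, rfl⟩
      · intro hz
        choose p hp using hz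
        exact ⟨p, funext fun i => congrFun (hp i.1) i.2⟩
    rw [h2]
    ext z
    rw [h]
    constructor
    · rintro ⟨p, rfl⟩ k
      exact ⟨p k, rfl⟩
    · intro hz
      choose p hp using hz
      exact ⟨p, funext fun i => congrFun (hp i.1) i.2⟩
  c'_ι p i := E.c'_ι _ _

/-- Every function between coded sets extends to the interpretations. -/
theorem exists_extension (φ : S → T) : ∃ φ' : S' → T', ∀ x,
    (E.prod F).tp (x, φ' x) = (E.tp x).map fun s => (s, φ s) := by
  rcases isEmpty_or_nonempty S with hS | hS
  · have : IsEmpty S' := ⟨fun x => by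
      have h : x ∈ E.ext ∅ := by
        rw [← Set.univ_eq_empty_iff.2 hS, ext_univ]; trivial
      rw [ext_empty] at h
      exact h⟩
    exact ⟨isEmptyElim, isEmptyElim⟩
  let Fn : (E.ix → R) → F.ix → R := fun y => F.c (φ (Function.invFun E.c y))
  have hFn : ∀ s, Fn (E.c s) = F.c (φ s) := fun s =>
    congrArg (fun s => F.c (φ s)) (Function.leftInverse_invFun E.c_injective s)
  have h : ∀ x : S', ∃ y : T', F.c' y = 𝓜.hat Fn (E.c' x) := fun x => by
    change _ ∈ Set.range F.c'
    rw [F.range_c', hat_mem_interp]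
    have : Fn ⁻¹' Set.range F.c = Set.univ := Set.eq_univ_of_forall fun y => ⟨_, rfl⟩
    rw [this, interp_univ]
    trivial
  choose φ' hφ' using h
  refine ⟨φ', tp_map_of_hat E (E.prod F) (φ := fun s => (s, φ s)) (φ' := fun x => (x, φ' x))
    (fun y => Sum.elim y (Fn y)) (fun s => ?_) fun x => ?_⟩
  · rw [hFn]; rfl
  · refine Eq.trans ?_ (hat_elim (𝓜 := 𝓜) (E.c' x)).symm
    rw [← hφ']
    have : 𝓜.hat (fun y : E.ix → R => y) (E.c' x) = E.c' x := hat_reindex 𝓜 id _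
    rw [this]
    rfl

/-- A type-definable set `Y` over small parameters is met by the type of every element that belongs
to all interpretations containing `Y`. -/
theorem exists_mem_tp_eq {Y : Set S'} (hY : 𝓜.IsSmallTypeDefinable (E.c' '' Y)) {x : S'}
    (hx : ∀ X, Y ⊆ E.ext X → x ∈ E.ext X) : ∃ y ∈ Y, E.tp y = E.tp x := by
  obtain ⟨A, hA, 𝒟, h𝒟, hY𝒟⟩ := hY
  obtain ⟨z, hz⟩ := 𝓜.tuple_saturated A hA
    (𝒟 ∪ (fun X => 𝓜.interp (E.c '' X)) '' (E.tp x : Filter S).sets)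
    (by rintro _ (h | ⟨X, -, rfl⟩); exacts [h𝒟 _ h, 𝓜.definable_interp _ _]) (by
      intro ℱ hℱ hfin
      have h1 : ∀ D ∈ ℱ, ∃ X ∈ E.tp x, D ∉ 𝒟 → D = 𝓜.interp (E.c '' X) := by
        intro D hD
        rcases hℱ hD with h | ⟨X, hX, rfl⟩
        exacts [⟨Set.univ, univ_mem, fun h' => absurd h h'⟩, ⟨X, hX, fun _ => rfl⟩]
      choose! X hX hX' using h1
      have h2 : (⋂ D ∈ ℱ, X D) ∈ (E.tp x : Filter S) := (biInter_mem hfin).2 hX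
      have h3 : ∃ y ∈ Y, y ∈ E.ext (⋂ D ∈ ℱ, X D) := by
        by_contra hcon
        push Not at hcon
        have := hx (⋂ D ∈ ℱ, X D)ᶜ (by rw [ext_compl]; exact hcon)
        rw [ext_compl] at this
        exact this h2
      obtain ⟨y, hy, hy'⟩ := h3
      refine ⟨E.c' y, fun D hD => ?_⟩
      by_cases hD' : D ∈ 𝒟
      · have : E.c' y ∈ ⋂₀ 𝒟 := hY𝒟 ▸ Set.mem_image_of_mem _ hy
        exact this D hD'
      · rw [hX' D hD hD']
        exact E.ext_mono (Set.biInter_subset_of_mem hD) hy')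
  have hz' : z ∈ E.c' '' Y := by
    rw [hY𝒟]
    exact fun D hD => hz D (Or.inl hD)
  obtain ⟨y, hy, rfl⟩ := hz'
  exact ⟨y, hy, Ultrafilter.coe_le_coe.1 fun X hX => hz _ (Or.inr ⟨X, hX, rfl⟩)⟩

theorem IsTD.forall_snd {E : 𝓜.Code S S'} {F : 𝓜.Code T T'} {Y : Set (S' × T')}
    (hY : (E.prod F).IsTD Y) : E.IsTD {x | ∀ y, (x, y) ∈ Y} := by
  obtain ⟨h, rfl⟩ := hY
  refine ⟨⨅ Z ∈ h, 𝓟 {s | ∀ t, (s, t) ∈ Z}, ?_⟩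
  simp_rw [monad_iInf, monad_principal]
  ext x
  rw [Set.mem_iInter₂]
  constructor
  · intro hx y Z hZ
    have h1 : {s | ∀ t, (s, t) ∈ Z} ∈ ((E.prod F).tp (x, y)).map Prod.fst := by
      rw [← E.tp_fst F (x, y)]
      exact hx Z hZ
    exact mem_of_superset h1 fun p hp => hp p.2
  · intro hx Z hZ
    by_contra hcon
    -- a function that picks a counterexample extends to the interpretation
    have h1 : ∀ s, ∃ t, (∃ t', (s, t') ∉ Z) → (s, t) ∉ Z := fun s => by
      by_cases hs : ∃ t', (s, t') ∉ Z
      · exact ⟨hs.choose, fun _ => hs.choose_spec⟩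
      · have : Nonempty T := by
          by_contra hT
          have := not_nonempty_iff.1 hT
          exact hcon
            (univ_mem' fun s t => this.elim t : {s | ∀ t, (s, t) ∈ Z} ∈ (E.tp x : Filter S))
        exact ⟨Classical.arbitrary T, fun h => absurd h hs⟩
    choose τ hτ using h1
    obtain ⟨τ', hτ'⟩ := E.exists_extension F τ
    have h2 : Z ∈ (E.prod F).tp (x, τ' x) := hx (τ' x) hZ
    rw [hτ', Ultrafilter.mem_map] at h2
    refine hcon (mem_of_superset (h2 : _ ∈ (E.tp x : Filter S)) fun s hs => ?_)
    by_contra hs'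
    exact hτ s (not_forall.1 hs') hs

theorem IsTD.isTypeDefinable {E : 𝓜.Code S S'} {Y : Set S'} (hY : E.IsTD Y) :
    𝓜.IsTypeDefinable ∅ (E.c' '' Y) := by
  obtain ⟨f, rfl⟩ := hY
  refine ⟨(fun X => 𝓜.interp (E.c '' X)) '' f.sets, ?_, ?_⟩
  · rintro _ ⟨X, -, rfl⟩
    exact 𝓜.definable_interp _ _
  · ext z
    constructor
    · rintro ⟨x, hx, rfl⟩ _ ⟨X, hX, rfl⟩
      exact hx hX
    · intro hz
      have hz' : z ∈ Set.range E.c' := by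
        rw [E.range_c', ← Set.image_univ]
        exact hz _ ⟨Set.univ, univ_mem, rfl⟩
      obtain ⟨x, rfl⟩ := hz'
      exact ⟨x, fun X hX => hz _ ⟨X, hX, rfl⟩, rfl⟩

theorem isTD_of_isTypeDefinable {Y : Set S'} (hY : 𝓜.IsTypeDefinable ∅ (E.c' '' Y)) :
    E.IsTD Y := by
  obtain ⟨𝒟, h𝒟, hY⟩ := hY
  refine ⟨⨅ D ∈ 𝒟, 𝓟 {s | ∀ X : Set (E.ix → R), D = 𝓜.interp X → E.c s ∈ X}, ?_⟩
  have h : ∀ D ∈ 𝒟, E.ext {s | ∀ X : Set (E.ix → R), D = 𝓜.interp X → E.c s ∈ X} = E.c' ⁻¹' D := by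
    intro D hD
    obtain ⟨X, rfl⟩ := 𝓜.exists_interp_of_definable (h𝒟 D hD)
    have : {s | ∀ X' : Set (E.ix → R), 𝓜.interp X = 𝓜.interp X' → E.c s ∈ X'} = E.c ⁻¹' X := by
      ext s
      refine ⟨fun h => h X rfl, fun h X' hX' => ?_⟩
      rw [← 𝓜.emb_mem_interp, ← hX', 𝓜.emb_mem_interp]
      exact h
    rw [this]
    ext x
    exact (E.c'_mem_interp x X).symm
  simp_rw [monad_iInf, monad_principal]
  ext x
  rw [← E.c'_injective.mem_set_image (s := Y), hY, Set.mem_iInter₂, Set.mem_sInter]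
  exact forall₂_congr fun D hD => by rw [h D hD]; rfl

theorem IsTD.isSmallTypeDefinable {E : 𝓜.Code S S'} {Y : Set S'} (hY : E.IsTD Y) :
    𝓜.IsSmallTypeDefinable (E.c' '' Y) :=
  ⟨∅, 𝓜.mk_empty_lt, hY.isTypeDefinable⟩

/-- A set that is type-definable with parameters and invariant under equality of types is
type-definable without parameters. -/
theorem isTD_of_isSmallTypeDefinable {Y : Set S'} (hY : 𝓜.IsSmallTypeDefinable (E.c' '' Y))
    (h : ∀ x y, E.tp x = E.tp y → x ∈ Y → y ∈ Y) : E.IsTD Y := by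
  refine ⟨⨅ X ∈ {X | Y ⊆ E.ext X}, 𝓟 X, ?_⟩
  simp_rw [monad_iInf, monad_principal]
  refine Set.Subset.antisymm (fun x hx => ?_) (Set.subset_iInter₂ fun X hX => hX)
  obtain ⟨y, hy, hyx⟩ := E.exists_mem_tp_eq hY fun X hX => Set.mem_iInter₂.1 hx X hX
  exact h y x hyx hy

theorem mk_lt_of_injective (E : 𝓜.Code S S') {Q : Type v} (f : Q → Ultrafilter S)
    (hf : Function.Injective f) : Cardinal.mk Q < 𝓜.κ := by
  have h1 : Cardinal.lift.{v} (Cardinal.mk (Set S)) < Cardinal.lift.{u} 𝓜.κ := by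
    refine lt_of_le_of_lt (Cardinal.lift_le.2 ?_) (𝓜.lift_mk_set_tuple_lt (α := E.ix))
    exact Cardinal.mk_le_of_injective E.c_injective.image_injective
  obtain ⟨μ, hμ⟩ := Cardinal.mem_range_lift_of_le h1.le
  have h2 : Cardinal.lift.{u} (Cardinal.mk Q) ≤ Cardinal.lift.{v} (Cardinal.mk (Set (Set S))) :=
    Cardinal.lift_mk_le_lift_mk_of_injective (f := fun q => {X | X ∈ f q}) fun a b hab =>
      hf (Ultrafilter.ext fun X => Set.ext_iff.1 hab X)
  rw [← hμ, Cardinal.lift_lt] at h1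
  rw [Cardinal.mk_set (α := Set S), Cardinal.lift_power, ← hμ, Cardinal.lift_two,
    ← Cardinal.lift_two.{u, v}, ← Cardinal.lift_power, Cardinal.lift_le] at h2
  exact h2.trans_lt (𝓜.isStrongLimit.isStrongPrelimit h1)

end Code
end MonsterModel

/-! ### Interpretations of groups, bounded index and type invariance -/

namespace MonsterModel

open Filter

variable {R : Type u} {𝓜 : MonsterModel.{u, v} R}

namespace Code

/-- `E` codes a group `G` and its interpretation `G'`: the inclusion is multiplicative, and the
shears `(x, y) ↦ (x, xy)` and `(x, y) ↦ (x, yx)` of `G' × G'` are the extensions of those of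
`G × G`. -/
@[to_additive /-- `E` codes an additive group `G` and its interpretation `G'`: the inclusion is
additive, and the shears `(x, y) ↦ (x, x + y)` and `(x, y) ↦ (x, y + x)` of `G' × G'` are the
extensions of those of `G × G`. -/]
def IsGroupCode {G : Type u} {G' : Type v} [Mul G] [Mul G'] (E : 𝓜.Code G G') : Prop :=
  (∀ g h, E.ι (g * h) = E.ι g * E.ι h) ∧
  (∀ x y, (E.prod E).tp (x, x * y) = ((E.prod E).tp (x, y)).map fun p => (p.1, p.1 * p.2)) ∧
  ∀ x y, (E.prod E).tp (x, y * x) = ((E.prod E).tp (x, y)).map fun p => (p.1, p.2 * p.1)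

/-- Elements of the same type are in the same coset of `H`. For subgroups that are type-definable
without parameters this amounts to bounded index. -/
@[to_additive IsAddTypeInvariant /-- Elements of the same type are in the same coset of `H`. For
subgroups that are type-definable without parameters this amounts to bounded index. -/]
def IsTypeInvariant {G : Type u} {G' : Type v} [Group G'] (E : 𝓜.Code G G') (H : Subgroup G') :
    Prop :=
  ∀ x y, E.tp x = E.tp y → x⁻¹ * y ∈ H

section TypeInvariant

variable {G : Type u} {G' : Type v} [Group G'] {E : 𝓜.Code G G'}

@[to_additive]
theorem IsTypeInvariant.mk_lt {H : Subgroup G'} (hH : E.IsTypeInvariant H) :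
    Cardinal.mk (G' ⧸ H) < 𝓜.κ := by
  refine E.mk_lt_of_injective (fun q : G' ⧸ H => E.tp q.out) fun p q hpq => ?_
  rw [← Quotient.out_eq p, ← Quotient.out_eq q]
  exact QuotientGroup.eq.2 (hH _ _ hpq)

@[to_additive]
theorem IsTypeInvariant.mono {H K : Subgroup G'} (hH : E.IsTypeInvariant H) (h : H ≤ K) :
    E.IsTypeInvariant K := fun x y hxy => h (hH x y hxy)

/-- Over a type invariant subgroup, the closed sets of the logic topology are those whose preimage
is type-definable without parameters. -/
@[to_additive IsAddTypeInvariant.isAddLogicClosed_iff]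
theorem IsTypeInvariant.isLogicClosed_iff {H : Subgroup G'} (hH : E.IsTypeInvariant H)
    (C : Set (G' ⧸ H)) :
    𝓜.IsLogicClosed E.c' H C ↔ E.IsTD ((fun g : G' => (g : G' ⧸ H)) ⁻¹' C) := by
  refine ⟨fun h => E.isTD_of_isSmallTypeDefinable h fun x y hxy hx => ?_,
    fun h => h.isSmallTypeDefinable⟩
  have : (x : G' ⧸ H) = y := QuotientGroup.eq.2 (hH x y hxy)
  rw [Set.mem_preimage] at hx ⊢
  rwa [← this]

@[to_additive]
theorem IsTypeInvariant.isClosed_iff {H : Subgroup G'} (hH : E.IsTypeInvariant H)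
    (C : Set (G' ⧸ H)) : @IsClosed _ (𝓜.logicTopology E.c' H) C ↔
      E.IsTD ((fun g : G' => (g : G' ⧸ H)) ⁻¹' C) := by
  let t : TopologicalSpace (G' ⧸ H) := TopologicalSpace.ofClosed
    {C | E.IsTD ((fun g : G' => (g : G' ⧸ H)) ⁻¹' C)}
    (by simpa [ext_empty] using E.isTD_ext ∅)
    (fun A hA => by
      rw [Set.mem_ofPred_eq, Set.sInter_eq_biInter, Set.preimage_iInter₂]
      exact IsTD.iInter fun C => IsTD.iInter fun hC => hA hC)
    (fun A hA B hB => hA.union hB)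
  have ht : t = 𝓜.logicTopology E.c' H := by
    refine le_antisymm (le_generateFrom fun V hV => ?_) fun V hV => ?_
    · exact (hH.isLogicClosed_iff _).1 hV
    · exact TopologicalSpace.isOpen_generateFrom_of_mem ((hH.isLogicClosed_iff Vᶜ).2 hV)
  rw [← ht, ← @isOpen_compl_iff _ _ t]
  change Cᶜᶜ ∈ {C | E.IsTD ((fun g : G' => (g : G' ⧸ H)) ⁻¹' C)} ↔ _
  rw [compl_compl]
  rfl

end TypeInvariant

variable {G : Type u} {G' : Type v} [Group G] [Group G'] {E : 𝓜.Code G G'}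

@[to_additive]
theorem IsGroupCode.ι_one (hE : E.IsGroupCode) : E.ι 1 = 1 := by
  have := hE.1 1 1
  rw [mul_one] at this
  exact left_eq_mul.1 this

@[to_additive]
theorem IsGroupCode.tp_mul (hE : E.IsGroupCode) (x y : G') :
    E.tp (x * y) = ((E.prod E).tp (x, y)).map fun p => p.1 * p.2 := by
  rw [E.tp_snd E (x, x * y), hE.2.1, Ultrafilter.map_map]
  rfl

@[to_additive]
theorem IsGroupCode.tp_inv_mul (hE : E.IsGroupCode) (x y : G') :
    E.tp (x⁻¹ * y) = ((E.prod E).tp (x, y)).map fun p => p.1⁻¹ * p.2 := by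
  have h := hE.2.1 x (x⁻¹ * y)
  rw [mul_inv_cancel_left] at h
  rw [E.tp_snd E (x, x⁻¹ * y), h, Ultrafilter.map_map]
  congr 1
  ext p
  simp

@[to_additive]
theorem IsGroupCode.tp_inv (hE : E.IsGroupCode) (x : G') :
    E.tp x⁻¹ = (E.tp x).map fun g => g⁻¹ := by
  have h := hE.tp_inv_mul x (E.ι 1)
  rw [hE.ι_one, mul_one, ← hE.ι_one] at h
  rw [h, E.tp_fst E (x, E.ι 1), Ultrafilter.map_map]
  have h1 : ∀ᶠ p in ((E.prod E).tp (x, E.ι 1) : Filter (G × G)), p.2 = 1 := by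
    have : E.tp (E.ι 1) = _ := E.tp_snd E (x, E.ι 1)
    rw [E.tp_ι] at this
    change {p : G × G | p.2 ∈ ({1} : Set G)} ∈ (E.prod E).tp (x, E.ι 1)
    change {(1 : G)} ∈ Ultrafilter.map Prod.snd ((E.prod E).tp (x, E.ι 1))
    rw [← this]
    exact rfl
  apply Ultrafilter.coe_injective
  rw [Ultrafilter.coe_map, Ultrafilter.coe_map]
  refine Filter.map_congr (h1.mono fun p hp => ?_)
  simp [hp]

@[to_additive]
theorem IsGroupCode.tp_ι_mul (hE : E.IsGroupCode) (g : G) (x : G') :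
    E.tp (E.ι g * x) = (E.tp x).map fun s => g * s := by
  rw [hE.tp_mul, E.tp_snd E (E.ι g, x), Ultrafilter.map_map]
  have h1 : ∀ᶠ p in ((E.prod E).tp (E.ι g, x) : Filter (G × G)), p.1 = g := by
    have : E.tp (E.ι g) = _ := E.tp_fst E (E.ι g, x)
    rw [E.tp_ι] at this
    change {g} ∈ Ultrafilter.map Prod.fst ((E.prod E).tp (E.ι g, x))
    rw [← this]
    exact rfl
  apply Ultrafilter.coe_injective
  rw [Ultrafilter.coe_map, Ultrafilter.coe_map]
  refine Filter.map_congr (h1.mono fun p hp => ?_)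
  simp [hp]

theorem IsGroupCode.tp_mul_ι (hE : E.IsGroupCode) (g : G) (x : G') :
    E.tp (x * E.ι g) = (E.tp x).map fun s => s * g := by
  rw [hE.tp_mul, E.tp_fst E (x, E.ι g), Ultrafilter.map_map]
  have h1 : ∀ᶠ p in ((E.prod E).tp (x, E.ι g) : Filter (G × G)), p.2 = g := by
    have : E.tp (E.ι g) = _ := E.tp_snd E (x, E.ι g)
    rw [E.tp_ι] at this
    change {g} ∈ Ultrafilter.map Prod.snd ((E.prod E).tp (x, E.ι g))
    rw [← this]
    exact rfl
  apply Ultrafilter.coe_injective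
  rw [Ultrafilter.coe_map, Ultrafilter.coe_map]
  refine Filter.map_congr (h1.mono fun p hp => ?_)
  simp [hp]

theorem IsGroupCode.ι_inv (hE : E.IsGroupCode) (g : G) : E.ι g⁻¹ = (E.ι g)⁻¹ := by
  rw [eq_inv_iff_mul_eq_one, ← hE.1, inv_mul_cancel, hE.ι_one]

/-- A type-definable subgroup is the monad of a filter which is continuous for division. -/
@[to_additive]
theorem IsGroupCode.tendsto_inv_mul (hE : E.IsGroupCode) {H : Subgroup G'} {f : Filter G}
    (hf : E.monad f = H) : Tendsto (fun p : G × G => p.1⁻¹ * p.2) (f ×ˢ f) f := by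
  intro U hU
  refine mem_prod_of_forall (E := E) (F := E) fun x hx y hy => ?_
  rw [hf] at hx hy
  have h : x⁻¹ * y ∈ E.monad f := by rw [hf]; exact H.mul_mem (H.inv_mem hx) hy
  have h1 : U ∈ E.tp (x⁻¹ * y) := h hU
  rw [hE.tp_inv_mul] at h1
  exact h1

theorem IsGroupCode.tendsto_mul (hE : E.IsGroupCode) {H : Subgroup G'} {f : Filter G}
    (hf : E.monad f = H) : Tendsto (fun p : G × G => p.1 * p.2) (f ×ˢ f) f := by
  intro U hU
  refine mem_prod_of_forall (E := E) (F := E) fun x hx y hy => ?_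
  rw [hf] at hx hy
  have h : x * y ∈ E.monad f := by rw [hf]; exact H.mul_mem hx hy
  have h1 : U ∈ E.tp (x * y) := h hU
  rw [hE.tp_mul] at h1
  exact h1

@[to_additive]
theorem IsGroupCode.inv_mul_mem_ext (hE : E.IsGroupCode) {X Y Z : Set G}
    (h : ∀ s ∈ X, ∀ t ∈ Y, s⁻¹ * t ∈ Z) {x y : G'} (hx : x ∈ E.ext X) (hy : y ∈ E.ext Y) :
    x⁻¹ * y ∈ E.ext Z := by
  change Z ∈ E.tp (x⁻¹ * y)
  rw [hE.tp_inv_mul]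
  exact (E.prod E).ext_mono (fun p hp => h p.1 hp.1 p.2 hp.2) (mem_ext_prod.2 ⟨hx, hy⟩)

@[to_additive]
theorem IsGroupCode.mul_mem_ext (hE : E.IsGroupCode) {X Y Z : Set G}
    (h : ∀ s ∈ X, ∀ t ∈ Y, s * t ∈ Z) {x y : G'} (hx : x ∈ E.ext X) (hy : y ∈ E.ext Y) :
    x * y ∈ E.ext Z := by
  change Z ∈ E.tp (x * y)
  rw [hE.tp_mul]
  exact (E.prod E).ext_mono (fun p hp => h p.1 hp.1 p.2 hp.2) (mem_ext_prod.2 ⟨hx, hy⟩)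

/-- If `H` has bounded index, then finitely many translates of any set whose interpretation contains
`H` cover `G`. Saturation over a small set of coset representatives gives finitely many translates
that cover the interpretation; if there were none in `G`, a function that picks an uncovered element
for each finite tuple would extend to the interpretation. -/
@[to_additive]
theorem IsGroupCode.exists_finite_cover (hE : E.IsGroupCode) {H : Subgroup G'}
    (hb : Cardinal.mk (G' ⧸ H) < 𝓜.κ) {D : Set G} (hD : (H : Set G') ⊆ E.ext D) :
    ∃ F : Set G, F.Finite ∧ ∀ s, ∃ t ∈ F, t⁻¹ * s ∈ D := by
  let P : Set (G × G) := {p | p.1⁻¹ * p.2 ∈ D}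
  have hP : ∀ x y, (x, y) ∈ (E.prod E).ext P ↔ x⁻¹ * y ∈ E.ext D := fun x y => by
    rw [← mem_tp, ← mem_tp, hE.tp_inv_mul]
    rfl
  let rep : G' ⧸ H → G' := Quotient.out
  have hrep : ∀ y : G', (rep (y : G' ⧸ H))⁻¹ * y ∈ H := fun y =>
    QuotientGroup.eq.1 (Quotient.out_eq (y : G' ⧸ H))
  let A : Set 𝓜.carrier := Set.range fun p : (G' ⧸ H) × E.ix => E.c' (rep p.1) p.2
  have hA : Cardinal.mk A < 𝓜.κ := by
    have hκ : Cardinal.aleph0 ≤ 𝓜.κ := 𝓜.isStrongLimit.aleph0_le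
    refine Cardinal.mk_range_le.trans_lt ?_
    rw [Cardinal.mk_prod]
    refine Cardinal.mul_lt_of_lt hκ (by rwa [Cardinal.lift_uzero]) ?_
    refine lt_of_lt_of_le ?_ hκ
    rw [Cardinal.lift_lt_aleph0]
    exact Cardinal.lt_aleph0_of_finite _
  let 𝒟 : G' ⧸ H → Set (E.ix → 𝓜.carrier) := fun q =>
    {z | Sum.elim (E.c' (rep q)) z ∈ 𝓜.interp ((E.prod E).c '' Pᶜ)}
  have hempty : ¬ (⋂₀ Set.range 𝒟).Nonempty := by
    rintro ⟨z, hz⟩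
    have hzr : z ∈ Set.range E.c' := by
      have h0 : Sum.elim (E.c' (rep (1 : G'))) z ∈ 𝓜.interp (Set.range (E.prod E).c) := by
        have h1 := hz (𝒟 (1 : G')) ⟨_, rfl⟩
        have h2 : 𝓜.interp ((E.prod E).c '' Pᶜ) ⊆ 𝓜.interp (Set.range (E.prod E).c) := by
          rw [← Set.inter_eq_left.2 (Set.image_subset_range (E.prod E).c Pᶜ), interp_inter]
          exact Set.inter_subset_right
        exact h2 h1
      rw [← (E.prod E).range_c'] at h0
      obtain ⟨p, hp⟩ := h0
      exact ⟨p.2, funext fun i => congrFun hp (Sum.inr i)⟩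
    obtain ⟨y, rfl⟩ := hzr
    have h1 : (rep (y : G' ⧸ H), y) ∈ (E.prod E).ext Pᶜ := hz (𝒟 y) ⟨_, rfl⟩
    rw [ext_compl] at h1
    exact h1 ((hP _ _).2 (hD (hrep y)))
  obtain ⟨S, hS, hcov⟩ :
      ∃ S : Set (G' ⧸ H), S.Finite ∧ ∀ y : G', ∃ q ∈ S, (rep q)⁻¹ * y ∈ E.ext D := by
    by_contra hcon
    push Not at hcon
    refine hempty (𝓜.tuple_saturated A hA _ ?_ ?_)
    · rintro _ ⟨q, rfl⟩
      exact 𝓜.definable_fiber _ fun i => ⟨(q, i), rfl⟩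
    · intro ℱ hℱ hfin
      rw [← Set.image_univ] at hℱ
      obtain ⟨S, -, hS, rfl⟩ := Set.exists_subset_image_finite_and.1 ⟨ℱ, hℱ, hfin, rfl⟩
      obtain ⟨y, hy⟩ := hcon S hS
      refine ⟨E.c' y, ?_⟩
      rintro _ ⟨q, hq, rfl⟩
      have h1 : (rep q, y) ∈ (E.prod E).ext Pᶜ := by
        rw [ext_compl]
        exact fun h => hy q hq ((hP _ _).1 h)
      exact h1
  have := hS.fintype
  let e := Fintype.equivFin S
  let a : Fin (Fintype.card S) → G' := fun k => rep (e.symm k)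
  by_contra hcon
  push Not at hcon
  choose τ hτ using fun p : Fin (Fintype.card S) → G => hcon (Set.range p) (Set.finite_range p)
  obtain ⟨τ', hτ'⟩ := (E.pow (Fintype.card S)).exists_extension E τ
  obtain ⟨q, hq, hqD⟩ := hcov (τ' a)
  have h1 : (E.prod E).tp (a (e ⟨q, hq⟩), τ' a) =
      (((E.pow (Fintype.card S)).prod E).tp (a, τ' a)).map fun p => (p.1 (e ⟨q, hq⟩), p.2) :=
    tp_map_of_reindex ((E.pow (Fintype.card S)).prod E) (E.prod E)
      (φ := fun p => (p.1 (e ⟨q, hq⟩), p.2)) (φ' := fun p => (p.1 (e ⟨q, hq⟩), p.2))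
      (Sum.map (fun i => (e ⟨q, hq⟩, i)) id) (fun _ i => by rcases i with i | i <;> rfl)
      (fun _ i => by rcases i with i | i <;> rfl) (a, τ' a)
  rw [hτ', Ultrafilter.map_map] at h1
  have h2 : Pᶜ ∈ (E.prod E).tp (a (e ⟨q, hq⟩), τ' a) := by
    rw [h1, Ultrafilter.mem_map]
    exact univ_mem' fun p => hτ p _ ⟨_, rfl⟩
  rw [mem_tp, ext_compl] at h2
  refine h2 ((hP _ _).2 ?_)
  simpa [a] using hqD

@[to_additive IsAddGroupCode.isAddTypeInvariant_of_mk_lt]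
theorem IsGroupCode.isTypeInvariant_of_mk_lt (hE : E.IsGroupCode) {H : Subgroup G'}
    (hb : Cardinal.mk (G' ⧸ H) < 𝓜.κ) (hH : E.IsTD (H : Set G')) : E.IsTypeInvariant H := by
  obtain ⟨f, hf⟩ := hH
  intro x y hxy
  change x⁻¹ * y ∈ (H : Set G')
  rw [← hf]
  intro U hU
  obtain ⟨V, hV, hVU⟩ := mem_prod_self_iff.1 (hE.tendsto_inv_mul hf hU)
  obtain ⟨F, hF, hcov⟩ := hE.exists_finite_cover hb
    (show (H : Set G') ⊆ E.ext V from hf ▸ monad_subset_ext.2 hV)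
  have h1 : (⋃ t ∈ F, {s | t⁻¹ * s ∈ V}) ∈ E.tp x := univ_mem' fun s => by
    obtain ⟨t, ht, hts⟩ := hcov s
    exact Set.mem_biUnion ht hts
  obtain ⟨t, -, ht⟩ := (Ultrafilter.finite_biUnion_mem_iff hF).1 h1
  have key : ∀ z, {s | t⁻¹ * s ∈ V} ∈ E.tp z → E.ι t⁻¹ * z ∈ E.ext V := fun z hz => by
    change V ∈ E.tp _
    rw [hE.tp_ι_mul]
    exact hz
  have h2 := hE.inv_mul_mem_ext (Z := U) (fun s hs t ht => hVU (Set.mk_mem_prod hs ht))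
    (key x ht) (key y (hxy ▸ ht))
  rw [mul_inv_rev, mul_assoc, inv_mul_cancel_left] at h2
  exact h2

end Code
end MonsterModel

/-! ### Compact quotients in the logic topology -/

namespace MonsterModel

open Filter Topology

variable {R : Type u} {𝓜 : MonsterModel.{u, v} R}

namespace Code

section Compact

variable {G : Type u} {G' : Type v} [Group G'] {E : 𝓜.Code G G'}

/-- The hypotheses under which `G' ⧸ H` is studied: `H` is type invariant and type-definable without
parameters, and the closed subsets of the quotient are those whose preimage is type-definable
without parameters. -/
@[to_additive /-- The hypotheses under which `G' ⧸ H` is studied: `H` is type invariant and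
type-definable without parameters, and the closed subsets of the quotient are those whose preimage
is type-definable without parameters. -/]
def IsGroupLogicQuotient (E : 𝓜.Code G G') (H : Subgroup G') [TopologicalSpace (G' ⧸ H)] : Prop :=
  E.IsTypeInvariant H ∧ E.IsTD (H : Set G') ∧
    ∀ C : Set (G' ⧸ H), IsClosed C ↔ E.IsTD ((fun g : G' => (g : G' ⧸ H)) ⁻¹' C)

/-- The cosets of `H` that are contained in the interpretation of `X`. -/
@[to_additive innerAddCosets /-- The cosets of `H` that are contained in the interpretation of
`X`. -/]
def innerCosets (E : 𝓜.Code G G') (H : Subgroup G') (X : Set G) : Set (G' ⧸ H) :=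
  {q | ∀ x : G', (x : G' ⧸ H) = q → x ∈ E.ext X}

/-- The quotient is a continuous image of the space of ultrafilters on `G`. -/
@[to_additive]
theorem IsGroupLogicQuotient.compactSpace {H : Subgroup G'} [TopologicalSpace (G' ⧸ H)]
    (hQ : E.IsGroupLogicQuotient H) : CompactSpace (G' ⧸ H) := by
  have hex : ∀ U : Ultrafilter G, ∃ x : G', E.tp x = U := fun U => by
    obtain ⟨x, hx⟩ := E.exists_tp_le (U : Filter G)
    exact ⟨x, Ultrafilter.coe_le_coe.1 hx⟩
  choose x hx using hex
  have hsurj : Function.Surjective fun U : Ultrafilter G => (x U : G' ⧸ H) := fun q => by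
    induction q using QuotientGroup.induction_on with | _ z => ?_
    exact ⟨E.tp z, QuotientGroup.eq.2 (hQ.1 _ _ (hx _))⟩
  refine hsurj.compactSpace (continuous_iff_isClosed.2 fun C hC => ?_)
  obtain ⟨f, hf⟩ := (hQ.2.2 C).1 hC
  have : (fun U : Ultrafilter G => (x U : G' ⧸ H)) ⁻¹' C =
      ⋂ X ∈ f, {U : Ultrafilter G | X ∈ U} := by
    ext U
    have h1 : x U ∈ E.monad f ↔ (x U : G' ⧸ H) ∈ C := by rw [hf]; rfl
    rw [Set.mem_preimage, ← h1, Set.mem_iInter₂]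
    change (∀ X ∈ f, X ∈ E.tp (x U)) ↔ _
    rw [hx]
    rfl
  rw [this]
  exact isClosed_biInter fun X _ => ultrafilter_isClosed_basic X

end Compact

section Quotient

variable {G : Type u} {G' : Type v} [Group G] [Group G'] {E : 𝓜.Code G G'}

/-- The product of a type-definable set with a type-definable, type invariant subgroup is
type-definable. -/
@[to_additive]
theorem IsTypeInvariant.monad_map_mul {H : Subgroup G'} (hH : E.IsTypeInvariant H)
    (hE : E.IsGroupCode) {f : Filter G} (hf : E.monad f = H) (k : Filter G) :
    E.monad (map (fun p : G × G => p.1 * p.2) (k ×ˢ f)) = {x | ∃ y ∈ E.monad k, y⁻¹ * x ∈ H} := by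
  ext x
  constructor
  · intro hx
    have hx' : (E.tp x : Filter G) ≤ map (fun p : G × G => p.1 * p.2) (k ×ˢ f) := hx
    have hne : ((k ×ˢ f) ⊓ comap (fun p : G × G => p.1 * p.2) (E.tp x)).NeBot := by
      rw [← map_neBot_iff (fun p : G × G => p.1 * p.2), Filter.push_pull, inf_eq_right.2 hx']
      infer_instance
    obtain ⟨⟨y, h⟩, hyh⟩ := (E.prod E).exists_tp_le
      ((k ×ˢ f) ⊓ comap (fun p : G × G => p.1 * p.2) (E.tp x))
    have hmem : (y, h) ∈ (E.prod E).monad (k ×ˢ f) := hyh.trans inf_le_left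
    rw [monad_prod, hf] at hmem
    have heq : E.tp (y * h) = E.tp x := by
      rw [hE.tp_mul]
      refine Ultrafilter.coe_le_coe.1 ?_
      rw [Ultrafilter.coe_map, map_le_iff_le_comap]
      exact hyh.trans inf_le_right
    refine ⟨y, hmem.1, ?_⟩
    have := H.mul_mem hmem.2 (hH _ _ heq)
    simpa [mul_assoc] using this
  · rintro ⟨y, hy, hyx⟩
    have hmem : (y, y⁻¹ * x) ∈ (E.prod E).monad (k ×ˢ f) := by
      rw [monad_prod, hf]
      exact ⟨hy, hyx⟩
    change (E.tp x : Filter G) ≤ _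
    have h1 := hE.tp_mul y (y⁻¹ * x)
    rw [mul_inv_cancel_left] at h1
    rw [h1, Ultrafilter.coe_map]
    exact map_mono hmem

/-- The cosets of `H` are type-definable without parameters. -/
@[to_additive]
theorem IsTypeInvariant.isTD_coset {H : Subgroup G'} (hH : E.IsTypeInvariant H)
    (hE : E.IsGroupCode) (hTD : E.IsTD (H : Set G')) (x : G') : E.IsTD {z | x⁻¹ * z ∈ H} := by
  obtain ⟨f, hf⟩ := hTD
  refine ⟨_, (hH.monad_map_mul hE hf (E.tp x)).trans ?_⟩
  ext z
  constructor
  · rintro ⟨y, hy, hyz⟩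
    have : E.tp y = E.tp x := Ultrafilter.coe_le_coe.1 hy
    have := H.mul_mem (hH x y this.symm) hyz
    simpa [mul_assoc] using this
  · exact fun hz => ⟨x, (le_rfl : (E.tp x : Filter G) ≤ E.tp x), hz⟩

/-- A homomorphism to a compact Hausdorff group extends to the interpretation, by limits along
types. -/
@[to_additive]
theorem IsGroupCode.exists_extension_hom (hE : E.IsGroupCode) {K : Type*} [Group K]
    [TopologicalSpace K] [IsTopologicalGroup K] [CompactSpace K] [T2Space K] (φ : G →* K) :
    ∃ φ' : G' →* K, ∀ x, Tendsto φ (E.tp x) (𝓝 (φ' x)) := by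
  let L : G' → K := fun x => ((E.tp x).map φ).lim
  have hL : ∀ x, Tendsto φ (E.tp x) (𝓝 (L x)) := fun x => ((E.tp x).map φ).le_nhds_lim
  refine ⟨MonoidHom.mk' L fun x y => ?_, hL⟩
  have h1 : Tendsto φ (E.tp (x * y)) (𝓝 (L x * L y)) := by
    rw [hE.tp_mul, Ultrafilter.coe_map, tendsto_map'_iff]
    have hx := hL x
    have hy := hL y
    rw [E.tp_fst E (x, y), Ultrafilter.coe_map, tendsto_map'_iff] at hx
    rw [E.tp_snd E (x, y), Ultrafilter.coe_map, tendsto_map'_iff] at hy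
    refine (hx.mul hy).congr fun p => ?_
    simp
  exact tendsto_nhds_unique (hL _) h1

variable {H : Subgroup G'} [TopologicalSpace (G' ⧸ H)]

@[to_additive]
theorem IsGroupLogicQuotient.isOpen_innerCosets (hQ : E.IsGroupLogicQuotient H) (hE : E.IsGroupCode)
    (X : Set G) : IsOpen (E.innerCosets H X) := by
  rw [← isClosed_compl_iff, hQ.2.2]
  obtain ⟨f, hf⟩ := hQ.2.1
  refine ⟨_, (hQ.1.monad_map_mul hE hf (𝓟 Xᶜ)).trans ?_⟩
  rw [monad_principal, ext_compl]
  ext z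
  rw [Set.mem_preimage, innerCosets, Set.mem_compl_iff, Set.mem_ofPred_eq, Set.mem_ofPred_eq]
  push Not
  refine exists_congr fun y => ?_
  rw [QuotientGroup.eq, and_comm]
  rfl

/-- The sets `innerCosets H X` form a basis of the logic topology. -/
@[to_additive]
theorem IsGroupLogicQuotient.exists_of_isOpen (hQ : E.IsGroupLogicQuotient H) (hE : E.IsGroupCode)
    {O : Set (G' ⧸ H)} (hO : IsOpen O) {x : G'} (hx : (x : G' ⧸ H) ∈ O) :
    ∃ X : Set G, (x : G' ⧸ H) ∈ E.innerCosets H X ∧ ∀ z ∈ E.ext X, (z : G' ⧸ H) ∈ O := by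
  obtain ⟨f, hf⟩ := hQ.1.isTD_coset hE hQ.2.1 x
  obtain ⟨g, hg⟩ := (hQ.2.2 Oᶜ).1 hO.isClosed_compl
  obtain ⟨X, hXf, hXg⟩ := disjoint_of_monad_disjoint (E := E) (f := f) (g := g) (by
    rw [hf, hg]
    refine Set.eq_empty_of_forall_notMem fun z hz => hz.2 ?_
    have : (x : G' ⧸ H) = z := QuotientGroup.eq.2 hz.1
    change (z : G' ⧸ H) ∈ O
    rwa [← this])
  refine ⟨X, fun z hz => ?_, fun z hz => ?_⟩
  · have : z ∈ E.monad f := by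
      rw [hf]
      exact QuotientGroup.eq.1 hz.symm
    exact this hXf
  · by_contra hzO
    have h1 : z ∈ E.monad g := by rw [hg]; exact hzO
    have h2 : z ∈ E.ext Xᶜ := h1 hXg
    rw [ext_compl] at h2
    exact h2 hz

@[to_additive]
theorem IsGroupLogicQuotient.t2Space (hQ : E.IsGroupLogicQuotient H) (hE : E.IsGroupCode) :
    T2Space (G' ⧸ H) := by
  refine ⟨fun p q hpq => ?_⟩
  induction p using QuotientGroup.induction_on with | _ x => ?_
  induction q using QuotientGroup.induction_on with | _ y => ?_
  obtain ⟨f, hf⟩ := hQ.1.isTD_coset hE hQ.2.1 x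
  obtain ⟨g, hg⟩ := hQ.1.isTD_coset hE hQ.2.1 y
  obtain ⟨X, hXf, hXg⟩ := disjoint_of_monad_disjoint (E := E) (f := f) (g := g) (by
    rw [hf, hg]
    refine Set.eq_empty_of_forall_notMem fun z hz => hpq ?_
    exact (QuotientGroup.eq.2 hz.1).trans (QuotientGroup.eq.2 hz.2).symm)
  refine ⟨_, _, hQ.isOpen_innerCosets hE X, hQ.isOpen_innerCosets hE Xᶜ, fun z hz => ?_,
    fun z hz => ?_, Set.disjoint_left.2 fun r => ?_⟩
  · have : z ∈ E.monad f := by rw [hf]; exact QuotientGroup.eq.1 hz.symm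
    exact this hXf
  · have : z ∈ E.monad g := by rw [hg]; exact QuotientGroup.eq.1 hz.symm
    exact this hXg
  · induction r using QuotientGroup.induction_on with | _ z => ?_
    intro h1 h2
    have h3 := h2 z rfl
    rw [ext_compl] at h3
    exact h3 (h1 z rfl)

@[to_additive]
theorem IsGroupLogicQuotient.isTopologicalGroup [H.Normal] (hQ : E.IsGroupLogicQuotient H)
    (hE : E.IsGroupCode) : IsTopologicalGroup (G' ⧸ H) where
  continuous_mul := by
    refine continuous_iff_continuousAt.2 fun ⟨p, q⟩ => ?_
    induction p using QuotientGroup.induction_on with | _ a => ?_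
    induction q using QuotientGroup.induction_on with | _ b => ?_
    intro N hN
    obtain ⟨O, hON, hO, hab⟩ := mem_nhds_iff.1 hN
    obtain ⟨X, hX, hXO⟩ := hQ.exists_of_isOpen hE hO (x := a * b) hab
    obtain ⟨f, hf⟩ := hQ.1.isTD_coset hE hQ.2.1 a
    obtain ⟨g, hg⟩ := hQ.1.isTD_coset hE hQ.2.1 b
    have hP : {p : G × G | p.1 * p.2 ∈ X} ∈ f ×ˢ g := by
      refine mem_prod_of_forall (E := E) (F := E) fun x hx y hy => ?_
      rw [hf] at hx
      rw [hg] at hy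
      have hx' : (a : G' ⧸ H) = x := QuotientGroup.eq.2 hx
      have hy' : (b : G' ⧸ H) = y := QuotientGroup.eq.2 hy
      have h1 : X ∈ E.tp (x * y) := hX (x * y) (by
        rw [QuotientGroup.mk_mul, QuotientGroup.mk_mul, hx', hy'])
      rw [hE.tp_mul] at h1
      exact h1
    obtain ⟨A, hA, B, hB, hAB⟩ := mem_prod_iff.1 hP
    have hA' : (a : G' ⧸ H) ∈ E.innerCosets H A := fun z hz => by
      have : z ∈ E.monad f := by rw [hf]; exact QuotientGroup.eq.1 hz.symm
      exact this hA
    have hB' : (b : G' ⧸ H) ∈ E.innerCosets H B := fun z hz => by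
      have : z ∈ E.monad g := by rw [hg]; exact QuotientGroup.eq.1 hz.symm
      exact this hB
    refine mem_map.2 (mem_of_superset (prod_mem_nhds ((hQ.isOpen_innerCosets hE A).mem_nhds hA')
      ((hQ.isOpen_innerCosets hE B).mem_nhds hB')) ?_)
    rintro ⟨p, q⟩ ⟨hp, hq⟩
    induction p using QuotientGroup.induction_on with | _ x => ?_
    induction q using QuotientGroup.induction_on with | _ y => ?_
    refine hON (hXO (x * y) ?_)
    exact hE.mul_mem_ext (fun s hs t ht => hAB (Set.mk_mem_prod hs ht)) (hp x rfl) (hq y rfl)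
  continuous_inv := by
    refine continuous_iff_continuousAt.2 fun p => ?_
    induction p using QuotientGroup.induction_on with | _ a => ?_
    intro N hN
    obtain ⟨O, hON, hO, ha⟩ := mem_nhds_iff.1 hN
    obtain ⟨X, hX, hXO⟩ := hQ.exists_of_isOpen hE hO (x := a⁻¹) ha
    have key : ∀ z, z ∈ E.ext ((fun g => g⁻¹) ⁻¹' X) ↔ z⁻¹ ∈ E.ext X := fun z => by
      rw [← mem_tp, ← mem_tp, hE.tp_inv]
      rfl
    have ha' : (a : G' ⧸ H) ∈ E.innerCosets H ((fun g => g⁻¹) ⁻¹' X) := fun z hz =>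
      (key z).2 (hX z⁻¹ (by rw [QuotientGroup.mk_inv, QuotientGroup.mk_inv, hz]))
    refine mem_map.2 (mem_of_superset ((hQ.isOpen_innerCosets hE _).mem_nhds ha') fun p hp => ?_)
    induction p using QuotientGroup.induction_on with | _ x => ?_
    exact hON (hXO x⁻¹ ((key x).1 (hp x rfl)))

@[to_additive]
theorem IsGroupLogicQuotient.denseRange (hQ : E.IsGroupLogicQuotient H) (hE : E.IsGroupCode) :
    DenseRange fun g : G => (E.ι g : G' ⧸ H) := by
  refine dense_iff_inter_open.2 fun O hO hne => ?_
  obtain ⟨q, hq⟩ := hne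
  induction q using QuotientGroup.induction_on with | _ x => ?_
  obtain ⟨X, hX, hXO⟩ := hQ.exists_of_isOpen hE hO hq
  obtain ⟨s, hs⟩ : X.Nonempty := by
    rw [Set.nonempty_iff_ne_empty]
    rintro rfl
    have := hX x rfl
    rwa [ext_empty] at this
  exact ⟨_, hXO _ (E.ι_mem_ext.2 hs), s, rfl⟩

end Quotient

/-! ### Intersections of interpretations of open sets -/

section OpenTD

variable {S T : Type u} {S' T' : Type v} {E : 𝓜.Code S S'} {F : 𝓜.Code T T'}
  [TopologicalSpace S] [TopologicalSpace T]

/-- The intersections of interpretations of open sets. -/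
def IsOpenTD (E : 𝓜.Code S S') (Y : Set S') : Prop :=
  ∀ x, (∀ U, IsOpen U → Y ⊆ E.ext U → x ∈ E.ext U) → x ∈ Y

theorem IsOpenTD.exists_filter {Y : Set S'} (hY : E.IsOpenTD Y) :
    ∃ f : Filter S, E.monad f = Y ∧ ∀ X ∈ f, ∃ U ∈ f, IsOpen U ∧ U ⊆ X := by
  let f : Filter S :=
    { sets := {X | ∃ U, IsOpen U ∧ Y ⊆ E.ext U ∧ U ⊆ X}
      univ_sets := ⟨Set.univ, isOpen_univ, by rw [ext_univ]; exact Set.subset_univ _, subset_rfl⟩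
      sets_of_superset := fun ⟨U, h1, h2, h3⟩ h => ⟨U, h1, h2, h3.trans h⟩
      inter_sets := fun ⟨U, h1, h2, h3⟩ ⟨V, h1', h2', h3'⟩ => ⟨U ∩ V, h1.inter h1',
        by rw [ext_inter]; exact Set.subset_inter h2 h2', Set.inter_subset_inter h3 h3'⟩ }
  refine ⟨f, Set.Subset.antisymm
    (fun x hx => hY x fun U h1 h2 => hx ⟨U, h1, h2, subset_rfl⟩) ?_, ?_⟩
  · rintro x hx X ⟨U, -, h2, h3⟩
    exact E.ext_mono h3 (h2 hx)
  · rintro X ⟨U, h1, h2, h3⟩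
    exact ⟨U, ⟨U, h1, h2, subset_rfl⟩, h1, h3⟩

theorem IsOpenTD.isTD {Y : Set S'} (hY : E.IsOpenTD Y) : E.IsTD Y := by
  obtain ⟨f, hf, -⟩ := hY.exists_filter
  exact ⟨f, hf⟩

theorem isOpenTD_of_filter {f : Filter S} (hf : ∀ X ∈ f, ∃ U ∈ f, IsOpen U ∧ U ⊆ X) :
    E.IsOpenTD (E.monad f) := by
  intro x hx X hX
  obtain ⟨U, hU, hUo, hUX⟩ := hf X hX
  exact E.ext_mono hUX (hx U hUo (monad_subset_ext.2 hU))

theorem IsOpenTD.iInter {κ : Sort*} {Y : κ → Set S'} (h : ∀ k, E.IsOpenTD (Y k)) :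
    E.IsOpenTD (⋂ k, Y k) := fun x hx => Set.mem_iInter.2 fun k => h k x fun U hU hUk =>
  hx U hU ((Set.iInter_subset _ k).trans hUk)

theorem IsOpenTD.preimage {φ : S → T} {φ' : S' → T'} (h : ∀ x, F.tp (φ' x) = (E.tp x).map φ)
    (hφ : Continuous φ) {Y : Set T'} (hY : F.IsOpenTD Y) : E.IsOpenTD (φ' ⁻¹' Y) := by
  intro x hx
  have key : ∀ z U, φ' z ∈ F.ext U ↔ z ∈ E.ext (φ ⁻¹' U) := fun z U => by
    rw [← mem_tp, h]
    rfl
  exact hY _ fun U hU hUY => (key x U).2 (hx _ (hU.preimage hφ) fun z hz => (key z U).1 (hUY hz))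

end OpenTD

section Topo

variable {G : Type u} {G' : Type v} [Group G] [Group G'] {E : 𝓜.Code G G'} [TopologicalSpace G]

@[to_additive isAddTopoSubgroup_iff]
theorem IsGroupCode.isTopoSubgroup_iff (hE : E.IsGroupCode) (H : Subgroup G') :
    𝓜.IsTopoSubgroup E.c E.c' H ↔ E.IsTypeInvariant H ∧ E.IsOpenTD (H : Set G') := by
  constructor
  · rintro ⟨hb, 𝒰, h𝒰, hH⟩
    have ho : E.IsOpenTD (H : Set G') := fun x hx => by
      rw [hH]
      exact Set.mem_iInter₂.2 fun U hU => hx U (h𝒰 U hU) (hH ▸ Set.biInter_subset_of_mem hU)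
    exact ⟨hE.isTypeInvariant_of_mk_lt hb ho.isTD, ho⟩
  · rintro ⟨hT, ho⟩
    refine ⟨hT.mk_lt, {U | IsOpen U ∧ (H : Set G') ⊆ E.ext U}, fun U hU => hU.1, ?_⟩
    refine Set.Subset.antisymm (Set.subset_iInter₂ fun U hU => hU.2) fun x hx => ?_
    exact ho x fun U h1 h2 => Set.mem_iInter₂.1 hx U ⟨h1, h2⟩

/-- The topological component is itself a topological subgroup, since intersections of type
invariant subgroups are type invariant. -/
@[to_additive isAddTopoSubgroup_addTopoComponent]
theorem IsGroupCode.isTopoSubgroup_topoComponent (hE : E.IsGroupCode) :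
    𝓜.IsTopoSubgroup E.c E.c' (𝓜.topoComponent E.c E.c' : Subgroup G') := by
  rw [hE.isTopoSubgroup_iff, topoComponent]
  constructor
  · exact fun x y hxy => Subgroup.mem_sInf.2 fun K hK => ((hE.isTopoSubgroup_iff K).1 hK).1 x y hxy
  · rw [Subgroup.coe_sInf]
    exact IsOpenTD.iInter fun K => IsOpenTD.iInter fun hK => ((hE.isTopoSubgroup_iff K).1 hK).2

/-- A type-definable subgroup that contains a topological subgroup is a topological subgroup. -/
@[to_additive]
theorem IsGroupCode.isOpenTD_of_le [ContinuousMul G] (hE : E.IsGroupCode) {H K : Subgroup G'}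
    (hH : E.IsTypeInvariant H) (hHo : E.IsOpenTD (H : Set G')) (hK : E.IsTD (K : Set G'))
    (hHK : H ≤ K) : E.IsOpenTD (K : Set G') := by
  obtain ⟨f, hf, hfo⟩ := hHo.exists_filter
  obtain ⟨k, hk⟩ := hK
  have h1 := hH.monad_map_mul hE hf k
  have h2 : {x | ∃ y ∈ E.monad k, y⁻¹ * x ∈ H} = (K : Set G') := by
    ext x
    rw [hk]
    constructor
    · rintro ⟨y, hy, hyx⟩
      have := K.mul_mem hy (hHK hyx)
      rwa [mul_inv_cancel_left] at this
    · exact fun hx => ⟨x, hx, by rw [inv_mul_cancel]; exact H.one_mem⟩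
  rw [← h2, ← h1]
  refine isOpenTD_of_filter fun X hX => ?_
  obtain ⟨A, hA, B, hB, hAB⟩ := mem_prod_iff.1 hX
  obtain ⟨U, hU, hUo, hUB⟩ := hfo B hB
  refine ⟨⋃ a ∈ A, (fun s => a * s) '' U, ?_, ?_, ?_⟩
  · refine mem_map.2 (mem_of_superset (prod_mem_prod hA hU) ?_)
    rintro ⟨a, s⟩ ⟨ha, hs⟩
    exact Set.mem_biUnion ha ⟨s, hs, rfl⟩
  · exact isOpen_biUnion fun a _ => (Homeomorph.mulLeft a).isOpenMap U hUo
  · refine Set.iUnion₂_subset fun a ha => ?_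
    rintro _ ⟨s, hs, rfl⟩
    exact hAB (Set.mk_mem_prod ha (hUB hs))

@[to_additive]
theorem IsGroupLogicQuotient.continuous_mk [ContinuousMul G] {H : Subgroup G'}
    [TopologicalSpace (G' ⧸ H)] (hQ : E.IsGroupLogicQuotient H) (hE : E.IsGroupCode)
    (ho : E.IsOpenTD (H : Set G')) : Continuous fun g : G => (E.ι g : G' ⧸ H) := by
  obtain ⟨f, hf, hfo⟩ := ho.exists_filter
  refine continuous_iff_continuousAt.2 fun g N hN => ?_
  obtain ⟨O, hON, hO, hg⟩ := mem_nhds_iff.1 hN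
  obtain ⟨X, hX, hXO⟩ := hQ.exists_of_isOpen hE hO hg
  have h1 : (fun s => g * s) ⁻¹' X ∈ f := by
    refine monad_subset_ext (E := E).1 fun x hx => ?_
    rw [hf] at hx
    have : X ∈ E.tp (E.ι g * x) := hX _ (QuotientGroup.eq.2 (by
      rw [mul_inv_rev, inv_mul_cancel_right]; exact H.inv_mem hx))
    rw [hE.tp_ι_mul] at this
    exact this
  obtain ⟨U, hU, hUo, hUX⟩ := hfo _ h1
  have hU1 : (1 : G) ∈ U := by
    rw [← E.ι_mem_ext, hE.ι_one]
    have h2 : (1 : G') ∈ E.monad f := by rw [hf]; exact H.one_mem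
    exact h2 hU
  refine mem_map.2 (mem_of_superset (((Homeomorph.mulLeft g).isOpenMap U hUo).mem_nhds
    ⟨1, hU1, mul_one g⟩) ?_)
  rintro _ ⟨s, hs, rfl⟩
  exact hON (hXO _ (E.ι_mem_ext.2 (hUX hs)))

/-- The smallest topological subgroup is normal. It is invariant under conjugation by elements of
`G`, and finitely many translates by elements of `G` of the interpretation of any set that contains
it cover `G'`. -/
theorem IsGroupCode.normal_of_minimal [IsTopologicalGroup G] (hE : E.IsGroupCode)
    {H : Subgroup G'} (hH : 𝓜.IsTopoSubgroup E.c E.c' H)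
    (hmin : ∀ K : Subgroup G', 𝓜.IsTopoSubgroup E.c E.c' K → H ≤ K) : H.Normal := by
  obtain ⟨hT, ho⟩ := (hE.isTopoSubgroup_iff H).1 hH
  have htp : ∀ g x, E.tp (E.ι g * x * (E.ι g)⁻¹) = (E.tp x).map fun s => g * s * g⁻¹ := by
    intro g x
    rw [← hE.ι_inv, hE.tp_mul_ι, hE.tp_ι_mul, Ultrafilter.map_map]
    rfl
  have hconj : ∀ g, ∀ x ∈ H, E.ι g * x * (E.ι g)⁻¹ ∈ H := by
    intro g
    refine hmin (H.comap (MulAut.conj (E.ι g)).toMonoidHom) ((hE.isTopoSubgroup_iff _).2 ⟨?_, ?_⟩)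
    · intro x y hxy
      have := hT (E.ι g * x * (E.ι g)⁻¹) (E.ι g * y * (E.ι g)⁻¹) (by rw [htp, htp, hxy])
      change E.ι g * (x⁻¹ * y) * (E.ι g)⁻¹ ∈ H
      simpa [mul_assoc] using this
    · exact ho.preimage (F := E) (φ' := fun x => E.ι g * x * (E.ι g)⁻¹) (htp g) (by fun_prop)
  refine ⟨fun h hh x => ?_⟩
  obtain ⟨f, hf, -⟩ := ho.exists_filter
  change x * h * x⁻¹ ∈ (H : Set G')
  rw [← hf]
  intro U hU
  obtain ⟨V, hV, hVU⟩ := mem_prod_self_iff.1 (hE.tendsto_mul hf hU)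
  obtain ⟨W, hW, hWV⟩ := mem_prod_self_iff.1 (hE.tendsto_inv_mul hf hV)
  have hWV' : W ∩ V ∈ f := inter_mem hW hV
  obtain ⟨F, hF, hcov⟩ := hE.exists_finite_cover hH.1
    (show (H : Set G') ⊆ E.ext (W ∩ V) from hf ▸ monad_subset_ext.2 hWV')
  have h1 : (⋃ t ∈ F, {s | t⁻¹ * s ∈ W ∩ V}) ∈ E.tp x⁻¹ := univ_mem' fun s => by
    obtain ⟨t, ht, hts⟩ := hcov s
    exact Set.mem_biUnion ht hts
  obtain ⟨t, -, ht⟩ := (Ultrafilter.finite_biUnion_mem_iff hF).1 h1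
  have hw : E.ι t⁻¹ * x⁻¹ ∈ E.ext (W ∩ V) := by
    change _ ∈ E.tp _
    rw [hE.tp_ι_mul]
    exact ht
  have hh' : E.ι t⁻¹ * h * (E.ι t⁻¹)⁻¹ ∈ E.ext (W ∩ V) := by
    have : E.ι t⁻¹ * h * (E.ι t⁻¹)⁻¹ ∈ E.monad f := by rw [hf]; exact hconj _ _ hh
    exact this hWV'
  rw [ext_inter] at hw hh'
  have h2 := hE.inv_mul_mem_ext (Z := V) (fun s hs t ht => hWV (Set.mk_mem_prod hs ht)) hw.1 hh'.1
  have h3 := hE.mul_mem_ext (Z := U) (fun s hs t ht => hVU (Set.mk_mem_prod hs ht)) h2 hw.2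
  have h4 : (E.ι t⁻¹ * x⁻¹)⁻¹ * (E.ι t⁻¹ * h * (E.ι t⁻¹)⁻¹) * (E.ι t⁻¹ * x⁻¹) = x * h * x⁻¹ := by
    simp [mul_assoc]
  rw [h4] at h3
  exact h3

/-- The quotient by the smallest topological subgroup is the Bohr compactification: the kernel of
the extension of any compactification is a topological subgroup. -/
@[to_additive]
theorem IsGroupLogicQuotient.isBohrCompactification [IsTopologicalGroup G] {H : Subgroup G'}
    [H.Normal] [TopologicalSpace (G' ⧸ H)] (hQ : E.IsGroupLogicQuotient H) (hE : E.IsGroupCode)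
    (ho : E.IsOpenTD (H : Set G'))
    (hmin : ∀ K : Subgroup G', 𝓜.IsTopoSubgroup E.c E.c' K → H ≤ K) (φ : G →* G' ⧸ H)
    (hφ : ∀ g, φ g = (E.ι g : G' ⧸ H)) : IsBohrCompactification.{u, v, w} φ := by
  have hφ' : ⇑φ = fun g : G => (E.ι g : G' ⧸ H) := funext hφ
  have hd : DenseRange φ := hφ' ▸ hQ.denseRange hE
  refine ⟨⟨hQ.isTopologicalGroup hE, hQ.compactSpace, hQ.t2Space hE,
    hφ' ▸ hQ.continuous_mk hE ho, hd⟩, ?_⟩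
  intro K _ _ ψ hψ
  obtain ⟨h1, h2, h3, hψc, -⟩ := hψ
  obtain ⟨Ψ, hΨ⟩ := hE.exists_extension_hom ψ
  have hΨtp : ∀ x y, E.tp x = E.tp y → Ψ x = Ψ y := fun x y hxy =>
    tendsto_nhds_unique (hΨ x) (hxy ▸ hΨ y)
  have hΨι : ∀ g, Ψ (E.ι g) = ψ g := fun g => by
    have := hΨ (E.ι g)
    rw [E.tp_ι] at this
    exact tendsto_nhds_unique this (tendsto_pure_nhds ψ g)
  have hclosed : ∀ C : Set K, IsClosed C → Ψ ⁻¹' C = E.monad (comap ψ (𝓝ˢ C)) := by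
    intro C hC
    ext x
    change _ ↔ (E.tp x : Filter G) ≤ _
    rw [← tendsto_iff_comap]
    constructor
    · exact fun hx => (hΨ x).mono_right (nhds_le_nhdsSet hx)
    · intro hx
      by_contra hxC
      have hdis : Disjoint (𝓝ˢ C) (𝓝 (Ψ x)) := disjoint_nhdsSet_nhds.2 (by rwa [hC.closure_eq])
      exact ((inferInstance : (map ψ (E.tp x)).NeBot).ne (hdis.le_bot.antisymm' bot_le ▸
        le_bot_iff.1 (hdis hx (hΨ x))))
  have hker : 𝓜.IsTopoSubgroup E.c E.c' Ψ.ker := by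
    rw [hE.isTopoSubgroup_iff]
    constructor
    · intro x y hxy
      rw [MonoidHom.mem_ker, map_mul, map_inv, hΨtp x y hxy, inv_mul_cancel]
    · have h4 : (Ψ.ker : Set G') = E.monad (comap ψ (𝓝ˢ {1})) := by
        rw [← hclosed _ isClosed_singleton]
        rfl
      rw [h4]
      refine isOpenTD_of_filter fun X hX => ?_
      rw [nhdsSet_singleton] at hX ⊢
      obtain ⟨N, hN, hNX⟩ := hX
      obtain ⟨O, hON, hO, hO1⟩ := mem_nhds_iff.1 hN
      exact ⟨ψ ⁻¹' O, preimage_mem_comap (hO.mem_nhds hO1), hO.preimage hψc,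
        (Set.preimage_mono hON).trans hNX⟩
  have hle : H ≤ Ψ.ker := hmin _ hker
  have hcont : Continuous (QuotientGroup.lift H Ψ hle) := by
    refine continuous_iff_isClosed.2 fun C hC => (hQ.2.2 _).2 ⟨_, (hclosed C hC).symm.trans ?_⟩
    rfl
  refine ⟨⟨QuotientGroup.lift H Ψ hle, hcont⟩, fun g => ?_, fun f hf => ?_⟩
  · change QuotientGroup.lift H Ψ hle (φ g) = ψ g
    rw [hφ, QuotientGroup.lift_mk, hΨι]
  · refine DFunLike.coe_injective (hd.equalizer f.continuous_toFun hcont (funext fun g => ?_))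
    refine (hf g).trans ?_
    change ψ g = QuotientGroup.lift H Ψ hle (φ g)
    rw [hφ, QuotientGroup.lift_mk, hΨι]

end Topo

end Code
end MonsterModel

/-! ### Representations of compact abelian groups -/

section CompactGroup

open MeasureTheory InnerProductSpace
open scoped RealInnerProductSpace ENNReal

/-- A function `ℓ` on a group that behaves like the distance to `1` in a linear group: it is
invariant under inversion, subadditive, and satisfies `2 ℓ(x) ≤ ℓ(x²) + ℓ(x)²`. The last condition
forbids small subgroups. -/
structure IsLinearLength {D : Type*} [CommGroup D] (ℓ : D → ℝ) : Prop where
  nonneg : ∀ x, 0 ≤ ℓ x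
  one : ℓ 1 = 0
  mul_le : ∀ x y, ℓ (x * y) ≤ ℓ x + ℓ y
  inv_le : ∀ x, ℓ x⁻¹ ≤ ℓ x
  two_mul_le : ∀ x, 2 * ℓ x ≤ ℓ (x * x) + ℓ x ^ 2

/-- A multiplicative map from a group to the contractions in a normed algebra gives a length. -/
theorem isLinearLength_norm_sub_one {D : Type*} [CommGroup D] {A : Type*} [NormedRing A]
    [NormedAlgebra ℝ A]
    (π : D →* A) (hπ : ∀ x, ‖π x‖ ≤ 1) : IsLinearLength fun x => ‖π x - 1‖ where
  nonneg x := norm_nonneg _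
  one := by simp
  mul_le x y := by
    have h : π (x * y) - 1 = π x * (π y - 1) + (π x - 1) := by rw [map_mul]; noncomm_ring
    rw [h]
    refine (norm_add_le _ _).trans ?_
    have h1 : ‖π x * (π y - 1)‖ ≤ 1 * ‖π y - 1‖ :=
      (norm_mul_le _ _).trans (mul_le_mul_of_nonneg_right (hπ x) (norm_nonneg _))
    linarith
  inv_le x := by
    have h : π x⁻¹ - 1 = -(π x⁻¹ * (π x - 1)) := by
      rw [mul_sub, ← map_mul, inv_mul_cancel, map_one]
      noncomm_ring
    rw [h, norm_neg]
    have h1 : ‖π x⁻¹ * (π x - 1)‖ ≤ 1 * ‖π x - 1‖ :=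
      (norm_mul_le _ _).trans (mul_le_mul_of_nonneg_right (hπ _) (norm_nonneg _))
    linarith
  two_mul_le x := by
    have h : (π x - 1) + (π x - 1) = (π (x * x) - 1) - (π x - 1) * (π x - 1) := by
      rw [map_mul]; noncomm_ring
    have h1 : ‖(π x - 1) + (π x - 1)‖ = 2 * ‖π x - 1‖ := by
      rw [← two_smul ℝ (π x - 1), norm_smul, Real.norm_ofNat]
    rw [← h1, h]
    refine (norm_sub_le _ _).trans (add_le_add_right ?_ _)
    rw [sq]
    exact norm_mul_le _ _

/-- A subgroup on which a linear length is at most `1 / 2` has length `0`, because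
`2 ℓ(x) ≤ ℓ(x²) + ℓ(x)²` improves a bound `b` for `ℓ` on the subgroup to `3 b / 4`. -/
theorem IsLinearLength.eq_zero {D : Type*} [CommGroup D] {ℓ : D → ℝ} (h : IsLinearLength ℓ)
    (H : Subgroup D) (hH : ∀ x ∈ H, ℓ x ≤ 1 / 2) : ∀ x ∈ H, ℓ x = 0 := by
  have h1 : ∀ n : ℕ, ∀ x ∈ H, ℓ x ≤ (3 / 4) ^ n * (1 / 2) := by
    intro n
    induction n with
    | zero => simpa using hH
    | succ n ih =>
      intro x hx
      have h2 := ih _ (H.mul_mem hx hx)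
      have h3 := h.two_mul_le x
      have h4 := ih x hx
      have h5 := hH x hx
      have h6 := h.nonneg x
      rw [pow_succ]
      nlinarith
  intro x hx
  refine le_antisymm ?_ (h.nonneg x)
  have h2 : Filter.Tendsto (fun n : ℕ => (3 / 4 : ℝ) ^ n * (1 / 2)) Filter.atTop
      (nhds (0 * (1 / 2))) :=
    (tendsto_pow_atTop_nhds_zero_of_lt_one (by norm_num) (by norm_num)).mul_const _
  rw [zero_mul] at h2
  exact ge_of_tendsto' h2 fun n => h1 n x hx

variable {D : Type v} [CommGroup D] [TopologicalSpace D]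

theorem exists_isLinearLength_of_finiteDimensional {W : Type*} [NormedAddCommGroup W]
    [NormedSpace ℝ W] [FiniteDimensional ℝ W] (π : D →* (W →L[ℝ] W)) (hπ : ∀ x z, ‖π x z‖ ≤ ‖z‖)
    (hc : ∀ z, Continuous fun x => π x z) (d : D) (z : W) (hz : π d z ≠ z) :
    ∃ ℓ : D → ℝ, IsLinearLength ℓ ∧ Continuous ℓ ∧ ℓ d ≠ 0 := by
  refine ⟨fun x => ‖π x - 1‖, isLinearLength_norm_sub_one (A := W →L[ℝ] W) π fun x => ?_, ?_, ?_⟩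
  · refine ContinuousLinearMap.opNorm_le_bound _ zero_le_one fun z => ?_
    rw [one_mul]
    exact hπ x z
  · exact (Continuous.sub (f := fun x => π x) (continuous_clm_apply.2 hc) continuous_const).norm
  · intro h0
    have h : π d = 1 := sub_eq_zero.1 (norm_eq_zero.1 h0)
    exact hz (DFunLike.congr_fun h z)

variable [IsTopologicalGroup D] [CompactSpace D]

/-- The average over a compact group of the rank one operators attached to the translates of a
nonzero vector `v` is a nonzero compact symmetric operator that commutes with the group. -/
theorem exists_isCompactOperator_commuting {V : Type*} [NormedAddCommGroup V]
    [InnerProductSpace ℝ V] [CompleteSpace V] (U : D → V →ₗᵢ[ℝ] V)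
    (hmul : ∀ x y f, U (x * y) f = U x (U y f)) (hone : ∀ f, U 1 f = f)
    (hU : ∀ f, Continuous fun x => U x f) {v : V} (hv : v ≠ 0) :
    ∃ T : V →L[ℝ] V, IsCompactOperator T ∧ T.IsSymmetric ∧ T ≠ 0 ∧
      (∀ y z, T (U y z) = U y (T z)) ∧ ∀ z, (∀ x, ⟪U x v, z⟫ = 0) → T z = 0 := by
  borelize D
  let μ : Measure D := Measure.haarMeasure ⊤
  have : IsProbabilityMeasure μ := ⟨Measure.haarMeasure_self⟩
  let K : D → V →L[ℝ] V := fun x => rankOne ℝ (U x v) (U x v)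
  have hK : Continuous K := by
    have h := hU v
    exact ((rankOne ℝ : V →L[ℝ] V →L⋆[ℝ] V →L[ℝ] V).continuous.comp h).clm_apply h
  have hKi : Integrable K μ :=
    hK.integrable_of_hasCompactSupport (HasCompactSupport.of_compactSpace K)
  let T : V →L[ℝ] V := ∫ x, K x ∂μ
  have hT : ∀ z, T z = ∫ x, ⟪U x v, z⟫ • U x v ∂μ := fun z => by
    rw [ContinuousLinearMap.integral_apply hKi]
    rfl
  have hinner : ∀ z y, ⟪T z, y⟫ = ∫ x, ⟪U x v, z⟫ * ⟪U x v, y⟫ ∂μ := fun z y => by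
    have hi : Integrable (fun x => ⟪U x v, z⟫ • U x v) μ :=
      (Continuous.smul ((hU v).inner continuous_const) (hU v)).integrable_of_hasCompactSupport
        (HasCompactSupport.of_compactSpace _)
    rw [hT, real_inner_comm, ← integral_inner hi]
    refine integral_congr_ae (Filter.Eventually.of_forall fun x => ?_)
    simp only [real_inner_smul_right, real_inner_comm]
  have hcomp : IsCompactOperator T := by
    have hc : Convex ℝ {S : V →L[ℝ] V | IsCompactOperator S} :=
      (compactOperator (RingHom.id ℝ) V V).convex
    refine hc.integral_mem isClosed_setOfPred_isCompactOperator
      (Filter.Eventually.of_forall fun x => ?_) hKi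
    exact (isCompactOperator_of_locallyCompactSpace_rng
      (ContinuousLinearMap.toSpanSingleton ℝ (U x v))).comp_clm (innerSL ℝ (U x v))
  have hsymm : T.IsSymmetric := fun z y => by
    change ⟪T z, y⟫ = ⟪z, T y⟫
    rw [hinner, real_inner_comm, hinner]
    exact integral_congr_ae (Filter.Eventually.of_forall fun x => mul_comm _ _)
  have hT0 : T ≠ 0 := by
    intro h0
    have h1 := hinner v v
    rw [h0, zero_apply, inner_zero_left] at h1
    have hc : Continuous fun x => ⟪U x v, v⟫ * ⟪U x v, v⟫ :=
      ((hU v).inner continuous_const).mul ((hU v).inner continuous_const)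
    refine h1.not_lt (hc.integral_pos_of_hasCompactSupport_nonneg_nonzero
      (HasCompactSupport.of_compactSpace _) (fun x => mul_self_nonneg _) (x := 1) ?_)
    rw [hone]
    exact mul_self_ne_zero.2 (inner_self_ne_zero.2 hv)
  have hcomm : ∀ y z, T (U y z) = U y (T z) := fun y z => by
    have hi : Integrable (fun x => ⟪U x v, z⟫ • U x v) μ :=
      (Continuous.smul ((hU v).inner continuous_const) (hU v)).integrable_of_hasCompactSupport
        (HasCompactSupport.of_compactSpace _)
    rw [hT, hT, ← integral_mul_left_eq_self _ y]
    have h1 : ∀ x, ⟪U (y * x) v, U y z⟫ • U (y * x) v = U y (⟪U x v, z⟫ • U x v) := fun x => by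
      rw [hmul, LinearIsometry.inner_map_map, map_smul]
    simp_rw [h1]
    exact (U y).toContinuousLinearMap.integral_comp_comm hi
  exact ⟨T, hcomp, hsymm, hT0, hcomm, fun z hz => by rw [hT]; simp [hz]⟩

/-- If `d` acts nontrivially in a continuous orthogonal representation of a compact abelian group,
then it acts nontrivially in a finite dimensional one. The latter is found as an eigenspace of the
average of the rank one operators attached to the translates of a vector `f - d f`: every vector
fixed by `d` is orthogonal to these translates. -/
theorem exists_isLinearLength_of_representation {V : Type*} [NormedAddCommGroup V]
    [InnerProductSpace ℝ V] [CompleteSpace V] (U : D → V →ₗᵢ[ℝ] V)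
    (hmul : ∀ x y f, U (x * y) f = U x (U y f)) (hone : ∀ f, U 1 f = f)
    (hU : ∀ f, Continuous fun x => U x f) (d : D) (f : V) (hf : U d f ≠ f) :
    ∃ ℓ : D → ℝ, IsLinearLength ℓ ∧ Continuous ℓ ∧ ℓ d ≠ 0 := by
  obtain ⟨T, hcomp, hsymm, hT0, hcomm, hTz⟩ :=
    exists_isCompactOperator_commuting U hmul hone hU (sub_ne_zero.2 hf.symm)
  obtain ⟨c, hc, hc0⟩ : ∃ c, Module.End.HasEigenvalue (T : Module.End ℝ V) c ∧ c ≠ 0 := by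
    by_contra hcon
    push Not at hcon
    exact hT0 ((T.eq_zero_of_forall_hasEigenvalue_eq_zero hcomp hsymm).1 hcon)
  let W := Module.End.eigenspace (T : Module.End ℝ V) c
  have hW : ∀ z, z ∈ W ↔ T z = c • z := fun z => Module.End.mem_eigenspace_iff
  have hTW : ∀ z ∈ W, (T : V →ₗ[ℝ] V) z ∈ W := fun z hz => by
    rw [show (T : V →ₗ[ℝ] V) z = c • z from (hW z).1 hz]
    exact W.smul_mem c hz
  have hWc : IsClosed (W : Set V) := by
    have : (W : Set V) = {z | T z = c • z} := Set.ext hW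
    rw [this]
    exact isClosed_eq T.continuous (continuous_const_smul c)
  have hfin : FiniteDimensional ℝ W := by
    -- the restriction of the compact operator `T` to `W` is multiplication by `c ≠ 0`
    have h1 : IsCompactOperator ((T : V →ₗ[ℝ] V).restrict hTW) :=
      IsCompactOperator.restrict (f := (T : V →ₗ[ℝ] V)) hcomp hTW hWc
    have h2 : (c⁻¹ • ((T : V →ₗ[ℝ] V).restrict hTW) : W → W) = id := by
      ext z
      have h3 : T z = c • (z : V) := (hW z).1 z.2
      change c⁻¹ • T z = z
      rw [h3, smul_smul, inv_mul_cancel₀ hc0, one_smul]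
    exact FiniteDimensional.of_isCompactOperator_id (𝕜 := ℝ) (h2 ▸ h1.smul c⁻¹)
  obtain ⟨z, hz, hz0⟩ := hc.exists_hasEigenvector
  have hzd : U d z ≠ z := by
    intro hfix
    refine hz0 ?_
    have h1 : ∀ x, ⟪U x (f - U d f), z⟫ = 0 := fun x => by
      have h2 : U x (f - U d f) = U x f - U d (U x f) := by
        rw [← hmul, mul_comm, hmul, ← map_sub]
      rw [h2, inner_sub_left]
      nth_rewrite 2 [← hfix]
      rw [LinearIsometry.inner_map_map, sub_self]
    have h3 : T z = 0 := hTz z h1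
    have h4 := (hW z).1 hz
    rw [h3] at h4
    exact (smul_eq_zero.1 h4.symm).resolve_left hc0
  have hUW : ∀ x, ∀ z ∈ W, U x z ∈ W := fun x z hz => by
    rw [hW, hcomm, (hW z).1 hz, map_smul]
  let π : D →* (W →L[ℝ] W) :=
    { toFun := fun x => ((U x).toContinuousLinearMap).restrict (p := W) (q := W) (hUW x)
      map_one' := by ext z; exact hone _
      map_mul' := fun x y => by ext z; exact hmul _ _ _ }
  exact exists_isLinearLength_of_finiteDimensional π (fun x z => ((U x).norm_map z).le)
    (fun z => Continuous.subtype_mk (hU z) _) d ⟨z, hz⟩ fun h => hzd (congrArg Subtype.val h)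

/-- Compact Hausdorff abelian groups have enough finite dimensional orthogonal representations,
because the translations of `L²` are faithful. -/
theorem exists_isLinearLength [T2Space D] (d : D) (hd : d ≠ 1) :
    ∃ ℓ : D → ℝ, IsLinearLength ℓ ∧ Continuous ℓ ∧ ℓ d ≠ 0 := by
  borelize D
  let μ : Measure D := Measure.haarMeasure ⊤
  have : Fact ((2 : ℝ≥0∞) ≠ ∞) := ⟨by norm_num⟩
  let U : D → Lp ℝ 2 μ →ₗᵢ[ℝ] Lp ℝ 2 μ := fun x =>
    { toFun := fun f => DomMulAct.mk x • f
      map_add' := fun f g => smul_add _ f g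
      map_smul' := fun c f => smul_comm _ c f
      norm_map' := fun f => DomMulAct.norm_smul_Lp _ f }
  have hU : ∀ f, Continuous fun x => U x f := fun f =>
    (DomMulAct.continuous_mk.smul continuous_const :
      Continuous fun x : D => DomMulAct.mk x • f)
  obtain ⟨φ, hφ⟩ : ∃ φ : C(D, ℝ), φ 1 ≠ φ d := by
    obtain ⟨φ, h0, h1, -⟩ := exists_continuous_zero_one_of_isClosed
      (isClosed_singleton (x := (1 : D))) (isClosed_singleton (x := d))
      (Set.disjoint_singleton.2 hd.symm)
    refine ⟨φ, ?_⟩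
    rw [h0 (Set.mem_singleton _), h1 (Set.mem_singleton _)]
    exact zero_ne_one
  refine exists_isLinearLength_of_representation U (fun x y f => ?_) (fun f => ?_) hU d
    (ContinuousMap.toLp 2 μ ℝ φ) ?_
  · change DomMulAct.mk (x * y) • f = DomMulAct.mk x • DomMulAct.mk y • f
    rw [smul_smul, mul_comm x y]
    rfl
  · exact one_smul _ f
  · intro h
    have h1 : ContinuousMap.toLp 2 μ ℝ (φ.comp ⟨fun x => d * x, by fun_prop⟩) =
        ContinuousMap.toLp 2 μ ℝ φ := h
    have h2 := DFunLike.congr_fun (ContinuousMap.toLp_injective μ h1) 1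
    rw [ContinuousMap.comp_apply] at h2
    change φ (d * 1) = φ 1 at h2
    rw [mul_one] at h2
    exact hφ h2.symm

end CompactGroup

/-! ### The ring operations of the extension -/

namespace MonsterModel

open Filter Topology

variable {R : Type u} [Ring R] (𝓜 : MonsterModel.{u, v} R)

/-- The extension to `R̄` of functions of finitely many variables, as a ring homomorphism. -/
noncomputable def hatHom (α : Type) [Finite α] :
    ((α → R) → R) →+* ((α → 𝓜.carrier) → 𝓜.carrier) where
  toFun f x := (opTerm f).realize x
  map_one' := by
    ext x
    refine (𝓜.realize_eq_of_forall (opTerm (1 : (α → R) → R))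
      (Term.func (L := fullLanguage R) (l := 0) (fun _ : Fin 0 → R => 1) ![])
      (fun y => ?_) x).trans (congrArg (𝓜.op _) (Subsingleton.elim _ _))
    rw [realize_opTerm_base]
    rfl
  map_zero' := by
    ext x
    refine (𝓜.realize_eq_of_forall (opTerm (0 : (α → R) → R))
      (Term.func (L := fullLanguage R) (l := 0) (fun _ : Fin 0 → R => 0) ![])
      (fun y => ?_) x).trans (congrArg (𝓜.op _) (Subsingleton.elim _ _))
    rw [realize_opTerm_base]
    rfl
  map_add' f g := by
    ext x
    refine (𝓜.realize_eq_of_forall (opTerm (f + g))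
      (Term.func (L := fullLanguage R) (l := 2) (fun x : Fin 2 → R => x 0 + x 1)
        ![opTerm f, opTerm g]) (fun y => ?_) x).trans
        (congrArg (𝓜.op _) (by ext i; fin_cases i <;> rfl))
    rw [realize_opTerm_base]
    exact (congrArg₂ (· + ·) (realize_opTerm_base f y) (realize_opTerm_base g y)).symm
  map_mul' f g := by
    ext x
    refine (𝓜.realize_eq_of_forall (opTerm (f * g))
      (Term.func (L := fullLanguage R) (l := 2) (fun x : Fin 2 → R => x 0 * x 1)
        ![opTerm f, opTerm g]) (fun y => ?_) x).trans
        (congrArg (𝓜.op _) (by ext i; fin_cases i <;> rfl))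
    rw [realize_opTerm_base]
    exact (congrArg₂ (· * ·) (realize_opTerm_base f y) (realize_opTerm_base g y)).symm

theorem hatHom_proj {α : Type} [Finite α] (a : α) (x : α → 𝓜.carrier) :
    𝓜.hatHom α (fun y => y a) x = x a :=
  congrFun (𝓜.hat_reindex (fun _ : Unit => a) x) ()

namespace Code

variable {𝓜} {S T : Type u} {S' T' : Type v} {E : 𝓜.Code S S'} {F : 𝓜.Code T T'}

/-- `f'` is the extension of `f : S → R` to `S'`. -/
def IsExt (E : 𝓜.Code S S') (f : S → R) (f' : S' → 𝓜.carrier) : Prop :=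
  ∃ g : (E.ix → R) → R, (∀ s, f s = g (E.c s)) ∧ ∀ x, f' x = 𝓜.hatHom E.ix g (E.c' x)

theorem isExt_coord (i : E.ix) : E.IsExt (fun s => E.c s i) fun x => E.c' x i :=
  ⟨fun y => y i, fun _ => rfl, fun _ => (𝓜.hatHom_proj i _).symm⟩

theorem isExt_const (r : R) : E.IsExt (fun _ => r) fun _ => 𝓜.embHom r := by
  refine ⟨fun _ => r, fun _ => rfl, fun x => Eq.symm ?_⟩
  refine (𝓜.realize_eq_of_forall (opTerm fun _ : E.ix → R => r)
    (Term.func (L := fullLanguage R) (l := 0) (fun _ : Fin 0 → R => r) ![])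
    (fun y => by rw [realize_opTerm_base]; rfl) _).trans
    (Eq.trans ?_ (𝓜.emb_op (fun _ : Fin 0 → R => r) ![]).symm)
  exact congrArg (𝓜.op _) (Subsingleton.elim _ _)

theorem IsExt.add {f g : S → R} {f' g' : S' → 𝓜.carrier} (hf : E.IsExt f f') (hg : E.IsExt g g') :
    E.IsExt (fun s => f s + g s) fun x => f' x + g' x := by
  obtain ⟨a, ha, ha'⟩ := hf
  obtain ⟨b, hb, hb'⟩ := hg
  refine ⟨a + b, fun s => congrArg₂ (· + ·) (ha s) (hb s), fun x => ?_⟩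
  rw [map_add]
  exact congrArg₂ (· + ·) (ha' x) (hb' x)

theorem IsExt.mul {f g : S → R} {f' g' : S' → 𝓜.carrier} (hf : E.IsExt f f') (hg : E.IsExt g g') :
    E.IsExt (fun s => f s * g s) fun x => f' x * g' x := by
  obtain ⟨a, ha, ha'⟩ := hf
  obtain ⟨b, hb, hb'⟩ := hg
  refine ⟨a * b, fun s => congrArg₂ (· * ·) (ha s) (hb s), fun x => ?_⟩
  rw [map_mul]
  exact congrArg₂ (· * ·) (ha' x) (hb' x)

theorem IsExt.sum {κ : Type*} (t : Finset κ) {f : κ → S → R} {f' : κ → S' → 𝓜.carrier}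
    (h : ∀ k ∈ t, E.IsExt (f k) (f' k)) :
    E.IsExt (fun s => ∑ k ∈ t, f k s) fun x => ∑ k ∈ t, f' k x := by
  classical
  induction t using Finset.induction_on with
  | empty => simpa using E.isExt_const 0
  | insert a t ha ih =>
    simp_rw [Finset.sum_insert ha]
    exact (h a (Finset.mem_insert_self a t)).add (ih fun k hk => h k (Finset.mem_insert_of_mem hk))

/-- A map is recognised on types as soon as its coordinates are extensions. -/
theorem tp_map_of_isExt {φ : S → T} {φ' : S' → T'}
    (h : ∀ i, E.IsExt (fun s => F.c (φ s) i) fun x => F.c' (φ' x) i) (x : S') :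
    F.tp (φ' x) = (E.tp x).map φ := by
  choose g hg hg' using h
  exact tp_map_of_hat E F (fun y i => g i y) (fun s => funext fun i => hg i s)
    (fun x => funext fun i => hg' i x) x

end Code

/-- The elements of `R` and of `R̄`, coded by themselves. -/
def baseCode : 𝓜.Code R 𝓜.carrier where
  ix := Fin 1
  c x _ := x
  c' x _ := x
  ι := 𝓜.embHom
  c_injective _ _ h := congrFun h 0
  c'_injective _ _ h := congrFun h 0
  range_c' := by
    have h1 : Set.range (fun (x : R) (_ : Fin 1) => x) = Set.univ :=
      Set.range_eq_univ.2 fun y => ⟨y 0, funext fun i => congrArg y (Subsingleton.elim 0 i)⟩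
    have h2 : Set.range (fun (x : 𝓜.carrier) (_ : Fin 1) => x) = Set.univ :=
      Set.range_eq_univ.2 fun y => ⟨y 0, funext fun i => congrArg y (Subsingleton.elim 0 i)⟩
    rw [h1, h2, interp_univ]
  c'_ι _ _ := rfl

theorem baseCode_isExt_id : 𝓜.baseCode.IsExt id id := Code.isExt_coord (E := 𝓜.baseCode) (0 : Fin 1)

theorem baseCode_isExt_fst : (𝓜.baseCode.prod 𝓜.baseCode).IsExt Prod.fst Prod.fst :=
  Code.isExt_coord (E := 𝓜.baseCode.prod 𝓜.baseCode) (Sum.inl (0 : Fin 1))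

theorem baseCode_isExt_snd : (𝓜.baseCode.prod 𝓜.baseCode).IsExt Prod.snd Prod.snd :=
  Code.isExt_coord (E := 𝓜.baseCode.prod 𝓜.baseCode) (Sum.inr (0 : Fin 1))

theorem baseCode_isAddGroupCode : 𝓜.baseCode.IsAddGroupCode := by
  refine ⟨fun g h => map_add 𝓜.embHom g h, fun x y => ?_, fun x y => ?_⟩
  · refine Code.tp_map_of_isExt (φ' := fun p : 𝓜.carrier × 𝓜.carrier => (p.1, p.1 + p.2)) ?_ (x, y)
    rintro (i | i)
    exacts [𝓜.baseCode_isExt_fst, 𝓜.baseCode_isExt_fst.add 𝓜.baseCode_isExt_snd]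
  · refine Code.tp_map_of_isExt (φ' := fun p : 𝓜.carrier × 𝓜.carrier => (p.1, p.2 + p.1)) ?_ (x, y)
    rintro (i | i)
    exacts [𝓜.baseCode_isExt_fst, 𝓜.baseCode_isExt_snd.add 𝓜.baseCode_isExt_fst]

theorem tp_ring_mul (p : 𝓜.carrier × 𝓜.carrier) : 𝓜.baseCode.tp (p.1 * p.2) =
    ((𝓜.baseCode.prod 𝓜.baseCode).tp p).map fun p => p.1 * p.2 :=
  Code.tp_map_of_isExt (φ' := fun p : 𝓜.carrier × 𝓜.carrier => p.1 * p.2)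
    (fun _ => 𝓜.baseCode_isExt_fst.mul 𝓜.baseCode_isExt_snd) p

theorem tp_ring_mul_ι (x : 𝓜.carrier) (t : R) : 𝓜.baseCode.tp (x * 𝓜.embHom t) =
    (𝓜.baseCode.tp x).map fun s => s * t :=
  Code.tp_map_of_isExt (φ' := fun x => x * 𝓜.embHom t)
    (fun _ => 𝓜.baseCode_isExt_id.mul (Code.isExt_const t)) x

/-! ### The subgroups `I i` -/

theorem isTD_genTypeDefinable (J : AddSubgroup 𝓜.carrier) :
    𝓜.baseCode.IsTD (𝓜.genTypeDefinable J : Set 𝓜.carrier) := by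
  rw [genTypeDefinable, AddSubgroup.coe_sInf]
  exact Code.IsTD.iInter fun H => Code.IsTD.iInter fun hH =>
    𝓜.baseCode.isTD_of_isTypeDefinable hH.1

theorem mul_mem_genTypeDefinable {J : AddSubgroup 𝓜.carrier} (r : 𝓜.carrier) {x : 𝓜.carrier}
    (hx : x ∈ J) : r * x ∈ 𝓜.genTypeDefinable J :=
  AddSubgroup.mem_sInf.2 fun _ hH => hH.2 r x hx

theorem genTypeDefinable_le {J H : AddSubgroup 𝓜.carrier} (hH : 𝓜.baseCode.IsTD (H : Set 𝓜.carrier))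
    (hJ : ∀ r : 𝓜.carrier, ∀ x ∈ J, r * x ∈ H) : 𝓜.genTypeDefinable J ≤ H :=
  sInf_le ⟨hH.isTypeDefinable, hJ⟩

variable [TopologicalSpace R]

theorem I_le_I_succ (i : ℕ) : 𝓜.I (i + 1) ≤ 𝓜.I (i + 2) := fun x hx => by
  have := 𝓜.mul_mem_genTypeDefinable 1 hx
  rwa [one_mul] at this

theorem I_le_I {i k : ℕ} (hi : 1 ≤ i) (hik : i ≤ k) : 𝓜.I i ≤ 𝓜.I k := by
  obtain ⟨d, rfl⟩ := Nat.exists_eq_add_of_le hik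
  obtain ⟨i, rfl⟩ := Nat.exists_eq_add_of_le' hi
  induction d with
  | zero => exact le_rfl
  | succ d ih =>
    refine (ih (by omega)).trans ?_
    have := 𝓜.I_le_I_succ (i + d)
    rwa [show i + d + 1 = i + 1 + d by omega, show i + d + 2 = i + 1 + (d + 1) by omega] at this

theorem mul_mem_I {i k : ℕ} (hi : 1 ≤ i) (hik : i < k) (r : 𝓜.carrier) {x : 𝓜.carrier}
    (hx : x ∈ 𝓜.I i) : r * x ∈ 𝓜.I k := by
  obtain ⟨i, rfl⟩ := Nat.exists_eq_add_of_le' hi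
  exact 𝓜.I_le_I (i := i + 2) (by omega) (by omega) (𝓜.mul_mem_genTypeDefinable r hx)

theorem isAddTopoSubgroup_I_one : 𝓜.IsAddTopoSubgroup 𝓜.baseCode.c 𝓜.baseCode.c' (𝓜.I 1) :=
  𝓜.baseCode_isAddGroupCode.isAddTopoSubgroup_addTopoComponent

theorem I_one_le {K : AddSubgroup 𝓜.carrier}
    (hK : 𝓜.IsAddTopoSubgroup 𝓜.baseCode.c 𝓜.baseCode.c' K) : 𝓜.I 1 ≤ K := sInf_le hK

theorem isAddTypeInvariant_I {i : ℕ} (hi : 1 ≤ i) : 𝓜.baseCode.IsAddTypeInvariant (𝓜.I i) :=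
  Code.IsAddTypeInvariant.mono
    ((𝓜.baseCode_isAddGroupCode.isAddTopoSubgroup_iff _).1 𝓜.isAddTopoSubgroup_I_one).1
    (𝓜.I_le_I le_rfl hi)

theorem isOpenTD_I_one : 𝓜.baseCode.IsOpenTD (𝓜.I 1 : Set 𝓜.carrier) :=
  ((𝓜.baseCode_isAddGroupCode.isAddTopoSubgroup_iff _).1 𝓜.isAddTopoSubgroup_I_one).2

theorem isTD_I {i : ℕ} (hi : 1 ≤ i) : 𝓜.baseCode.IsTD (𝓜.I i : Set 𝓜.carrier) := by
  obtain ⟨i, rfl⟩ := Nat.exists_eq_add_of_le' hi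
  rcases i with _ | i
  · exact 𝓜.isOpenTD_I_one.isTD
  · exact 𝓜.isTD_genTypeDefinable _

theorem isOpenTD_I [IsTopologicalRing R] {i : ℕ} (hi : 1 ≤ i) :
    𝓜.baseCode.IsOpenTD (𝓜.I i : Set 𝓜.carrier) :=
  𝓜.baseCode_isAddGroupCode.isOpenTD_of_le (𝓜.isAddTypeInvariant_I le_rfl) 𝓜.isOpenTD_I_one
    (𝓜.isTD_I hi) (𝓜.I_le_I le_rfl hi)

theorem isAddGroupLogicQuotient_I {i : ℕ} (hi : 1 ≤ i) :
    𝓜.baseCode.IsAddGroupLogicQuotient (𝓜.I i) :=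
  ⟨𝓜.isAddTypeInvariant_I hi, 𝓜.isTD_I hi, (𝓜.isAddTypeInvariant_I hi).isClosed_iff⟩

/-- The interpretation of the preimage in `R` of an open set of cosets contains all cosets in that
open set. -/
theorem mem_ext_of_isOpen {i : ℕ} (hi : 1 ≤ i) {O : Set (𝓜.carrier ⧸ 𝓜.I i)} (hO : IsOpen O)
    {x : 𝓜.carrier} (hx : (x : 𝓜.carrier ⧸ 𝓜.I i) ∈ O) :
    x ∈ 𝓜.baseCode.ext {r | ((𝓜.embHom r : 𝓜.carrier) : 𝓜.carrier ⧸ 𝓜.I i) ∈ O} := by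
  obtain ⟨X, hX, hXO⟩ :=
    (𝓜.isAddGroupLogicQuotient_I hi).exists_of_isOpen 𝓜.baseCode_isAddGroupCode hO hx
  exact 𝓜.baseCode.ext_mono (fun r hr => hXO _ (𝓜.baseCode.ι_mem_ext.2 hr)) (hX x rfl)

/-- Absorption from the left implies absorption from the right: if `x * y ∉ I 2` for some `x ∈ I
1`, some linear length on the compact group `R̄ / I 2` does not vanish on `x * y`. Since `R̄ * I
1 ⊆ I 2`, this length is small on `R * W` for some `W ⊆ R` whose interpretation contains `I 1`,
and finitely many translates of `W` cover `R`. As linear lengths allow no small subgroups, the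
elements `r` of `R` for which the length vanishes on `r * R` form an open subgroup, defined by
finitely many inequalities. Its interpretation has bounded index, so it contains `I 1`. -/
theorem mul_mem_I_two [IsTopologicalRing R] {x : 𝓜.carrier} (hx : x ∈ 𝓜.I 1) (y : 𝓜.carrier) :
    x * y ∈ 𝓜.I 2 := by
  by_contra hxy
  have hE := 𝓜.baseCode_isAddGroupCode
  have hQ := 𝓜.isAddGroupLogicQuotient_I one_le_two
  have := hQ.isTopologicalAddGroup hE
  have := hQ.compactSpace
  have : T2Space (Multiplicative (𝓜.carrier ⧸ 𝓜.I 2)) := hQ.t2Space hE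
  obtain ⟨ℓ, hℓ, hℓc, hd⟩ := exists_isLinearLength
    (D := Multiplicative (𝓜.carrier ⧸ 𝓜.I 2))
    (Multiplicative.ofAdd ((x * y : 𝓜.carrier) : 𝓜.carrier ⧸ 𝓜.I 2))
    (fun h => hxy ((QuotientAddGroup.eq_zero_iff _).1 h))
  -- the length as a function on `R̄`
  let ψ : 𝓜.carrier → ℝ := fun z => ℓ (Multiplicative.ofAdd (z : 𝓜.carrier ⧸ 𝓜.I 2))
  have hψI : ∀ z ∈ 𝓜.I 2, ψ z = 0 := fun z hz => by
    change ℓ (Multiplicative.ofAdd (z : 𝓜.carrier ⧸ 𝓜.I 2)) = 0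
    rw [(QuotientAddGroup.eq_zero_iff z).2 hz]
    exact hℓ.one
  have hψadd : ∀ a b, ψ (a + b) ≤ ψ a + ψ b := fun a b =>
    hℓ.mul_le (Multiplicative.ofAdd (a : 𝓜.carrier ⧸ 𝓜.I 2))
      (Multiplicative.ofAdd (b : 𝓜.carrier ⧸ 𝓜.I 2))
  have hcont : Continuous fun q : 𝓜.carrier ⧸ 𝓜.I 2 => ℓ (Multiplicative.ofAdd q) :=
    hℓc.comp continuous_ofAdd
  have hopen : ∀ z, ψ z < 1 / 4 → {r : R | ψ (𝓜.embHom r) < 1 / 4} ∈ 𝓜.baseCode.tp z := fun z hz =>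
    𝓜.mem_ext_of_isOpen one_le_two (isOpen_Iio.preimage hcont) hz
  have hclosed : ∀ z, {r : R | ψ (𝓜.embHom r) = 0} ∈ 𝓜.baseCode.tp z → ψ z = 0 := fun z hz => by
    by_contra hne
    have h1 := 𝓜.mem_ext_of_isOpen one_le_two
      ((isClosed_singleton (x := (0 : ℝ))).isOpen_compl.preimage hcont) (x := z) hne
    have h2 : {r : R | ψ (𝓜.embHom r) = 0}ᶜ ∈ 𝓜.baseCode.tp z := h1
    exact Ultrafilter.compl_mem_iff_notMem.1 h2 hz
  obtain ⟨f, hf, -⟩ := 𝓜.isOpenTD_I_one.exists_filter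
  obtain ⟨W, hW, hWsmall⟩ : ∃ W ∈ f, ∀ r : R, ∀ w ∈ W, ψ (𝓜.embHom (r * w)) < 1 / 4 := by
    have hP : {p : R × R | ψ (𝓜.embHom (p.1 * p.2)) < 1 / 4} ∈ (⊤ : Filter R) ×ˢ f := by
      refine Code.mem_prod_of_forall (E := 𝓜.baseCode) (F := 𝓜.baseCode) fun a _ b hb => ?_
      rw [hf] at hb
      have h1 := hopen (a * b) (by
        rw [hψI _ (𝓜.mul_mem_I le_rfl one_lt_two a hb)]; norm_num)
      rw [𝓜.tp_ring_mul (a, b)] at h1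
      exact h1
    obtain ⟨A, hA, W, hW, hAW⟩ := mem_prod_iff.1 hP
    rw [mem_top] at hA
    subst hA
    exact ⟨W, hW, fun r w hw => hAW (Set.mk_mem_prod (Set.mem_univ r) hw)⟩
  obtain ⟨F, hF, hcov⟩ := hE.exists_finite_cover 𝓜.isAddTopoSubgroup_I_one.1 (D := W)
    (hf ▸ Code.monad_subset_ext.2 hW)
  let N : Set R := {r | ∀ t ∈ F, ψ (𝓜.embHom (r * t)) < 1 / 4}
  have hN : ∀ r, r ∈ N ↔ ∀ s, ψ (𝓜.embHom (r * s)) = 0 := by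
    intro r
    refine ⟨fun hr => ?_, fun hr t _ => by rw [hr t]; norm_num⟩
    let m : R →+ 𝓜.carrier ⧸ 𝓜.I 2 :=
      ((QuotientAddGroup.mk' (𝓜.I 2)).comp 𝓜.embHom.toAddMonoidHom).comp (AddMonoidHom.mulLeft r)
    intro s
    refine hℓ.eq_zero m.toMultiplicative.range ?_ _ ⟨Multiplicative.ofAdd s, rfl⟩
    rintro _ ⟨s, rfl⟩
    obtain ⟨t, ht, hts⟩ := hcov s.toAdd
    change ψ (𝓜.embHom (r * s.toAdd)) ≤ 1 / 2
    have h1 : r * s.toAdd = r * t + r * (-t + s.toAdd) := by rw [← mul_add, add_neg_cancel_left]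
    rw [h1, map_add]
    have := hψadd (𝓜.embHom (r * t)) (𝓜.embHom (r * (-t + s.toAdd)))
    have := hr t ht
    have := hWsmall r _ hts
    linarith
  have hNo : IsOpen N := by
    have h1 : N = ⋂ t ∈ F, {r | ψ (𝓜.embHom (r * t)) < 1 / 4} := by ext r; simp [N]
    rw [h1]
    refine hF.isOpen_biInter fun t _ => isOpen_Iio.preimage (f := fun r => ψ (𝓜.embHom (r * t))) ?_
    exact hcont.comp ((hQ.continuous_mk hE (𝓜.isOpenTD_I one_le_two)).comp (continuous_mul_const t))
  have hN0 : (0 : 𝓜.carrier) ∈ 𝓜.baseCode.ext N := by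
    rw [← hE.ι_zero, 𝓜.baseCode.ι_mem_ext, hN]
    intro s
    rw [zero_mul, map_zero]
    exact hψI 0 (𝓜.I 2).zero_mem
  have hψneg : ∀ a, ψ a = 0 → ψ (-a) = 0 := fun a ha =>
    le_antisymm ((hℓ.inv_le _).trans ha.le) (hℓ.nonneg _)
  have hψadd0 : ∀ a b, ψ a = 0 → ψ b = 0 → ψ (a + b) = 0 := fun a b ha hb =>
    le_antisymm ((hψadd a b).trans (by rw [ha, hb, add_zero])) (hℓ.nonneg _)
  let K : AddSubgroup 𝓜.carrier :=
    { carrier := 𝓜.baseCode.ext N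
      zero_mem' := hN0
      add_mem' := fun ha hb => hE.add_mem_ext (fun s hs t ht => (hN _).2 fun r => by
        rw [add_mul, map_add]
        exact hψadd0 _ _ ((hN s).1 hs r) ((hN t).1 ht r)) ha hb
      neg_mem' := fun {a} ha => by
        have := hE.neg_add_mem_ext (Z := N) (fun s hs t ht => (hN _).2 fun r => by
          rw [add_mul, neg_mul, map_add, map_neg]
          exact hψadd0 _ _ (hψneg _ ((hN s).1 hs r)) ((hN t).1 ht r)) ha hN0
        rwa [add_zero] at this }
  have hxN : x ∈ 𝓜.baseCode.ext N := by
    refine 𝓜.I_one_le (K := K) ((hE.isAddTopoSubgroup_iff K).2 ⟨?_, ?_⟩) hx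
    · intro a b hab
      change N ∈ 𝓜.baseCode.tp (-a + b)
      have h1 : N = ⋂ t ∈ F, {r | ψ (𝓜.embHom (r * t)) < 1 / 4} := by ext r; simp [N]
      rw [h1]
      refine (biInter_mem hF).2 fun t _ => ?_
      have h2 := hopen ((-a + b) * 𝓜.embHom t) (by
        have h3 : (-a + b) * 𝓜.embHom t ∈ 𝓜.I 2 := by
          rw [add_mul, neg_mul]
          exact 𝓜.isAddTypeInvariant_I one_le_two _ _ (by rw [tp_ring_mul_ι, tp_ring_mul_ι, hab])
        rw [hψI _ h3]
        norm_num)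
      rw [tp_ring_mul_ι] at h2
      exact h2
    · exact fun z hz => hz N hNo subset_rfl
  refine hd (hclosed (x * y) ?_)
  rw [𝓜.tp_ring_mul (x, y), Ultrafilter.mem_map]
  have h1 : N ∈ ((𝓜.baseCode.prod 𝓜.baseCode).tp (x, y)).map Prod.fst := by
    rw [← 𝓜.baseCode.tp_fst 𝓜.baseCode (x, y)]
    exact hxN
  rw [Ultrafilter.mem_map] at h1
  have h2 : Prod.fst ⁻¹' N ⊆ (fun p : R × R => p.1 * p.2) ⁻¹' {r | ψ (𝓜.embHom r) = 0} :=
    fun p hp => (hN p.1).1 hp p.2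
  exact (𝓜.baseCode.prod 𝓜.baseCode).ext_mono h2 h1

theorem I_mul_mem_succ [IsTopologicalRing R] (i : ℕ) :
    ∀ x ∈ 𝓜.I (i + 1), ∀ y : 𝓜.carrier, x * y ∈ 𝓜.I (i + 2) := by
  induction i with
  | zero => exact fun x hx y => 𝓜.mul_mem_I_two hx y
  | succ i ih =>
    let K : AddSubgroup 𝓜.carrier :=
      { carrier := {x | ∀ y, x * y ∈ 𝓜.I (i + 3)}
        zero_mem' := fun y => by rw [zero_mul]; exact AddSubgroup.zero_mem _
        add_mem' := fun ha hb y => by rw [add_mul]; exact AddSubgroup.add_mem _ (ha y) (hb y)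
        neg_mem' := fun ha y => by rw [neg_mul]; exact AddSubgroup.neg_mem _ (ha y) }
    have hK : 𝓜.I (i + 2) ≤ K := 𝓜.genTypeDefinable_le
      (Code.IsTD.forall_snd (E := 𝓜.baseCode) (F := 𝓜.baseCode)
        (Code.IsTD.preimage (φ' := fun p : 𝓜.carrier × 𝓜.carrier => p.1 * p.2) 𝓜.tp_ring_mul
          (𝓜.isTD_I (i := i + 3) (by omega))))
      fun r x hx y => by
        rw [mul_assoc]
        exact 𝓜.mul_mem_I (i := i + 2) (by omega) (by omega) r (ih x hx y)
    exact hK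

theorem I_mul_mem [IsTopologicalRing R] {i k : ℕ} (hi : 1 ≤ i) (hik : i < k) {x : 𝓜.carrier}
    (hx : x ∈ 𝓜.I i) (y : 𝓜.carrier) : x * y ∈ 𝓜.I k := by
  obtain ⟨i, rfl⟩ := Nat.exists_eq_add_of_le' hi
  exact 𝓜.I_le_I (i := i + 2) (by omega) (by omega) (𝓜.I_mul_mem_succ i x hx y)

theorem cosetMul_mk [IsTopologicalRing R] {i j k : ℕ} (hi : 1 ≤ i) (hj : 1 ≤ j) (hik : i < k)
    (hjk : j < k) (a b : 𝓜.carrier) :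
    𝓜.cosetMul k (a : 𝓜.carrier ⧸ 𝓜.I i) (b : 𝓜.carrier ⧸ 𝓜.I j) =
      ((a * b : 𝓜.carrier) : 𝓜.carrier ⧸ 𝓜.I k) := by
  have ha : -(Quotient.out (a : 𝓜.carrier ⧸ 𝓜.I i)) + a ∈ 𝓜.I i :=
    QuotientAddGroup.eq.1 (Quotient.out_eq (a : 𝓜.carrier ⧸ 𝓜.I i))
  have hb : -(Quotient.out (b : 𝓜.carrier ⧸ 𝓜.I j)) + b ∈ 𝓜.I j :=
    QuotientAddGroup.eq.1 (Quotient.out_eq (b : 𝓜.carrier ⧸ 𝓜.I j))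
  refine QuotientAddGroup.eq.2 ?_
  have h := AddSubgroup.add_mem _ (𝓜.I_mul_mem hi hik ha b)
    (𝓜.mul_mem_I hj hjk (Quotient.out (a : 𝓜.carrier ⧸ 𝓜.I i)) hb)
  have h' : ∀ a' b' : 𝓜.carrier, (-a' + a) * b + a' * (-b' + b) = -(a' * b') + a * b :=
    fun a' b' => by noncomm_ring
  rwa [h'] at h

end MonsterModel

/-! ### Unitriangular matrices -/

section UT

variable {n : ℕ} {S : Type*} [Ring S]

/-- The elementary unitriangular matrix with entry `a` at the position `(i, j)`, `i < j`. -/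
def UT.elem {i j : Fin n} (h : i < j) (a : S) : UT n S :=
  ⟨1 + Matrix.single i j a, fun k => by
    rw [Matrix.add_apply, Matrix.one_apply_eq, Matrix.single_apply, if_neg, add_zero]
    rintro ⟨rfl, rfl⟩
    exact lt_irrefl _ h, fun k l hkl => by
    rw [Matrix.add_apply, Matrix.one_apply_ne hkl.ne', Matrix.single_apply, if_neg, add_zero]
    rintro ⟨rfl, rfl⟩
    exact lt_asymm h hkl⟩

theorem UT.elem_mul_elem {i j : Fin n} (h : i < j) (a b : S) :
    UT.elem h a * UT.elem h b = UT.elem h (a + b) := by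
  refine Subtype.ext ?_
  change (1 + Matrix.single i j a) * (1 + Matrix.single i j b) = 1 + Matrix.single i j (a + b)
  simp only [add_mul, mul_add, one_mul, mul_one, Matrix.single_mul_single_of_ne _ _ _ _ h.ne',
    Matrix.single_add]
  abel

theorem UT.elem_zero {i j : Fin n} (h : i < j) : UT.elem h (0 : S) = 1 :=
  Subtype.ext (by change 1 + Matrix.single i j (0 : S) = 1; simp)

theorem UT.elem_neg {i j : Fin n} (h : i < j) (a : S) : UT.elem h (-a) = (UT.elem h a)⁻¹ := by
  rw [eq_inv_iff_mul_eq_one, UT.elem_mul_elem, neg_add_cancel, UT.elem_zero]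

theorem UT.elem_commutator {i l j : Fin n} (h : i < l) (h' : l < j) (a b : S) :
    UT.elem h a * UT.elem h' b * (UT.elem h a)⁻¹ * (UT.elem h' b)⁻¹ =
      UT.elem (h.trans h') (a * b) := by
  rw [mul_inv_eq_iff_eq_mul, mul_inv_eq_iff_eq_mul]
  refine Subtype.ext ?_
  change (1 + Matrix.single i l a) * (1 + Matrix.single l j b) =
    (1 + Matrix.single i j (a * b)) * (1 + Matrix.single l j b) * (1 + Matrix.single i l a)
  simp only [add_mul, mul_add, one_mul, mul_one, Matrix.single_mul_single_same,
    Matrix.single_mul_single_of_ne _ _ _ _ (h.trans h').ne',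
    Matrix.single_mul_single_of_ne _ _ _ _ h'.ne', zero_mul]
  abel

theorem UT.elem_mul_apply {i j : Fin n} (h : i < j) (a : S) (A : UT n S) (p q : Fin n) :
    (UT.elem h a * A).1 p q = A.1 p q + if p = i then a * A.1 j q else 0 := by
  change ((1 + Matrix.single i j a) * A.1) p q = _
  rw [add_mul, one_mul, Matrix.add_apply]
  split_ifs with hp
  · subst hp
    rw [Matrix.single_mul_apply_same]
  · rw [Matrix.single_mul_apply_of_ne _ _ _ _ _ hp]

theorem UT.mul_apply_of_lt (A B : UT n S) {i j : Fin n} (h : i < j) :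
    (A * B).1 i j = A.1 i j + B.1 i j + ∑ k : {k : Fin n // i < k ∧ k < j}, A.1 i k * B.1 k j := by
  have h1 : ∀ k, A.1 i k * B.1 k j =
      (if k = j then A.1 i j else 0) + (if k = i then B.1 i j else 0) +
      if i < k ∧ k < j then A.1 i k * B.1 k j else 0 := by
    intro k
    rcases lt_trichotomy k i with hk | rfl | hk
    · rw [A.2.2 _ _ hk, if_neg (hk.trans h).ne, if_neg hk.ne, if_neg (fun h' => lt_asymm h'.1 hk)]
      simp
    · rw [A.2.1, if_neg h.ne, if_pos rfl, if_neg (fun h' => lt_irrefl _ h'.1)]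
      simp
    · rcases lt_trichotomy k j with hk' | rfl | hk'
      · rw [if_neg hk'.ne, if_neg hk.ne', if_pos ⟨hk, hk'⟩]
        simp
      · rw [B.2.1, if_neg hk.ne', if_pos rfl, if_neg (fun h' => lt_irrefl _ h'.2)]
        simp
      · rw [B.2.2 _ _ hk', if_neg hk'.ne', if_neg hk.ne', if_neg (fun h' => lt_asymm h'.2 hk')]
        simp
  change (A.1 * B.1) i j = _
  rw [Matrix.mul_apply, Finset.sum_congr rfl fun k _ => h1 k, Finset.sum_add_distrib,
    Finset.sum_add_distrib, Finset.sum_ite_eq', Finset.sum_ite_eq', ← Finset.sum_filter,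
    if_pos (Finset.mem_univ _), if_pos (Finset.mem_univ _),
    Finset.sum_subtype (p := fun k => i < k ∧ k < j) _ (by simp)]

instance UT.instIsTopologicalGroup [TopologicalSpace S] [IsTopologicalRing S] :
    IsTopologicalGroup (UT n S) where
  continuous_mul := (inferInstance : ContinuousMul (UT n S)).continuous_mul
  continuous_inv := by
    refine Continuous.subtype_mk (f := fun A : UT n S =>
      ∑ k ∈ Finset.range n, (1 - (A : Matrix (Fin n) (Fin n) S)) ^ k) ?_ _
    fun_prop

theorem UT.continuous_apply [TopologicalSpace S] (i j : Fin n) :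
    Continuous fun A : UT n S => A.1 i j :=
  (continuous_id.matrix_elem i j).comp continuous_subtype_val

theorem UT.continuous_elem [TopologicalSpace S] [IsTopologicalRing S] {i j : Fin n} (h : i < j) :
    Continuous fun a : S => UT.elem h a :=
  Continuous.subtype_mk (continuous_const.add
    (continuous_matrix fun p q => by
      simp only [Matrix.single_apply]
      split_ifs
      exacts [continuous_id, continuous_const])) _

end UT

namespace MonsterModel

open Filter Topology

section UTCode

variable {R : Type u} [Ring R] (𝓜 : MonsterModel.{u, v} R) (n : ℕ)

/-- The unitriangular matrices over `R` and over `R̄`, coded by their entries. -/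
def utCode : 𝓜.Code (UT n R) (UT n 𝓜.carrier) where
  ix := Fin n × Fin n
  c := UT.coords
  c' := UT.coords
  ι := UT.map 𝓜.embHom
  c_injective A B h := Subtype.ext (Matrix.ext fun i j => congrFun h (i, j))
  c'_injective A B h := Subtype.ext (Matrix.ext fun i j => congrFun h (i, j))
  range_c' := by
    -- `z` is the tuple of entries of a unitriangular matrix when `z p = g p z` for all `p`
    let g : Fin n × Fin n → (Fin n × Fin n → R) → R := fun p =>
      if p.1 = p.2 then 1 else if p.2 < p.1 then 0 else fun z => z p
    have hR : Set.range (UT.coords : UT n R → _) = ⋂ p, {z | z p = g p z} := by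
      ext z
      rw [Set.mem_iInter]
      constructor
      · rintro ⟨A, rfl⟩ ⟨i, j⟩
        change A.1 i j = g (i, j) (UT.coords A)
        simp only [g]
        split_ifs with h1 h2
        · subst h1; exact A.2.1 i
        · exact A.2.2 i j h2
        · rfl
      · intro h
        refine ⟨⟨Matrix.of fun i j => z (i, j), fun i => ?_, fun i j hij => ?_⟩, rfl⟩
        · refine (h (i, i)).trans ?_
          simp [g]
        · refine (h (i, j)).trans ?_
          simp [g, hij, hij.ne']
    rw [hR, interp_iInter]
    ext z
    rw [Set.mem_iInter]
    have hg : ∀ p, z ∈ 𝓜.interp {z | z p = g p z} ↔ z p = 𝓜.hatHom _ (g p) z := fun p => by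
      rw [𝓜.mem_interp_eq (fun z => z p) (g p), ← 𝓜.hatHom_proj p z]
      rfl
    simp_rw [hg]
    constructor
    · rintro ⟨A, rfl⟩ ⟨i, j⟩
      change A.1 i j = _
      simp only [g]
      split_ifs with h1 h2
      · subst h1; rw [map_one]; exact A.2.1 i
      · rw [map_zero]; exact A.2.2 i j h2
      · exact (𝓜.hatHom_proj (i, j) (UT.coords A)).symm
    · intro h
      refine ⟨⟨Matrix.of fun i j => z (i, j), fun i => ?_, fun i j hij => ?_⟩, rfl⟩
      · refine (h (i, i)).trans ?_
        simp [g]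
      · refine (h (i, j)).trans ?_
        simp [g, hij, hij.ne']
  c'_ι _ _ := rfl

variable {n}

theorem utCode_isExt_fst (i j : Fin n) : ((𝓜.utCode n).prod (𝓜.utCode n)).IsExt
    (fun q => q.1.1 i j) fun q => q.1.1 i j :=
  Code.isExt_coord (E := (𝓜.utCode n).prod (𝓜.utCode n)) (Sum.inl (i, j))

theorem utCode_isExt_snd (i j : Fin n) : ((𝓜.utCode n).prod (𝓜.utCode n)).IsExt
    (fun q => q.2.1 i j) fun q => q.2.1 i j :=
  Code.isExt_coord (E := (𝓜.utCode n).prod (𝓜.utCode n)) (Sum.inr (i, j))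

theorem utCode_isGroupCode : (𝓜.utCode n).IsGroupCode := by
  refine ⟨fun g h => map_mul (UT.map 𝓜.embHom) g h, fun x y => ?_, fun x y => ?_⟩
  · refine Code.tp_map_of_isExt
      (φ' := fun p : UT n 𝓜.carrier × UT n 𝓜.carrier => (p.1, p.1 * p.2)) ?_ (x, y)
    rintro (⟨i, j⟩ | ⟨i, j⟩)
    exacts [𝓜.utCode_isExt_fst i j, Code.IsExt.sum Finset.univ fun k _ =>
      (𝓜.utCode_isExt_fst i k).mul (𝓜.utCode_isExt_snd k j)]
  · refine Code.tp_map_of_isExt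
      (φ' := fun p : UT n 𝓜.carrier × UT n 𝓜.carrier => (p.1, p.2 * p.1)) ?_ (x, y)
    rintro (⟨i, j⟩ | ⟨i, j⟩)
    exacts [𝓜.utCode_isExt_fst i j, Code.IsExt.sum Finset.univ fun k _ =>
      (𝓜.utCode_isExt_snd i k).mul (𝓜.utCode_isExt_fst k j)]

theorem tp_apply (i j : Fin n) (A : UT n 𝓜.carrier) :
    𝓜.baseCode.tp (A.1 i j) = ((𝓜.utCode n).tp A).map fun A => A.1 i j :=
  Code.tp_map_of_isExt (φ' := fun A : UT n 𝓜.carrier => A.1 i j)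
    (fun _ => Code.isExt_coord (E := 𝓜.utCode n) (i, j)) A

theorem tp_elem {i j : Fin n} (h : i < j) (x : 𝓜.carrier) :
    (𝓜.utCode n).tp (UT.elem h x) = (𝓜.baseCode.tp x).map (UT.elem h) := by
  refine Code.tp_map_of_isExt (φ' := fun x : 𝓜.carrier => UT.elem h x) ?_ x
  rintro ⟨p, q⟩
  change 𝓜.baseCode.IsExt (fun s => (1 : Matrix (Fin n) (Fin n) R) p q + Matrix.single i j s p q)
    fun x => (1 : Matrix (Fin n) (Fin n) 𝓜.carrier) p q + Matrix.single i j x p q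
  refine Code.IsExt.add ?_ ?_
  · have h1 := Code.isExt_const (E := 𝓜.baseCode) ((1 : Matrix (Fin n) (Fin n) R) p q)
    have h2 : 𝓜.embHom ((1 : Matrix (Fin n) (Fin n) R) p q) =
        (1 : Matrix (Fin n) (Fin n) 𝓜.carrier) p q := by
      rw [Matrix.one_apply, Matrix.one_apply]
      split_ifs <;> simp
    rwa [h2] at h1
  · simp only [Matrix.single_apply]
    split_ifs
    · exact 𝓜.baseCode_isExt_id
    · have h1 := Code.isExt_const (E := 𝓜.baseCode) 0
      rwa [map_zero] at h1

end UTCode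

section Level

variable {R : Type u} [Ring R] (𝓜 : MonsterModel.{u, v} R) [TopologicalSpace R] (n : ℕ)

/-- The strictly upper triangular matrices over `R̄` whose `(i, j)` entry is in `I (j - i)`. -/
def levelMatrices : AddSubgroup (Matrix (Fin n) (Fin n) 𝓜.carrier) where
  carrier := {M | ∀ i j, (j ≤ i → M i j = 0) ∧ (i < j → M i j ∈ 𝓜.I ((j : ℕ) - i))}
  zero_mem' _ _ := ⟨fun _ => rfl, fun _ => AddSubgroup.zero_mem _⟩
  add_mem' hM hN i j := ⟨fun h => by rw [Matrix.add_apply, (hM i j).1 h, (hN i j).1 h, add_zero],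
    fun h => AddSubgroup.add_mem _ ((hM i j).2 h) ((hN i j).2 h)⟩
  neg_mem' hM i j := ⟨fun h => by rw [Matrix.neg_apply, (hM i j).1 h, neg_zero],
    fun h => AddSubgroup.neg_mem _ ((hM i j).2 h)⟩

variable {n}

theorem mul_mem_levelMatrices (A : UT n 𝓜.carrier) {M : Matrix (Fin n) (Fin n) 𝓜.carrier}
    (hM : M ∈ 𝓜.levelMatrices n) : A.1 * M ∈ 𝓜.levelMatrices n := by
  refine fun i j => ⟨fun h => ?_, fun h => ?_⟩
  · rw [Matrix.mul_apply]
    refine Finset.sum_eq_zero fun k _ => ?_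
    rcases lt_or_ge k i with hk | hk
    · rw [A.2.2 i k hk, zero_mul]
    · rw [(hM k j).1 (h.trans hk), mul_zero]
  · rw [Matrix.mul_apply]
    refine AddSubgroup.sum_mem _ fun k _ => ?_
    rcases lt_trichotomy k i with hk | rfl | hk
    · rw [A.2.2 i k hk, zero_mul]
      exact AddSubgroup.zero_mem _
    · rw [A.2.1, one_mul]
      exact (hM k j).2 h
    · rcases lt_or_ge k j with hk' | hk'
      · rw [Fin.lt_def] at hk hk'
        exact 𝓜.mul_mem_I (by omega) (by omega) _ ((hM k j).2 hk')
      · rw [(hM k j).1 hk', mul_zero]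
        exact AddSubgroup.zero_mem _

variable (n) in
/-- The unitriangular matrices over `R̄` whose `(i, j)` entry, for `i < j`, is in `I (j - i)`. -/
def levelSubgroup : Subgroup (UT n 𝓜.carrier) where
  carrier := {A | A.1 - 1 ∈ 𝓜.levelMatrices n}
  one_mem' := by
    change (1 : Matrix (Fin n) (Fin n) 𝓜.carrier) - 1 ∈ 𝓜.levelMatrices n
    rw [sub_self]
    exact AddSubgroup.zero_mem _
  mul_mem' := fun {A B} hA hB => by
    have h : A.1 * B.1 - 1 = A.1 * (B.1 - 1) + (A.1 - 1) := by noncomm_ring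
    change A.1 * B.1 - 1 ∈ 𝓜.levelMatrices n
    rw [h]
    exact AddSubgroup.add_mem _ (𝓜.mul_mem_levelMatrices A hB) hA
  inv_mem' := fun {A} hA => by
    have h1 : A⁻¹.1 * A.1 = 1 := congrArg Subtype.val (inv_mul_cancel A)
    have h : A⁻¹.1 - 1 = -(A⁻¹.1 * (A.1 - 1)) := by rw [mul_sub, h1, mul_one, neg_sub]
    change A⁻¹.1 - 1 ∈ 𝓜.levelMatrices n
    rw [h]
    exact AddSubgroup.neg_mem _ (𝓜.mul_mem_levelMatrices A⁻¹ hA)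

theorem mem_levelSubgroup {A : UT n 𝓜.carrier} :
    A ∈ 𝓜.levelSubgroup n ↔ ∀ i j : Fin n, i < j → A.1 i j ∈ 𝓜.I ((j : ℕ) - i) := by
  constructor
  · intro hA i j h
    have h1 : (A.1 - 1) i j ∈ _ := (hA i j).2 h
    rwa [Matrix.sub_apply, Matrix.one_apply_ne h.ne, sub_zero] at h1
  · refine fun hA i j => ⟨fun h => ?_, fun h => ?_⟩
    · rw [Matrix.sub_apply]
      rcases h.eq_or_lt with rfl | h
      · rw [A.2.1, Matrix.one_apply_eq, sub_self]
      · rw [A.2.2 _ _ h, Matrix.one_apply_ne h.ne', sub_self]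
    · rw [Matrix.sub_apply, Matrix.one_apply_ne h.ne, sub_zero]
      exact hA i j h

/-- The cosets of `levelSubgroup` are described by the cosets of the entries. -/
theorem inv_mul_mem_levelSubgroup {A B : UT n 𝓜.carrier} : A⁻¹ * B ∈ 𝓜.levelSubgroup n ↔
    ∀ i j : Fin n, i < j → -A.1 i j + B.1 i j ∈ 𝓜.I ((j : ℕ) - i) := by
  have h1 : A⁻¹.1 * A.1 = 1 := congrArg Subtype.val (inv_mul_cancel A)
  have h2 : A.1 * A⁻¹.1 = 1 := congrArg Subtype.val (mul_inv_cancel A)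
  have h3 : A⁻¹ * B ∈ 𝓜.levelSubgroup n ↔ B.1 - A.1 ∈ 𝓜.levelMatrices n := by
    change A⁻¹.1 * B.1 - 1 ∈ 𝓜.levelMatrices n ↔ _
    constructor
    · intro h
      have := 𝓜.mul_mem_levelMatrices A h
      rwa [mul_sub, ← mul_assoc, h2, one_mul, mul_one] at this
    · intro h
      have := 𝓜.mul_mem_levelMatrices A⁻¹ h
      rwa [mul_sub, h1] at this
  rw [h3]
  constructor
  · intro h i j hij
    rw [neg_add_eq_sub]
    exact (h i j).2 hij
  · refine fun h i j => ⟨fun hij => ?_, fun hij => ?_⟩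
    · rw [Matrix.sub_apply]
      rcases hij.eq_or_lt with rfl | hij
      · rw [A.2.1, B.2.1, sub_self]
      · rw [A.2.2 _ _ hij, B.2.2 _ _ hij, sub_self]
    · rw [Matrix.sub_apply, ← neg_add_eq_sub]
      exact h i j hij

theorem toCosetMatrix_eq_iff {A B : UT n 𝓜.carrier} :
    𝓜.toCosetMatrix A = 𝓜.toCosetMatrix B ↔ A⁻¹ * B ∈ 𝓜.levelSubgroup n := by
  rw [inv_mul_mem_levelSubgroup, funext_iff]
  exact ⟨fun h i j hij => QuotientAddGroup.eq.1 (h ⟨(i, j), hij⟩),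
    fun h p => QuotientAddGroup.eq.2 (h p.1.1 p.1.2 p.2)⟩

theorem toCosetMatrix_surjective : Function.Surjective (𝓜.toCosetMatrix : UT n 𝓜.carrier → _) := by
  intro x
  refine ⟨⟨Matrix.of fun i j => if h : i < j then (x ⟨(i, j), h⟩).out else if i = j then 1 else 0,
    fun i => by simp, fun i j hij => by simp [hij.not_gt, hij.ne']⟩, funext fun p => ?_⟩
  refine Eq.trans (congrArg _ ?_) (Quotient.out_eq (x p))
  exact dif_pos p.2

theorem toCosetMatrix_mul [IsTopologicalRing R] (A B : UT n 𝓜.carrier) :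
    𝓜.toCosetMatrix (A * B) = 𝓜.cosetMatrixMul (𝓜.toCosetMatrix A) (𝓜.toCosetMatrix B) := by
  ext ⟨⟨i, j⟩, hij⟩
  change (((A * B).1 i j : 𝓜.carrier) : 𝓜.carrier ⧸ 𝓜.I ((j : ℕ) - i)) = _
  rw [UT.mul_apply_of_lt A B hij, QuotientAddGroup.mk_add, QuotientAddGroup.mk_add,
    ← QuotientAddGroup.mk'_apply (𝓜.I _) (∑ k, _), map_sum]
  refine congrArg _ (Finset.sum_congr rfl fun k _ => ?_)
  obtain ⟨k, hk, hk'⟩ := k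
  have h1 : (i : ℕ) < k := hk
  have h2 : (k : ℕ) < j := hk'
  exact (𝓜.cosetMul_mk (i := (k : ℕ) - i) (j := (j : ℕ) - k) (k := (j : ℕ) - i)
    (by omega) (by omega) (by omega) (by omega) _ _).symm

theorem isTopoSubgroup_levelSubgroup [IsTopologicalRing R] :
    𝓜.IsTopoSubgroup (𝓜.utCode n).c (𝓜.utCode n).c' (𝓜.levelSubgroup n) := by
  refine (𝓜.utCode_isGroupCode.isTopoSubgroup_iff _).2 ⟨fun A B hAB => ?_, ?_⟩
  · refine 𝓜.inv_mul_mem_levelSubgroup.2 fun i j hij => ?_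
    have := Fin.lt_def.1 hij
    exact 𝓜.isAddTypeInvariant_I (by omega) _ _ (by rw [tp_apply, tp_apply, hAB])
  · have h1 : (𝓜.levelSubgroup n : Set (UT n 𝓜.carrier)) = ⋂ (i : Fin n) (j : Fin n) (_ : i < j),
        (fun A : UT n 𝓜.carrier => A.1 i j) ⁻¹' (𝓜.I ((j : ℕ) - i)) := by
      ext A
      simp only [Set.mem_iInter]
      exact 𝓜.mem_levelSubgroup
    rw [h1]
    refine Code.IsOpenTD.iInter fun i => Code.IsOpenTD.iInter fun j =>
      Code.IsOpenTD.iInter fun hij => ?_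
    have := Fin.lt_def.1 hij
    exact Code.IsOpenTD.preimage (𝓜.tp_apply i j) (UT.continuous_apply i j)
      (𝓜.isOpenTD_I (by omega))

theorem isTopoSubgroup_utComponent :
    𝓜.IsTopoSubgroup (𝓜.utCode n).c (𝓜.utCode n).c' (𝓜.utComponent n) :=
  𝓜.utCode_isGroupCode.isTopoSubgroup_topoComponent

theorem utComponent_le {K : Subgroup (UT n 𝓜.carrier)}
    (hK : 𝓜.IsTopoSubgroup (𝓜.utCode n).c (𝓜.utCode n).c' K) : 𝓜.utComponent n ≤ K := sInf_le hK

theorem normal_utComponent [IsTopologicalRing R] : (𝓜.utComponent n).Normal :=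
  𝓜.utCode_isGroupCode.normal_of_minimal 𝓜.isTopoSubgroup_utComponent fun _ => 𝓜.utComponent_le

/-- The elements `x` of `R̄` for which the elementary matrix with entry `x` at `(i, j)` is in the
component of `UT n R̄`. -/
def elemPreimage {i j : Fin n} (h : i < j) : AddSubgroup 𝓜.carrier where
  carrier := {x | UT.elem h x ∈ 𝓜.utComponent n}
  zero_mem' := by
    rw [Set.mem_ofPred_eq, UT.elem_zero]
    exact Subgroup.one_mem _
  add_mem' := fun ha hb => by
    rw [Set.mem_ofPred_eq, ← UT.elem_mul_elem]
    exact Subgroup.mul_mem _ ha hb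
  neg_mem' := fun ha => by
    rw [Set.mem_ofPred_eq, UT.elem_neg]
    exact Subgroup.inv_mem _ ha

theorem I_one_le_elemPreimage [IsTopologicalRing R] {i j : Fin n} (h : i < j) :
    𝓜.I 1 ≤ 𝓜.elemPreimage h := by
  obtain ⟨hT, ho⟩ := (𝓜.utCode_isGroupCode.isTopoSubgroup_iff _).1
    (𝓜.isTopoSubgroup_utComponent (n := n))
  refine 𝓜.I_one_le ((𝓜.baseCode_isAddGroupCode.isAddTopoSubgroup_iff _).2 ⟨fun x y hxy => ?_, ?_⟩)
  · change UT.elem h (-x + y) ∈ 𝓜.utComponent n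
    rw [← UT.elem_mul_elem, UT.elem_neg]
    exact hT _ _ (by rw [tp_elem, tp_elem, hxy])
  · exact Code.IsOpenTD.preimage (𝓜.tp_elem h) (UT.continuous_elem h) ho

/-- By induction on `j - i`, from the commutators of elementary matrices. -/
theorem I_le_elemPreimage [IsTopologicalRing R] (d : ℕ) : ∀ {i j : Fin n} (h : i < j),
    (j : ℕ) - i = d + 1 → 𝓜.I (d + 1) ≤ 𝓜.elemPreimage h := by
  induction d with
  | zero => exact fun h _ => 𝓜.I_one_le_elemPreimage h
  | succ d ih =>
    intro i j h hd
    have hT : 𝓜.baseCode.IsTD (𝓜.elemPreimage h : Set 𝓜.carrier) := Code.IsTD.preimage (𝓜.tp_elem h)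
      ((𝓜.utCode_isGroupCode.isTopoSubgroup_iff _).1 𝓜.isTopoSubgroup_utComponent).2.isTD
    refine 𝓜.genTypeDefinable_le hT fun r x hx => ?_
    let l : Fin n := ⟨i + 1, by have := j.2; omega⟩
    have hil : i < l := Fin.lt_def.2 (Nat.lt_succ_self _)
    have hlj : l < j := Fin.lt_def.2 (by change (i : ℕ) + 1 < j; omega)
    have hx' : UT.elem hlj x ∈ 𝓜.utComponent n :=
      ih hlj (by change (j : ℕ) - (i + 1) = d + 1; omega) hx
    change UT.elem h (r * x) ∈ 𝓜.utComponent n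
    rw [← UT.elem_commutator hil hlj]
    exact Subgroup.mul_mem _ (𝓜.normal_utComponent.conj_mem _ hx' _) (Subgroup.inv_mem _ hx')

/-- A matrix with entries in the groups `I (j - i)` is a product of elementary matrices: row
operations remove the entries above the diagonal, beginning with the last row. -/
theorem levelSubgroup_le_utComponent [IsTopologicalRing R] :
    𝓜.levelSubgroup n ≤ 𝓜.utComponent n := by
  have key : ∀ T : Finset (Fin n × Fin n), ∀ A ∈ 𝓜.levelSubgroup n,
      (∀ i j, i < j → (i, j) ∉ T → A.1 i j = 0) → A ∈ 𝓜.utComponent n := by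
    intro T
    induction T using Finset.induction_on_max_value (fun p : Fin n × Fin n => p.1) with
    | empty =>
      intro A _ hA
      have : A = 1 := by
        refine Subtype.ext (Matrix.ext fun i j => ?_)
        change A.1 i j = (1 : Matrix (Fin n) (Fin n) 𝓜.carrier) i j
        rcases lt_trichotomy i j with h | rfl | h
        · rw [hA i j h (Finset.notMem_empty _), Matrix.one_apply_ne h.ne]
        · rw [A.2.1, Matrix.one_apply_eq]
        · rw [A.2.2 _ _ h, Matrix.one_apply_ne h.ne']
      rw [this]
      exact Subgroup.one_mem _
    | insert a T _ hmax ih =>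
      obtain ⟨i, j⟩ := a
      intro A hAl hA
      by_cases hij : i < j
      · have hd := Fin.lt_def.1 hij
        have hmem : ∀ x ∈ 𝓜.I ((j : ℕ) - i), UT.elem hij x ∈ 𝓜.utComponent n := by
          obtain ⟨d, hd'⟩ := Nat.exists_eq_add_of_le' (show 1 ≤ (j : ℕ) - i by omega)
          rw [hd']
          exact 𝓜.I_le_elemPreimage d hij hd'
        have hAij := 𝓜.mem_levelSubgroup.1 hAl i j hij
        -- the row `j` of `A` is that of the identity matrix, as `j > i`
        have hrow : ∀ q, A.1 j q = if q = j then 1 else 0 := fun q => by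
          split_ifs with hq
          · rw [hq, A.2.1]
          · rcases lt_or_gt_of_ne hq with hq | hq
            · exact A.2.2 _ _ hq
            · refine hA j q hq fun hmem => ?_
              rcases Finset.mem_insert.1 hmem with h | h
              · exact hij.ne' (congrArg Prod.fst h)
              · exact hij.not_ge (hmax _ h)
        have hB : ∀ p q, (UT.elem hij (-A.1 i j) * A).1 p q =
            if p = i ∧ q = j then 0 else A.1 p q := fun p q => by
          rw [UT.elem_mul_apply, hrow]
          by_cases hp : p = i
          · by_cases hq : q = j
            · simp [hp, hq]
            · simp [hq]
          · simp [hp]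
        have hBN : UT.elem hij (-A.1 i j) * A ∈ 𝓜.utComponent n := by
          refine ih _ (𝓜.mem_levelSubgroup.2 fun p q hpq => ?_) fun p q hpq hT => ?_
          · rw [hB]
            split_ifs
            exacts [AddSubgroup.zero_mem _, 𝓜.mem_levelSubgroup.1 hAl p q hpq]
          · rw [hB]
            split_ifs with h
            · rfl
            · refine hA p q hpq fun hmem => ?_
              rcases Finset.mem_insert.1 hmem with h' | h'
              exacts [h ⟨congrArg Prod.fst h', congrArg Prod.snd h'⟩, hT h']
        have := Subgroup.mul_mem _ (hmem _ hAij) hBN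
        rwa [UT.elem_neg, mul_inv_cancel_left] at this
      · refine ih A hAl fun p q hpq hT => hA p q hpq fun hmem => ?_
        rcases Finset.mem_insert.1 hmem with h | h
        · obtain ⟨rfl, rfl⟩ := Prod.mk.inj h
          exact hij hpq
        · exact hT h
  exact fun A hA => key Finset.univ A hA fun i j _ h => absurd (Finset.mem_univ _) h

theorem utComponent_eq_levelSubgroup [IsTopologicalRing R] :
    𝓜.utComponent n = 𝓜.levelSubgroup n :=
  le_antisymm (𝓜.utComponent_le 𝓜.isTopoSubgroup_levelSubgroup) 𝓜.levelSubgroup_le_utComponent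

variable (n) in
theorem isGroupLogicQuotient_utComponent :
    (𝓜.utCode n).IsGroupLogicQuotient (𝓜.utComponent n) := by
  obtain ⟨hT, ho⟩ := (𝓜.utCode_isGroupCode.isTopoSubgroup_iff _).1
    (𝓜.isTopoSubgroup_utComponent (n := n))
  exact ⟨hT, ho.isTD, hT.isClosed_iff⟩

variable (n) in
/-- Matrices modulo the component of `UT n R̄` are matrices of cosets. -/
noncomputable def cosetMatrixEquiv [IsTopologicalRing R] :
    (UT n 𝓜.carrier ⧸ 𝓜.utComponent n) ≃ 𝓜.CosetMatrix n :=
  Equiv.ofBijective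
    (Quotient.lift 𝓜.toCosetMatrix fun A B h => 𝓜.toCosetMatrix_eq_iff.2 (by
      rw [← utComponent_eq_levelSubgroup]
      exact (QuotientGroup.leftRel_apply (s := 𝓜.utComponent n)).1 h)) (by
    constructor
    · intro p q h
      induction p using QuotientGroup.induction_on with | _ A => ?_
      induction q using QuotientGroup.induction_on with | _ B => ?_
      refine QuotientGroup.eq.2 ?_
      rw [utComponent_eq_levelSubgroup]
      exact 𝓜.toCosetMatrix_eq_iff.1 h
    · intro x
      obtain ⟨A, hA⟩ := 𝓜.toCosetMatrix_surjective x
      exact ⟨A, hA⟩)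

theorem cosetMatrixEquiv_mk [IsTopologicalRing R] (A : UT n 𝓜.carrier) :
    𝓜.cosetMatrixEquiv n (A : UT n 𝓜.carrier ⧸ 𝓜.utComponent n) = 𝓜.toCosetMatrix A := rfl

theorem continuous_cosetMatrixEquiv [IsTopologicalRing R] :
    Continuous (𝓜.cosetMatrixEquiv n) := by
  refine continuous_pi fun p => continuous_iff_isClosed.2 fun C hC => ?_
  have hp := Fin.lt_def.1 p.2
  rw [(𝓜.isGroupLogicQuotient_utComponent n).2.2]
  have h1 := ((𝓜.isAddGroupLogicQuotient_I (i := (p.1.2 : ℕ) - p.1.1) (by omega)).2.2 C).1 hC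
  exact Code.IsTD.preimage (𝓜.tp_apply p.1.1 p.1.2) h1

theorem t2Space_cosetMatrix : T2Space (𝓜.CosetMatrix n) := by
  have : ∀ p : {p : Fin n × Fin n // p.1 < p.2},
      T2Space (𝓜.carrier ⧸ 𝓜.I ((p.1.2 : ℕ) - (p.1.1 : ℕ))) := fun p => by
    have hp := Fin.lt_def.1 p.2
    exact (𝓜.isAddGroupLogicQuotient_I (by omega)).t2Space 𝓜.baseCode_isAddGroupCode
  infer_instance

end Level

end MonsterModel

theorem mainTheorem2 {R : Type u} [Ring R] [TopologicalSpace R] [IsTopologicalRing R]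
    (𝓜 : MonsterModel.{u, v} R) (n : ℕ) :
    -- `UT n (R̄)⁰⁰_topo` and `(R̄, +)⁰⁰_topo` do have the properties of which they are smallest
    𝓜.IsTopoSubgroup (G := UT n R) UT.coords UT.coords (𝓜.utComponent n) ∧
    𝓜.IsAddTopoSubgroup (fun (x : R) (_ : Fin 1) => x) (fun (x : 𝓜.carrier) (_ : Fin 1) => x)
      (𝓜.I 1) ∧
    -- the closed sets of the logic topologies
    (∀ C : Set (UT n 𝓜.carrier ⧸ 𝓜.utComponent n),
      IsClosed C ↔ 𝓜.IsLogicClosed UT.coords (𝓜.utComponent n) C) ∧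
    (∀ i, 1 ≤ i → ∀ C : Set (𝓜.carrier ⧸ 𝓜.I i),
      IsClosed C ↔ 𝓜.IsAddLogicClosed (fun (x : 𝓜.carrier) (_ : Fin 1) => x) (𝓜.I i) C) ∧
    -- products of cosets do not depend on the representatives
    (∀ i j k, 1 ≤ i → 1 ≤ j → i < k → j < k → ∀ a b : 𝓜.carrier,
      𝓜.cosetMul k (a : 𝓜.carrier ⧸ 𝓜.I i) (b : 𝓜.carrier ⧸ 𝓜.I j) =
        ((a * b : 𝓜.carrier) : 𝓜.carrier ⧸ 𝓜.I k)) ∧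
    -- the Bohr compactification of `UT n R`, and the isomorphism with the group of coset matrices
    (∃ _ : (𝓜.utComponent n).Normal,
      IsBohrCompactification.{u, v, w}
        ((QuotientGroup.mk' (𝓜.utComponent n)).comp (UT.map 𝓜.embHom)) ∧
      ∃ _ : Group (𝓜.CosetMatrix n),
        (∀ x y : 𝓜.CosetMatrix n, x * y = 𝓜.cosetMatrixMul x y) ∧
        ∃ e : (UT n 𝓜.carrier ⧸ 𝓜.utComponent n) ≃ₜ* 𝓜.CosetMatrix n,
          ∀ A : UT n 𝓜.carrier, e (A : UT n 𝓜.carrier ⧸ 𝓜.utComponent n) = 𝓜.toCosetMatrix A) ∧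
    -- the Bohr compactification of `(R, +)`
    IsAddBohrCompactification.{u, v, w}
      ((QuotientAddGroup.mk' (𝓜.I 1)).comp 𝓜.embHom.toAddMonoidHom) := by
  have hQ := 𝓜.isGroupLogicQuotient_utComponent n
  have hN := 𝓜.normal_utComponent (n := n)
  refine ⟨𝓜.isTopoSubgroup_utComponent, 𝓜.isAddTopoSubgroup_I_one,
    fun C => (hQ.2.2 C).trans (hQ.1.isLogicClosed_iff C).symm,
    fun i hi C => ((𝓜.isAddGroupLogicQuotient_I hi).2.2 C).trans
      ((𝓜.isAddTypeInvariant_I hi).isAddLogicClosed_iff C).symm,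
    fun i j k hi hj hik hjk a b => 𝓜.cosetMul_mk hi hj hik hjk a b, ⟨hN, ?_, ?_⟩, ?_⟩
  · exact hQ.isBohrCompactification 𝓜.utCode_isGroupCode
      ((𝓜.utCode_isGroupCode.isTopoSubgroup_iff _).1 𝓜.isTopoSubgroup_utComponent).2
      (fun _ => 𝓜.utComponent_le) _ fun _ => rfl
  · let e := 𝓜.cosetMatrixEquiv n
    let g : Group (𝓜.CosetMatrix n) := e.symm.group
    have hmul : ∀ x y : 𝓜.CosetMatrix n, x * y = e (e.symm x * e.symm y) := fun _ _ => rfl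
    have hcompact := hQ.compactSpace
    have ht2 := 𝓜.t2Space_cosetMatrix (n := n)
    refine ⟨g, fun x y => ?_, ⟨⟨e, fun p q => ?_⟩, 𝓜.continuous_cosetMatrixEquiv,
      (𝓜.continuous_cosetMatrixEquiv.homeoOfEquivCompactToT2 (f := e)).continuous_symm⟩,
      fun A => rfl⟩
    · obtain ⟨A, rfl⟩ := 𝓜.toCosetMatrix_surjective x
      obtain ⟨B, rfl⟩ := 𝓜.toCosetMatrix_surjective y
      rw [hmul, ← 𝓜.cosetMatrixEquiv_mk, ← 𝓜.cosetMatrixEquiv_mk, Equiv.symm_apply_apply,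
        Equiv.symm_apply_apply, ← QuotientGroup.mk_mul]
      exact 𝓜.toCosetMatrix_mul A B
    · change e (p * q) = e p * e q
      rw [hmul, Equiv.symm_apply_apply, Equiv.symm_apply_apply]
  · exact (𝓜.isAddGroupLogicQuotient_I le_rfl).isBohrCompactification
      𝓜.baseCode_isAddGroupCode 𝓜.isOpenTD_I_one (fun _ => 𝓜.I_one_le) _ fun _ => rfl
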